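/- **Setting.** Let $X$ be a compact topological space, $Y\subset X$ closed, $n\in\mathbb N$, $J=\begin{pmatrix}0&-I_n\\ I_n&0\end{pmatrix}$, $S^1=\mathbb R/2\pi\mathbb Z$. Let $\mathcal H:X\times\mathbb R\times\mathbb R^{2n}\to\mathbb R$ be such that every $\mathcal H_\lambda=\mathcal H(\lambda,\cdot,\cdot)$ is $C^2$, with $\mathcal H$ and all partial derivatives of $\mathcal H_\lambda$ of order at most $2$ continuous on $X\times\mathbb R\times\mathbb R^{2n}$; $\mathcal H$ is $2\pi$-periodic in $t$; $\nabla_u\mathcal H(\lambda,t,0)=0$; and there are $a,b\ge 0$, $r>1$ with $|\nabla_u\mathcal H(\lambda,t,u)|\le a+b|u|^r$ and $|D_u\nabla_u\mathcal H(\lambda,t,u)|\le a+b|u|^r$ for all $(\lambda,t,u)$. Put $S_\lambda(t)=D_u\nabla_u\mathcal H(\lambda,t,0)$. **Function spaces.** Write $u(t)=c_0+\sum_{k\ge1}(a_k\sin kt+b_k\cos kt)$. For $\sigma\in\{\frac12,1\}$ the space $H^{\sigma}(S^1,\mathbb K^{2n})$, $\mathbb K\in\{\mathbb R,\mathbb C\}$,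 consists of the $u\in L^2$ with $\sum_k k^{2\sigma}(|a_k|^2+|b_k|^2)<\infty$, with scalar product $2\pi\langle c_0,\tilde c_0\rangle+\pi\sum_k k^{2\sigma}(\langle a_k,\tilde a_k\rangle+\langle b_k,\tilde b_k\rangle)$. On $H^{1/2}(S^1,\mathbb R^{2n})$ let $P_\pm$ be the orthogonal projections onto $E_\pm=\{\sum_{k\ge1}(a_k\cos kt\mp Ja_k\sin kt)\}$, and $$\psi_\lambda(u)=\tfrac12\langle P_+u-P_-u,u\rangle_{H^{1/2}}+\int_0^{2\pi}\mathcal H(\lambda,t,u(t))\,dt .$$ Let $L_\lambda$ be the Hessian of $\psi_\lambda$ at $u=0$, that is, the derivative at $0$ of the $H^{1/2}$-gradient of $\psi_\lambda$. The family $\mathcal H$ is called admissible if $L_\lambda$ is invertible for all $\lambda\in Y$. **K-theory and index bundles.** For a space $Z$ and a closed $B\subset Z$, $K(Z,B)$ is the set of classes $[E_0,E_1,a]$ of triples of complex vector bundles $E_0,E_1$ over $Z$ and a bundle morphism $a:E_0\to E_1$ whose support $\{z: a_z\text{ is not an isomorphism}\}$ is a compact subset of $Z\setminus B$. Two triples are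 homotopic if they are isomorphic to the restrictions to $Z\times\{0\}$ and $Z\times\{1\}$ of such a triple on $(Z\times[0,1],B\times[0,1])$. Two triples have the same class if they become homotopic after adding (as direct summands) triples with empty support. Put $K^{-1}(X,Y)=K(X\times\mathbb R,Y\times\mathbb R)$, and write $\Theta(V)$ for the product bundle with fibre $V$. Let $W\hookrightarrow H$ be complex Hilbert spaces, $W$ dense in $H$. For a norm-continuous family $T:Z\to\mathcal L(W,H)$ of Fredholm operators of index $0$, invertible on $B$ and outside a compact set, put $$\operatorname{ind}T=[E(T,V),\Theta(V),T|_{E(T,V)}]\in K(Z,B),\qquad E(T,V)_z=\{u\in W:T_zu\in V\},$$ where $V\subset H$ is any finite-dimensional subspace with $\operatorname{im}T_z+V=H$ for all $z$ (the class does not depend on $V$). For a norm-continuous family $D:X\to\mathcal L(W,H)$ of Fredholm operators that are selfadjoint as operators in $H$ with domain $W$ and invertible for $\lambda\in Y$, put $\operatorname{s-ind}D=\operatorname{ind}\big((\lambda,s)\mapsto D_\lambda+is\big)\in K^{-1}(X,Y)$. **The three indices.** Assume that $\mathcal H$ is admissible. - $\mu_{Morse}(\mathcal H)=\operatorname{s-ind}(L^{\mathbb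 C})$, with $L^{\mathbb C}_\lambda$ the complexification of $L_\lambda$, acting on $W=H=H^{1/2}(S^1,\mathbb C^{2n})$. - $\mu_{spec}(\mathcal H)=\operatorname{s-ind}(\mathcal A^{\mathbb C})$, with $\mathcal A^{\mathbb C}_\lambda u=Ju'+S_\lambda u$, $W=H^1(S^1,\mathbb C^{2n})$, $H=L^2(S^1,\mathbb C^{2n})$. - $\mu_{mon}(\mathcal H)=[\Theta(\mathbb C^{2n}),\Theta(\mathbb C^{2n}),\Lambda]$, with $\Lambda(\lambda,s)=(I_{2n}-\Psi_{(\lambda,s)}(2\pi))^T$, where $\Psi_{(\lambda,s)}:[0,2\pi]\to M(2n,\mathbb C)$ solves $J\Psi'+S_\lambda(t)\Psi+is\Psi=0$, $\Psi(0)=I_{2n}$. **Theorem 3.4.** If $\mathcal H$ is admissible, these three indices are well defined and $$\mu_{Morse}(\mathcal H)=\mu_{spec}(\mathcal H)=\mu_{mon}(\mathcal H)\in K^{-1}(X,Y).$$ -/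

import Mathlib

open MeasureTheory Matrix

universe u

namespace HamiltonianIndex

noncomputable section



/-- The space `𝕜^{2n}` with its Euclidean scalar product, `𝕜 = ℝ` or `ℂ`. -/
abbrev Vec (𝕜 : Type) [RCLike 𝕜] (n : ℕ) : Type := EuclideanSpace 𝕜 (Fin n ⊕ Fin n)

/-- The matrix-vector product on `𝕜^{2n}`. -/
def matVec {𝕜 : Type} [RCLike 𝕜] {n : ℕ} (M : Matrix (Fin n ⊕ Fin n) (Fin n ⊕ Fin n) 𝕜)
    (v : Vec 𝕜 n) : Vec 𝕜 n :=
  WithLp.toLp 2 (M *ᵥ v.ofLp)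

/-- The weights of the scalar product of `H^{m/2}(S¹)`: `2π` for the constant mode, `π |k|^m` for
the modes `cos kt` and `sin kt`. -/
def weight (m : ℕ) (k : ℤ) : ℝ :=
  if k = 0 then 2 * Real.pi else Real.pi * ((|k| : ℤ) : ℝ) ^ m

theorem weight_pos (m : ℕ) (k : ℤ) : 0 < weight m k := by
  unfold weight
  split_ifs with h
  · positivity
  · have : 0 < |k| := abs_pos.mpr h
    have : (0 : ℝ) < ((|k| : ℤ) : ℝ) := by exact_mod_cast this
    positivity

theorem weight_mono {m m' : ℕ} (h : m ≤ m') (k : ℤ) : weight m k ≤ weight m' k := by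
  unfold weight
  split_ifs with hk
  · exact le_rfl
  · have : 0 < |k| := abs_pos.mpr hk
    have h1 : (1 : ℝ) ≤ ((|k| : ℤ) : ℝ) := by exact_mod_cast this
    gcongr

/-- Families of Fourier coefficients `c : ℤ → 𝕜^{2n}` with `∑ weight m k |c k|² < ∞`. -/
def Sobolev.submodule (𝕜 : Type) [RCLike 𝕜] (n m : ℕ) : Submodule 𝕜 (ℤ → Vec 𝕜 n) where
  carrier := {c | Summable fun k => weight m k * ‖c k‖ ^ 2}
  zero_mem' := by simp [summable_zero]
  add_mem' := by
    intro a b ha hb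
    refine Summable.of_nonneg_of_le (fun k => ?_) (fun k => ?_) ((ha.add hb).mul_left 2)
    · have := (weight_pos m k).le; positivity
    · have h1 := norm_add_le (a k) (b k)
      have h2 : ‖a k + b k‖ ^ 2 ≤ 2 * (‖a k‖ ^ 2 + ‖b k‖ ^ 2) := by
        nlinarith [sq_nonneg (‖a k‖ - ‖b k‖), norm_nonneg (a k + b k)]
      have := mul_le_mul_of_nonneg_left h2 (weight_pos m k).le
      simp only [Pi.add_apply]
      linarith
  smul_mem' := by
    intro r a ha
    have : (fun k => weight m k * ‖(r • a) k‖ ^ 2)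
        = fun k => ‖r‖ ^ 2 * (weight m k * ‖a k‖ ^ 2) := by
      funext k
      simp only [Pi.smul_apply, norm_smul]
      ring
    simp only [Set.mem_ofPred_eq, this]
    exact Summable.mul_left _ ha

/-- The Sobolev space `H^{m/2}(S¹, 𝕜^{2n})` of the functions
`u(t) = c₀ + ∑_{k ≥ 1} (a_k sin kt + b_k cos kt)` with `∑ k^m (|a_k|² + |b_k|²) < ∞`, given by their
Fourier coefficients. They are indexed by `ℤ`: index `0` is `c₀`, index `k > 0` is the cosine
coefficient `b_k` and index `-k < 0` is the sine coefficient `a_k`. See `toL2` for the function that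
belongs to the coefficients. `m = 1` is `H^{1/2}`, `m = 2` is `H¹`. -/
def Sobolev (𝕜 : Type) [RCLike 𝕜] (n m : ℕ) : Type := Sobolev.submodule 𝕜 n m

namespace Sobolev

variable {𝕜 : Type} [RCLike 𝕜] {n m : ℕ}

instance : AddCommGroup (Sobolev 𝕜 n m) :=
  inferInstanceAs (AddCommGroup (Sobolev.submodule 𝕜 n m))

instance : Module 𝕜 (Sobolev 𝕜 n m) :=
  inferInstanceAs (Module 𝕜 (Sobolev.submodule 𝕜 n m))

/-- The Fourier coefficient with index `k`. -/
def coeff (u : Sobolev 𝕜 n m) (k : ℤ) : Vec 𝕜 n := u.1 k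

theorem summable_coeff (u : Sobolev 𝕜 n m) :
    Summable fun k => weight m k * ‖u.coeff k‖ ^ 2 := u.2

theorem ext {u v : Sobolev 𝕜 n m} (h : ∀ k, u.coeff k = v.coeff k) : u = v :=
  Subtype.ext (funext h)

@[simp] theorem coeff_add (u v : Sobolev 𝕜 n m) (k : ℤ) :
    (u + v).coeff k = u.coeff k + v.coeff k := rfl

@[simp] theorem coeff_smul (a : 𝕜) (u : Sobolev 𝕜 n m) (k : ℤ) :
    (a • u).coeff k = a • u.coeff k := rfl

theorem norm_sqrt_smul_sq {w : ℝ} (hw : 0 ≤ w) (v : Vec 𝕜 n) :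
    ‖((√w : ℝ) : 𝕜) • v‖ ^ 2 = w * ‖v‖ ^ 2 := by
  rw [norm_smul, mul_pow, RCLike.norm_ofReal, sq_abs, Real.sq_sqrt hw]

theorem memlp_of_le (u : Sobolev 𝕜 n m) {m' : ℕ} (h : m' ≤ m) :
    Memℓp (fun k => ((√(weight m' k) : ℝ) : 𝕜) • u.coeff k) 2 := by
  rw [memℓp_gen_iff (by norm_num)]
  refine Summable.of_nonneg_of_le (fun k => by positivity) (fun k => ?_) u.summable_coeff
  have := norm_sqrt_smul_sq (weight_pos m' k).le (u.coeff k)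
  rw [ENNReal.toReal_ofNat, Real.rpow_ofNat, this]
  exact mul_le_mul_of_nonneg_right (weight_mono h k) (by positivity)

/-- The coefficients, scaled by `√(weight m' k)`, as an element of `ℓ²`. -/
def toLp (m' : ℕ) (h : m' ≤ m) : Sobolev 𝕜 n m →ₗ[𝕜] lp (fun _ : ℤ => Vec 𝕜 n) 2 where
  toFun u := ⟨fun k => ((√(weight m' k) : ℝ) : 𝕜) • u.coeff k, u.memlp_of_le h⟩
  map_add' u v := by ext k : 2; exact smul_add _ _ _
  map_smul' a u := by ext k : 2; exact smul_comm ((√(weight m' k) : ℝ) : 𝕜) a (u.coeff k)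

theorem toLp_apply {m' : ℕ} (h : m' ≤ m) (u : Sobolev 𝕜 n m) (k : ℤ) :
    toLp m' h u k = ((√(weight m' k) : ℝ) : 𝕜) • u.coeff k := rfl

/-- The scalar product `2π⟪c₀, c₀'⟫ + π ∑_{k ≥ 1} k^m (⟪a_k, a_k'⟫ + ⟪b_k, b_k'⟫)`. -/
instance : Inner 𝕜 (Sobolev 𝕜 n m) :=
  ⟨fun u v => ∑' k, (weight m k : 𝕜) * inner 𝕜 (u.coeff k) (v.coeff k)⟩

theorem inner_def (u v : Sobolev 𝕜 n m) :
    inner 𝕜 u v = ∑' k, (weight m k : 𝕜) * inner 𝕜 (u.coeff k) (v.coeff k) := rfl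

theorem inner_eq_toLp (u v : Sobolev 𝕜 n m) :
    inner 𝕜 u v = inner 𝕜 (toLp m le_rfl u) (toLp m le_rfl v) := by
  rw [inner_def, lp.inner_eq_tsum]
  congr 1
  funext k
  rw [toLp_apply, toLp_apply, inner_smul_left, inner_smul_right, RCLike.conj_ofReal, ← mul_assoc,
    ← RCLike.ofReal_mul, Real.mul_self_sqrt (weight_pos m k).le]

theorem toLp_injective {m' : ℕ} (h : m' ≤ m) :
    Function.Injective (toLp (𝕜 := 𝕜) (n := n) m' h) := by
  intro u v huv
  refine ext fun k => ?_
  have := congrArg (fun f : lp (fun _ : ℤ => Vec 𝕜 n) 2 => f k) huv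
  simp only [toLp_apply] at this
  have hk : ((√(weight m' k) : ℝ) : 𝕜) ≠ 0 := by
    simpa using (Real.sqrt_pos.mpr (weight_pos m' k)).ne'
  exact smul_right_injective _ hk this

theorem toLp_surjective : Function.Surjective (toLp (𝕜 := 𝕜) (n := n) m le_rfl) := by
  intro f
  have hw : ∀ k, ((√(weight m k) : ℝ) : 𝕜) ≠ 0 := fun k => by
    simpa using (Real.sqrt_pos.mpr (weight_pos m k)).ne'
  have h : ∀ k, ((√(weight m k) : ℝ) : 𝕜) • (((√(weight m k) : ℝ) : 𝕜)⁻¹ • f k) = f k :=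
    fun k => smul_inv_smul₀ (hw k) _
  refine ⟨⟨fun k => ((√(weight m k) : ℝ) : 𝕜)⁻¹ • f k, ?_⟩, ?_⟩
  · have hf := (memℓp_gen_iff (p := 2) (by norm_num)).mp (lp.memℓp f)
    change Summable _
    refine hf.congr fun k => ?_
    rw [← norm_sqrt_smul_sq (𝕜 := 𝕜) (weight_pos m k).le, h]
    norm_num
  · ext k : 2
    exact h k

/-- The scalar product is positive definite. -/
@[reducible] def core : InnerProductSpace.Core 𝕜 (Sobolev 𝕜 n m) where
  inner := inner 𝕜
  conj_inner_symm u v := by simp only [inner_eq_toLp]; exact inner_conj_symm _ _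
  re_inner_nonneg u := by rw [inner_eq_toLp]; exact inner_self_nonneg
  add_left u v w := by simp only [inner_eq_toLp, map_add]; exact inner_add_left _ _ _
  smul_left u v a := by simp only [inner_eq_toLp, map_smul]; exact inner_smul_left _ _ _
  definite u h := by
    rw [inner_eq_toLp, inner_self_eq_zero] at h
    exact toLp_injective le_rfl (by rw [h, map_zero])

instance : NormedAddCommGroup (Sobolev 𝕜 n m) :=
  @InnerProductSpace.Core.toNormedAddCommGroup 𝕜 _ _ _ _ core

instance : InnerProductSpace 𝕜 (Sobolev 𝕜 n m) := InnerProductSpace.ofCore core.toCore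

theorem norm_toLp (u : Sobolev 𝕜 n m) : ‖toLp m le_rfl u‖ = ‖u‖ := by
  rw [@norm_eq_sqrt_re_inner 𝕜, @norm_eq_sqrt_re_inner 𝕜 (Sobolev 𝕜 n m), inner_eq_toLp]

/-- The scaled coefficients identify `H^{m/2}` with `ℓ²`, isometrically. -/
def toLpEquiv : Sobolev 𝕜 n m ≃ₗᵢ[𝕜] lp (fun _ : ℤ => Vec 𝕜 n) 2 :=
  ⟨LinearEquiv.ofBijective (toLp m le_rfl) ⟨toLp_injective le_rfl, toLp_surjective⟩, norm_toLp⟩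

instance : CompleteSpace (Sobolev 𝕜 n m) :=
  (toLpEquiv (𝕜 := 𝕜) (n := n) (m := m)).toIsometryEquiv.completeSpace


theorem norm_toLp_le {m' : ℕ} (h : m' ≤ m) (u : Sobolev 𝕜 n m) : ‖toLp m' h u‖ ≤ ‖u‖ := by
  rw [← norm_toLp u]
  refine lp.norm_mono (by norm_num) fun k => ?_
  rw [toLp_apply, toLp_apply, norm_smul, norm_smul, RCLike.norm_ofReal, RCLike.norm_ofReal,
    abs_of_nonneg (Real.sqrt_nonneg _), abs_of_nonneg (Real.sqrt_nonneg _)]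
  exact mul_le_mul_of_nonneg_right (Real.sqrt_le_sqrt (weight_mono h k)) (norm_nonneg _)

theorem continuous_coeff (k : ℤ) : Continuous fun u : Sobolev 𝕜 n m => u.coeff k := by
  have hk : ((√(weight m k) : ℝ) : 𝕜) ≠ 0 := by
    simpa using (Real.sqrt_pos.mpr (weight_pos m k)).ne'
  have h : (fun u : Sobolev 𝕜 n m => u.coeff k)
      = fun u => ((√(weight m k) : ℝ) : 𝕜)⁻¹ • toLpEquiv u k := by
    funext u
    exact (inv_smul_smul₀ hk (u.coeff k)).symm
  rw [h]
  have h1 : Continuous fun f : lp (fun _ : ℤ => Vec 𝕜 n) 2 => f k :=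
    (lp.evalCLM 𝕜 (fun _ : ℤ => Vec 𝕜 n) 2 k).continuous
  exact (h1.comp toLpEquiv.continuous).const_smul (((√(weight m k) : ℝ) : 𝕜)⁻¹)

end Sobolev

/-- The mode with index `k`: `cos kt` for `k ≥ 0` (so `1` for `k = 0`), `sin |k|t` for `k < 0`. -/
def trig (k : ℤ) (t : ℝ) : ℝ :=
  if 0 ≤ k then Real.cos (k * t) else Real.sin (-k * t)

theorem continuous_trig (k : ℤ) : Continuous (trig k) := by
  unfold trig
  split_ifs <;> fun_prop

/-- Lebesgue measure on a period `(0, 2π]`. -/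
abbrev circleMeasure : Measure ℝ := volume.restrict (Set.Ioc 0 (2 * Real.pi))

/-- The Hilbert space `L²(S¹, 𝕜^{2n})`, with scalar product `∫₀^{2π} ⟪u, v⟫ dt`. -/
abbrev L2 (𝕜 : Type) [RCLike 𝕜] (n : ℕ) : Type := Lp (Vec 𝕜 n) 2 circleMeasure

theorem integral_cos_int {j : ℤ} (hj : j ≠ 0) :
    ∫ t in (0 : ℝ)..(2 * Real.pi), Real.cos (j * t) = 0 := by
  have hj' : (j : ℝ) ≠ 0 := by exact_mod_cast hj
  rw [intervalIntegral.integral_comp_mul_left (fun x => Real.cos x) hj', integral_cos]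
  have h := Real.sin_int_mul_pi (j * 2)
  push_cast at h
  have h2 : (j : ℝ) * (2 * Real.pi) = j * 2 * Real.pi := by ring
  simp [h2, h]

theorem integral_sin_int (j : ℤ) :
    ∫ t in (0 : ℝ)..(2 * Real.pi), Real.sin (j * t) = 0 := by
  by_cases hj : j = 0
  · simp [hj]
  have hj' : (j : ℝ) ≠ 0 := by exact_mod_cast hj
  rw [intervalIntegral.integral_comp_mul_left (fun x => Real.sin x) hj', integral_sin]
  have h := Real.cos_int_mul_two_pi j
  simp [h]

theorem integral_cos_cos (j k : ℤ) : ∫ t in (0 : ℝ)..(2 * Real.pi),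
    (Real.cos (j * t) * Real.cos (k * t)) =
      ((if j - k = 0 then 2 * Real.pi else 0) + (if j + k = 0 then 2 * Real.pi else 0)) / 2 := by
  have h : ∀ t : ℝ, Real.cos (j * t) * Real.cos (k * t)
      = (Real.cos ((j - k : ℤ) * t) + Real.cos ((j + k : ℤ) * t)) / 2 := by
    intro t
    push_cast
    rw [sub_mul, add_mul, Real.cos_sub, Real.cos_add]
    ring
  have hc : ∀ i : ℤ, ∫ t in (0 : ℝ)..(2 * Real.pi), Real.cos (i * t)
      = if i = 0 then 2 * Real.pi else 0 := by
    intro i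
    split_ifs with hi
    · simp [hi]
    · exact integral_cos_int hi
  simp_rw [h]
  rw [intervalIntegral.integral_div, intervalIntegral.integral_add, hc, hc]
  · exact Continuous.intervalIntegrable (by fun_prop) _ _
  · exact Continuous.intervalIntegrable (by fun_prop) _ _

theorem integral_sin_sin (j k : ℤ) : ∫ t in (0 : ℝ)..(2 * Real.pi),
    (Real.sin (j * t) * Real.sin (k * t)) =
      ((if j - k = 0 then 2 * Real.pi else 0) - (if j + k = 0 then 2 * Real.pi else 0)) / 2 := by
  have h : ∀ t : ℝ, Real.sin (j * t) * Real.sin (k * t)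
      = (Real.cos ((j - k : ℤ) * t) - Real.cos ((j + k : ℤ) * t)) / 2 := by
    intro t
    push_cast
    rw [sub_mul, add_mul, Real.cos_sub, Real.cos_add]
    ring
  have hc : ∀ i : ℤ, ∫ t in (0 : ℝ)..(2 * Real.pi), Real.cos (i * t)
      = if i = 0 then 2 * Real.pi else 0 := by
    intro i
    split_ifs with hi
    · simp [hi]
    · exact integral_cos_int hi
  simp_rw [h]
  rw [intervalIntegral.integral_div, intervalIntegral.integral_sub, hc, hc]
  · exact Continuous.intervalIntegrable (by fun_prop) _ _
  · exact Continuous.intervalIntegrable (by fun_prop) _ _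

theorem integral_sin_cos (j k : ℤ) : ∫ t in (0 : ℝ)..(2 * Real.pi),
    (Real.sin (j * t) * Real.cos (k * t)) = 0 := by
  have h : ∀ t : ℝ, Real.sin (j * t) * Real.cos (k * t)
      = (Real.sin ((j - k : ℤ) * t) + Real.sin ((j + k : ℤ) * t)) / 2 := by
    intro t
    push_cast
    rw [sub_mul, add_mul, Real.sin_sub, Real.sin_add]
    ring
  simp_rw [h]
  rw [intervalIntegral.integral_div, intervalIntegral.integral_add, integral_sin_int,
    integral_sin_int]
  · simp
  · exact Continuous.intervalIntegrable (by fun_prop) _ _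
  · exact Continuous.intervalIntegrable (by fun_prop) _ _

theorem integral_trig_mul_trig (j k : ℤ) :
    ∫ t in (0 : ℝ)..(2 * Real.pi), trig j t * trig k t = if j = k then weight 0 k else 0 := by
  have e : ∀ (i : ℤ) (t : ℝ), -(i : ℝ) * t = ((-i : ℤ) : ℝ) * t := by intros; push_cast; rfl
  unfold trig weight
  by_cases hj : 0 ≤ j <;> by_cases hk : 0 ≤ k <;> simp only [hj, hk, if_true, if_false, e]
  · rw [integral_cos_cos]
    split_ifs <;> first | omega | simp
  · simp_rw [mul_comm (Real.cos _)]
    rw [integral_sin_cos, if_neg (by omega)]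
  · rw [integral_sin_cos, if_neg (by omega)]
  · rw [integral_sin_sin]
    split_ifs <;> first | omega | simp

theorem abs_trig_le_one (k : ℤ) (t : ℝ) : |trig k t| ≤ 1 := by
  unfold trig
  split_ifs
  · exact Real.abs_cos_le_one _
  · exact Real.abs_sin_le_one _

section

variable {𝕜 : Type} [RCLike 𝕜] {n m : ℕ}

theorem memLp_trig_smul (k : ℤ) (v : Vec 𝕜 n) :
    MemLp (fun t => ((trig k t : ℝ) : 𝕜) • v) 2 circleMeasure := by
  refine MemLp.of_bound (C := ‖v‖) ?_ (Filter.Eventually.of_forall fun t => ?_)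
  · have : Continuous fun t => ((trig k t : ℝ) : 𝕜) • v :=
      Continuous.smul (f := fun t => ((trig k t : ℝ) : 𝕜)) (g := fun _ => v)
        (RCLike.continuous_ofReal.comp (continuous_trig k)) continuous_const
    exact this.aestronglyMeasurable
  · rw [norm_smul, RCLike.norm_ofReal]
    exact mul_le_of_le_one_left (norm_nonneg _) (abs_trig_le_one k t)

/-- The function `t ↦ trig k t • v` as an element of `L²`. -/
def trigL2 (k : ℤ) : Vec 𝕜 n →ₗ[𝕜] L2 𝕜 n where
  toFun v := (memLp_trig_smul k v).toLp _
  map_add' v w := by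
    rw [← MemLp.toLp_add]
    congr 1
    funext t
    exact smul_add _ _ _
  map_smul' a v := by
    rw [RingHom.id_apply, ← MemLp.toLp_const_smul]
    congr 1
    funext t
    exact smul_comm _ _ _

theorem inner_trigL2 (j k : ℤ) (v w : Vec 𝕜 n) :
    inner 𝕜 (trigL2 j v) (trigL2 k w) = if j = k then (weight 0 k : 𝕜) * inner 𝕜 v w else 0 := by
  rw [L2.inner_def]
  have h : (fun t => inner 𝕜 ((trigL2 j v : L2 𝕜 n) t) ((trigL2 k w : L2 𝕜 n) t))
      =ᵐ[circleMeasure] fun t => ((trig j t * trig k t : ℝ) : 𝕜) * inner 𝕜 v w := by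
    filter_upwards [(memLp_trig_smul j v).coeFn_toLp, (memLp_trig_smul k w).coeFn_toLp]
      with t h1 h2
    change inner 𝕜 ((memLp_trig_smul j v).toLp _ t) ((memLp_trig_smul k w).toLp _ t) = _
    rw [h1, h2, inner_smul_left, inner_smul_right, RCLike.conj_ofReal]
    push_cast
    ring
  rw [integral_congr_ae h, integral_mul_const, integral_ofReal,
    ← intervalIntegral.integral_of_le (by positivity), integral_trig_mul_trig]
  split_ifs <;> simp

/-- The functions `trigL2 k v`, normalised. -/
def trigIsometry (k : ℤ) : Vec 𝕜 n →ₗᵢ[𝕜] L2 𝕜 n where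
  toLinearMap := ((√(weight 0 k) : ℝ) : 𝕜)⁻¹ • trigL2 k
  norm_map' v := by
    have hk : √(weight 0 k) ≠ 0 := (Real.sqrt_pos.mpr (weight_pos 0 k)).ne'
    have h : ‖(trigL2 k v : L2 𝕜 n)‖ = √(weight 0 k) * ‖v‖ := by
      rw [@norm_eq_sqrt_re_inner 𝕜, inner_trigL2, if_pos rfl, RCLike.re_ofReal_mul,
        Real.sqrt_mul (weight_pos 0 k).le, ← @norm_eq_sqrt_re_inner 𝕜]
    rw [LinearMap.smul_apply, norm_smul, h, norm_inv, RCLike.norm_ofReal,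
      abs_of_nonneg (Real.sqrt_nonneg _), inv_mul_cancel_left₀ hk]

theorem orthogonalFamily_trigIsometry :
    OrthogonalFamily 𝕜 (fun _ : ℤ => Vec 𝕜 n) (trigIsometry (𝕜 := 𝕜) (n := n)) := by
  intro j k hjk v w
  change inner 𝕜 (((√(weight 0 j) : ℝ) : 𝕜)⁻¹ • trigL2 j v : L2 𝕜 n)
    (((√(weight 0 k) : ℝ) : 𝕜)⁻¹ • trigL2 k w) = 0
  rw [inner_smul_left, inner_smul_right, inner_trigL2, if_neg hjk, mul_zero, mul_zero]

/-- The inclusion `H^{m/2}(S¹, 𝕜^{2n}) ↪ L²(S¹, 𝕜^{2n})`: it sends a family of Fourier coefficients to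
the function `∑ trig k • c k`, see `hasSum_toL2`. -/
def toL2 : Sobolev 𝕜 n m →L[𝕜] L2 𝕜 n :=
  LinearMap.mkContinuous
    (orthogonalFamily_trigIsometry.linearIsometry.toLinearMap ∘ₗ Sobolev.toLp 0 (Nat.zero_le m)) 1
    fun u => by
      rw [LinearMap.comp_apply, LinearIsometry.coe_toLinearMap, LinearIsometry.norm_map, one_mul]
      exact Sobolev.norm_toLp_le _ u

theorem toL2_injective : Function.Injective (toL2 (𝕜 := 𝕜) (n := n) (m := m)) := fun _ _ h =>
  Sobolev.toLp_injective (Nat.zero_le m)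
    (orthogonalFamily_trigIsometry.linearIsometry.injective h)

/-- The Fourier series of `u` converges in `L²` to the function that `u` stands for. -/
theorem hasSum_toL2 (u : Sobolev 𝕜 n m) :
    HasSum (fun k => (trigL2 k (u.coeff k) : L2 𝕜 n)) (toL2 u) := by
  have h := orthogonalFamily_trigIsometry.hasSum_linearIsometry (Sobolev.toLp 0 (Nat.zero_le m) u)
  refine (?_ : HasSum _ (toL2 u))
  have e : (fun k => (trigL2 k (u.coeff k) : L2 𝕜 n))
      = fun k => trigIsometry k (Sobolev.toLp 0 (Nat.zero_le m) u k) := ?_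
  · rw [e]
    exact h
  funext k
  change _ = ((√(weight 0 k) : ℝ) : 𝕜)⁻¹ • trigL2 k (((√(weight 0 k) : ℝ) : 𝕜) • u.coeff k)
  have hk : ((√(weight 0 k) : ℝ) : 𝕜) ≠ 0 := by
    simpa using (Real.sqrt_pos.mpr (weight_pos 0 k)).ne'
  rw [map_smul, inv_smul_smul₀ hk]

end



/-- A family of complex vector spaces over `X` with a topology on its total space. -/
structure VectorFamily (X : Type u) [TopologicalSpace X] : Type (max u 1) where
  Fiber : X → Type
  [addCommGroup : ∀ x, AddCommGroup (Fiber x)]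
  [module : ∀ x, Module ℂ (Fiber x)]
  topology : TopologicalSpace (Bundle.TotalSpace Unit Fiber)

attribute [instance] VectorFamily.addCommGroup VectorFamily.module

namespace VectorFamily

variable {X : Type u} [TopologicalSpace X] {X' : Type u} [TopologicalSpace X']

/-- The total space, the disjoint union of the fibres. -/
abbrev Total (E : VectorFamily X) : Type u := Bundle.TotalSpace Unit E.Fiber

instance (E : VectorFamily X) : TopologicalSpace E.Total := E.topology

/-- The family is a complex vector bundle of finite rank: the projection is continuous and near every
point there is a fibrewise linear homeomorphism `(π, φ) : π⁻¹(U) → U × ℂ^r` (the two continuity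
conditions are those for `φ` and for the inverse). The rank may vary between components. -/
def IsVectorBundle (E : VectorFamily X) : Prop :=
  Continuous (fun p : E.Total => p.proj) ∧
  ∀ x₀ : X, ∃ U : Set X, IsOpen U ∧ x₀ ∈ U ∧
    ∃ (r : ℕ) (φ : ∀ x : U, E.Fiber x ≃ₗ[ℂ] (Fin r → ℂ)),
      Continuous (fun p : {p : E.Total // p.proj ∈ U} => φ ⟨p.1.proj, p.2⟩ p.1.snd) ∧
      Continuous (fun q : U × (Fin r → ℂ) => (⟨q.1, (φ q.1).symm q.2⟩ : E.Total))

/-- The direct sum, with the topology of the fibre product of the total spaces. -/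
def prod (E F : VectorFamily X) : VectorFamily X where
  Fiber x := E.Fiber x × F.Fiber x
  topology := TopologicalSpace.induced
    (fun p => ((⟨p.proj, p.snd.1⟩, ⟨p.proj, p.snd.2⟩) : E.Total × F.Total)) inferInstance

theorem continuous_prod_pair (E F : VectorFamily X) :
    Continuous (fun p : (E.prod F).Total =>
      ((⟨p.proj, p.snd.1⟩, ⟨p.proj, p.snd.2⟩) : E.Total × F.Total)) :=
  continuous_induced_dom

theorem continuous_prod_fst (E F : VectorFamily X) :
    Continuous (fun p : (E.prod F).Total => (⟨p.proj, p.snd.1⟩ : E.Total)) :=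
  continuous_fst.comp (continuous_prod_pair E F)

theorem continuous_prod_snd (E F : VectorFamily X) :
    Continuous (fun p : (E.prod F).Total => (⟨p.proj, p.snd.2⟩ : F.Total)) :=
  continuous_snd.comp (continuous_prod_pair E F)

theorem IsVectorBundle.prod {E F : VectorFamily X} (hE : E.IsVectorBundle)
    (hF : F.IsVectorBundle) : (E.prod F).IsVectorBundle := by
  refine ⟨hE.1.comp (continuous_prod_fst E F), fun x₀ => ?_⟩
  obtain ⟨U, hU, hxU, r, φ, hφ, hφ'⟩ := hE.2 x₀
  obtain ⟨V, hV, hxV, s, ψ, hψ, hψ'⟩ := hF.2 x₀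
  let e : ((Fin r → ℂ) × (Fin s → ℂ)) ≃L[ℂ] (Fin (r + s) → ℂ) :=
    ContinuousLinearEquiv.ofFinrankEq (by simp)
  refine ⟨U ∩ V, hU.inter hV, ⟨hxU, hxV⟩, r + s, fun x =>
    ((φ ⟨x, x.2.1⟩).prodCongr (ψ ⟨x, x.2.2⟩)).trans e.toLinearEquiv, ?_, ?_⟩
  · refine e.continuous.comp (Continuous.prodMk ?_ ?_)
    · exact hφ.comp (((continuous_prod_fst E F).comp continuous_subtype_val).subtype_mk
        fun p => p.2.1)
    · exact hψ.comp (((continuous_prod_snd E F).comp continuous_subtype_val).subtype_mk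
        fun p => p.2.2)
  · refine continuous_induced_rng.mpr (Continuous.prodMk ?_ ?_)
    · exact hφ'.comp (Continuous.prodMk ((continuous_subtype_val.comp continuous_fst).subtype_mk
        fun q => q.1.2.1) (continuous_fst.comp (e.symm.continuous.comp continuous_snd)))
    · exact hψ'.comp (Continuous.prodMk ((continuous_subtype_val.comp continuous_fst).subtype_mk
        fun q => q.1.2.2) (continuous_snd.comp (e.symm.continuous.comp continuous_snd)))

/-- The pullback along `f`, with the topology of the fibre product `X' ×_X E`. -/
def pullback (f : X' → X) (E : VectorFamily X) : VectorFamily X' where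
  Fiber x := E.Fiber (f x)
  topology := TopologicalSpace.induced
    (fun p => ((p.proj, ⟨f p.proj, p.snd⟩) : X' × E.Total)) inferInstance

theorem continuous_pullback_pair (f : X' → X) (E : VectorFamily X) :
    Continuous (fun p : (E.pullback f).Total => ((p.proj, ⟨f p.proj, p.snd⟩) : X' × E.Total)) :=
  continuous_induced_dom

theorem IsVectorBundle.pullback {f : X' → X} (hf : Continuous f) {E : VectorFamily X}
    (hE : E.IsVectorBundle) : (E.pullback f).IsVectorBundle := by
  have h1 : Continuous (fun p : (E.pullback f).Total => p.proj) :=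
    continuous_fst.comp (continuous_pullback_pair f E)
  have h2 : Continuous (fun p : (E.pullback f).Total => (⟨f p.proj, p.snd⟩ : E.Total)) :=
    continuous_snd.comp (continuous_pullback_pair f E)
  refine ⟨h1, fun x₀ => ?_⟩
  obtain ⟨U, hU, hxU, r, φ, hφ, hφ'⟩ := hE.2 (f x₀)
  refine ⟨f ⁻¹' U, hU.preimage hf, hxU, r, fun x => φ ⟨f x, x.2⟩, ?_, ?_⟩
  · exact hφ.comp ((h2.comp continuous_subtype_val).subtype_mk fun p => p.2)
  · refine continuous_induced_rng.mpr (Continuous.prodMk ?_ ?_)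
    · exact continuous_subtype_val.comp continuous_fst
    · exact hφ'.comp (Continuous.prodMk ((hf.comp (continuous_subtype_val.comp
        continuous_fst)).subtype_mk fun q => q.1.2) continuous_snd)

/-- The product bundle `Θ(V) = X × V`. -/
def productBundle (X : Type u) [TopologicalSpace X] (V : Type) [NormedAddCommGroup V]
    [NormedSpace ℂ V] : VectorFamily X where
  Fiber _ := V
  topology := TopologicalSpace.induced (fun p => ((p.proj, p.snd) : X × V)) inferInstance

theorem isVectorBundle_productBundle (V : Type) [NormedAddCommGroup V] [NormedSpace ℂ V]
    [FiniteDimensional ℂ V] : (productBundle X V).IsVectorBundle := by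
  have h : Continuous (fun p : (productBundle X V).Total => ((p.proj, p.snd) : X × V)) :=
    continuous_induced_dom
  refine ⟨continuous_fst.comp h, fun x₀ => ?_⟩
  let e : V ≃L[ℂ] (Fin (Module.finrank ℂ V) → ℂ) := ContinuousLinearEquiv.ofFinrankEq (by simp)
  refine ⟨Set.univ, isOpen_univ, Set.mem_univ _, _, fun _ => e.toLinearEquiv, ?_, ?_⟩
  · exact e.continuous.comp (continuous_snd.comp (h.comp continuous_subtype_val))
  · exact continuous_induced_rng.mpr (Continuous.prodMk
      (continuous_subtype_val.comp continuous_fst) (e.symm.continuous.comp continuous_snd))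

/-- A bundle morphism: continuous on total spaces, linear on fibres. -/
structure Hom (E F : VectorFamily X) where
  map : ∀ x, E.Fiber x →ₗ[ℂ] F.Fiber x
  continuous_total : Continuous (fun p : E.Total => (⟨p.proj, map p.proj p.snd⟩ : F.Total))

/-- The direct sum of two bundle morphisms. -/
def Hom.prod {E F E' F' : VectorFamily X} (a : Hom E F) (b : Hom E' F') :
    Hom (E.prod E') (F.prod F') where
  map x := (a.map x).prodMap (b.map x)
  continuous_total := continuous_induced_rng.mpr (Continuous.prodMk
    (a.continuous_total.comp (continuous_prod_fst E E'))
    (b.continuous_total.comp (continuous_prod_snd E E')))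

/-- The pullback of a bundle morphism. -/
def Hom.pullback (f : X' → X) {E F : VectorFamily X} (a : Hom E F) :
    Hom (E.pullback f) (F.pullback f) where
  map x := a.map (f x)
  continuous_total := continuous_induced_rng.mpr (Continuous.prodMk
    (continuous_fst.comp (continuous_pullback_pair f E))
    (a.continuous_total.comp (continuous_snd.comp (continuous_pullback_pair f E))))

/-- A bundle isomorphism, continuous in both directions. -/
structure Iso (E F : VectorFamily X) where
  equiv : ∀ x, E.Fiber x ≃ₗ[ℂ] F.Fiber x
  continuous_total : Continuous (fun p : E.Total => (⟨p.proj, equiv p.proj p.snd⟩ : F.Total))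
  continuous_symm_total :
    Continuous (fun p : F.Total => (⟨p.proj, (equiv p.proj).symm p.snd⟩ : E.Total))

end VectorFamily

/-- A triple `{E₀, E₁, a}` of two complex vector bundles and a bundle morphism `a : E₀ → E₁`. -/
structure Triple (X : Type u) [TopologicalSpace X] : Type (max u 1) where
  E₀ : VectorFamily X
  E₁ : VectorFamily X
  isVectorBundle₀ : E₀.IsVectorBundle
  isVectorBundle₁ : E₁.IsVectorBundle
  a : VectorFamily.Hom E₀ E₁

namespace Triple

variable {X : Type u} [TopologicalSpace X] {X' : Type u} [TopologicalSpace X']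

/-- The points over which `a` is not an isomorphism. -/
def supp (ξ : Triple X) : Set X := {x | ¬ Function.Bijective (ξ.a.map x)}

/-- The triple is trivial: its support is empty. -/
def IsTrivial (ξ : Triple X) : Prop := ξ.supp = ∅

/-- Isomorphism of triples: isomorphisms of both bundles that commute with the morphisms. -/
def Isomorphic (ξ η : Triple X) : Prop :=
  ∃ (φ₀ : VectorFamily.Iso ξ.E₀ η.E₀) (φ₁ : VectorFamily.Iso ξ.E₁ η.E₁),
    ∀ x v, η.a.map x (φ₀.equiv x v) = φ₁.equiv x (ξ.a.map x v)

/-- The direct sum of triples. -/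
def prod (ξ η : Triple X) : Triple X where
  E₀ := ξ.E₀.prod η.E₀
  E₁ := ξ.E₁.prod η.E₁
  isVectorBundle₀ := ξ.isVectorBundle₀.prod η.isVectorBundle₀
  isVectorBundle₁ := ξ.isVectorBundle₁.prod η.isVectorBundle₁
  a := ξ.a.prod η.a

theorem supp_prod (ξ η : Triple X) : (ξ.prod η).supp = ξ.supp ∪ η.supp := by
  have h : ∀ x, Function.Bijective ((ξ.prod η).a.map x) ↔
      Function.Bijective (ξ.a.map x) ∧ Function.Bijective (η.a.map x) := fun x => by
    change Function.Bijective (Prod.map (ξ.a.map x) (η.a.map x)) ↔ _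
    exact Prod.map_bijective
  ext x
  simp only [supp, Set.mem_union, Set.mem_ofPred_eq, h]
  tauto

/-- The pullback of a triple, in particular its restriction to a slice. -/
def pullback (f : X' → X) (hf : Continuous f) (ξ : Triple X) : Triple X' where
  E₀ := ξ.E₀.pullback f
  E₁ := ξ.E₁.pullback f
  isVectorBundle₀ := ξ.isVectorBundle₀.pullback hf
  isVectorBundle₁ := ξ.isVectorBundle₁.pullback hf
  a := ξ.a.pullback f

/-- The support is a compact subset of `X ∖ Y`, so that the triple belongs to `L(X, Y)`. -/
def IsRelative (Y : Set X) (ξ : Triple X) : Prop := IsCompact ξ.supp ∧ Disjoint ξ.supp Y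

theorem IsRelative.prod {Y : Set X} {ξ η : Triple X} (hξ : ξ.IsRelative Y)
    (hη : η.IsRelative Y) : (ξ.prod η).IsRelative Y := by
  rw [IsRelative, supp_prod]
  exact ⟨hξ.1.union hη.1, hξ.2.union_left hη.2⟩

/-- Homotopy of triples, through an element of `L(X × [0,1], Y × [0,1])`. -/
def Homotopic (Y : Set X) (ξ η : Triple X) : Prop :=
  ∃ Ξ : Triple (X × unitInterval), Ξ.IsRelative (Y ×ˢ Set.univ) ∧
    Isomorphic (Ξ.pullback (fun x => (x, 0)) (by fun_prop)) ξ ∧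
    Isomorphic (Ξ.pullback (fun x => (x, 1)) (by fun_prop)) η

end Triple

/-- The triples on `X` whose support is a compact subset of `X ∖ Y`. -/
def RelTriple (X : Type u) [TopologicalSpace X] (Y : Set X) : Type (max u 1) :=
  {ξ : Triple X // ξ.IsRelative Y}

/-- The relation that defines K-theory: homotopy after the addition of trivial triples. -/
def RelTriple.Stable {X : Type u} [TopologicalSpace X] {Y : Set X} (ξ ξ' : RelTriple X Y) : Prop :=
  ∃ η η' : Triple X, η.IsTrivial ∧ η'.IsTrivial ∧
    Triple.Homotopic Y (ξ.1.prod η) (ξ'.1.prod η')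

/-- (The underlying set of) the K-theory group `K(X, Y)`: classes of triples whose support is a
compact subset of `X ∖ Y`, for stable homotopy. Stable homotopy is an equivalence relation (homotopies
can be glued), so the quotient `Quot` identifies nothing else. The group law, which is the direct sum of triples,
is not needed to compare two classes. -/
def KTheory (X : Type u) [TopologicalSpace X] (Y : Set X) : Type (max u 1) :=
  Quot (RelTriple.Stable (X := X) (Y := Y))

/-- The class `[E₀, E₁, a]`. -/
def KTheory.mk {X : Type u} [TopologicalSpace X] {Y : Set X} (ξ : Triple X)
    (h : ξ.IsRelative Y) : KTheory X Y :=
  Quot.mk _ ⟨ξ, h⟩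

/-- The odd group `K⁻¹(X, Y) = K(X × ℝ, Y × ℝ)`. -/
abbrev KMinusOne (X : Type u) [TopologicalSpace X] (Y : Set X) : Type (max u 1) :=
  KTheory (X × ℝ) (Y ×ˢ Set.univ)

section IndexBundle

variable {Z : Type u} [TopologicalSpace Z] {W H : Type}
  [NormedAddCommGroup W] [InnerProductSpace ℂ W] [NormedAddCommGroup H] [InnerProductSpace ℂ H]

/-- The family `E(T, V)` with fibres `{u ∈ W | T_z u ∈ V}`, topologised as a subspace of `Z × W`. -/
def kernelFamily (T : C(Z, W →L[ℂ] H)) (V : Submodule ℂ H) : VectorFamily Z where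
  Fiber z := V.comap (T z).toLinearMap
  topology := TopologicalSpace.induced (fun p => ((p.proj, p.snd.1) : Z × W)) inferInstance

/-- The restriction `T : E(T, V) → Θ(V)`. -/
def restrictedMorphism (T : C(Z, W →L[ℂ] H)) (V : Submodule ℂ H) :
    VectorFamily.Hom (kernelFamily T V) (VectorFamily.productBundle Z V) where
  map z := ((T z).toLinearMap.restrict (p := V.comap (T z).toLinearMap) (q := V) fun _ h => h)
  continuous_total := by
    have h : Continuous (fun p : (kernelFamily T V).Total => ((p.proj, p.snd.1) : Z × W)) :=
      continuous_induced_dom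
    refine continuous_induced_rng.mpr (Continuous.prodMk (continuous_fst.comp h) ?_)
    exact Continuous.subtype_mk ((T.continuous.comp (continuous_fst.comp h)).clm_apply
      (continuous_snd.comp h)) _

/-- Transversality: `im T_z + V = H` for all `z`. -/
def IsTransversal (T : C(Z, W →L[ℂ] H)) (V : Submodule ℂ H) : Prop :=
  ∀ z, (T z).range ⊔ V = ⊤

/-- The triple `{E(T, V), Θ(V), T}`. -/
def indexTriple (T : C(Z, W →L[ℂ] H)) (V : Submodule ℂ H) [FiniteDimensional ℂ V]
    (h : (kernelFamily T V).IsVectorBundle) : Triple Z where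
  E₀ := kernelFamily T V
  E₁ := VectorFamily.productBundle Z V
  isVectorBundle₀ := h
  isVectorBundle₁ := VectorFamily.isVectorBundle_productBundle V
  a := restrictedMorphism T V

/-- `HasIndexBundle T Y κ` says that `T` is a continuous family of Fredholm operators of index `0`,
invertible outside a compact set and on `Y`, and that `κ ∈ K(Z, Y)` is its index bundle
`ind T = [E(T, V), Θ(V), T]`. It contains that the index bundle is well defined: there is a
finite-dimensional transversal `V`, every such `V` yields a vector bundle `E(T, V)` and an element of
`L(Z, Y)`, and the class of this element is always `κ`. So `κ` is unique. -/
structure HasIndexBundle (T : C(Z, W →L[ℂ] H)) (Y : Set Z) (κ : KTheory Z Y) : Prop where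
  isFredholm : ∀ z, (T z).IsFredholm
  index_eq_zero : ∀ z, Module.finrank ℂ (T z).ker = Module.finrank ℂ (H ⧸ (T z).range)
  exists_isCompact : ∃ K : Set Z, IsCompact K ∧ ∀ z ∉ K, (T z).IsInvertible
  isInvertible : ∀ z ∈ Y, (T z).IsInvertible
  exists_transversal : ∃ V : Submodule ℂ H, FiniteDimensional ℂ V ∧ IsTransversal T V
  eq_mk : ∀ (V : Submodule ℂ H) [FiniteDimensional ℂ V], IsTransversal T V →
    ∃ (h : (kernelFamily T V).IsVectorBundle) (hY : (indexTriple T V h).IsRelative Y),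
      κ = KTheory.mk (indexTriple T V h) hY

theorem HasIndexBundle.unique {T : C(Z, W →L[ℂ] H)} {Y : Set Z} {κ κ' : KTheory Z Y}
    (h : HasIndexBundle T Y κ) (h' : HasIndexBundle T Y κ') : κ = κ' := by
  obtain ⟨V, hV, hT⟩ := h.exists_transversal
  obtain ⟨_, _, e⟩ := h.eq_mk V hT
  obtain ⟨_, _, e'⟩ := h'.eq_mk V hT
  rw [e, e']

/-- The operator `D : W → H`, regarded as an unbounded operator in `H` with domain `W`, which is a
subspace of `H` through `ι`. -/
def toLinearPMap (ι : W →L[ℂ] H) (hι : Function.Injective ι) (D : W →L[ℂ] H) : H →ₗ.[ℂ] H where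
  domain := ι.range
  toFun := D.toLinearMap ∘ₗ (LinearEquiv.ofInjective ι.toLinearMap hι).symm.toLinearMap

/-- The suspension `(x, s) ↦ D_x + i s`. -/
def suspension {X : Type u} [TopologicalSpace X] (ι : W →L[ℂ] H) (D : C(X, W →L[ℂ] H)) :
    C(X × ℝ, W →L[ℂ] H) where
  toFun z := D z.1 + (Complex.I * (z.2 : ℂ)) • ι
  continuous_toFun := by fun_prop

/-- `HasSelfAdjointIndexBundle ι hι D Y κ` says that `D : X → FS(W, H)` is a continuous family of
selfadjoint Fredholm operators in `H` with domain `W`, invertible on `Y`, and that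
`κ ∈ K⁻¹(X, Y)` is its index bundle `s-ind D`, the index bundle of the suspension of `D`. -/
structure HasSelfAdjointIndexBundle [CompleteSpace H] {X : Type u} [TopologicalSpace X]
    (ι : W →L[ℂ] H) (hι : Function.Injective ι) (D : C(X, W →L[ℂ] H)) (Y : Set X)
    (κ : KMinusOne X Y) : Prop where
  isSelfAdjoint : ∀ x, IsSelfAdjoint (toLinearPMap ι hι (D x))
  isFredholm : ∀ x, (D x).IsFredholm
  isInvertible : ∀ x ∈ Y, (D x).IsInvertible
  hasIndexBundle : HasIndexBundle (suspension ι D) (Y ×ˢ Set.univ) κ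

end IndexBundle


section Operators

variable {n : ℕ}

/-- The derivative `u' ∈ H^{m/2}` of `u ∈ H^{m/2+1}`, in Fourier coefficients:
`(cos kt)' = -k sin kt` and `(sin kt)' = k cos kt`. -/
def coeffDeriv {𝕜 : Type} [RCLike 𝕜] {m : ℕ} (u : Sobolev 𝕜 n (m + 2)) : Sobolev 𝕜 n m :=
  ⟨fun k => ((k : ℝ) : 𝕜) • u.coeff (-k), by
    have h := (Equiv.neg ℤ).summable_iff.mpr u.summable_coeff
    refine Summable.of_nonneg_of_le (fun k => ?_) (fun k => ?_) h
    · have := (weight_pos m k).le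
      positivity
    · simp only [Function.comp_apply, Equiv.neg_apply, norm_smul, RCLike.norm_ofReal]
      unfold weight
      by_cases hk : k = 0
      · simp [hk]
        positivity
      · simp only [hk, neg_eq_zero, if_false, abs_neg, Int.cast_abs, mul_pow]
        exact le_of_eq (by ring)⟩

/-- The inclusion `H^{m/2}(S¹, ℝ^{2n}) ⊂ H^{m/2}(S¹, ℂ^{2n})` of the real functions. -/
def Sobolev.ofReal {m : ℕ} (u : Sobolev ℝ n m) : Sobolev ℂ n m :=
  ⟨fun k => WithLp.toLp 2 fun i => ((u.coeff k i : ℝ) : ℂ), by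
    refine u.summable_coeff.congr fun k => ?_
    simp [EuclideanSpace.norm_sq_eq]⟩

theorem matVec_add {𝕜 : Type} [RCLike 𝕜] (M : Matrix (Fin n ⊕ Fin n) (Fin n ⊕ Fin n) 𝕜)
    (v w : Vec 𝕜 n) : matVec M (v + w) = matVec M v + matVec M w := by
  simp [matVec, Matrix.mulVec_add]

theorem matVec_smul {𝕜 : Type} [RCLike 𝕜] (M : Matrix (Fin n ⊕ Fin n) (Fin n ⊕ Fin n) 𝕜)
    (a : 𝕜) (v : Vec 𝕜 n) : matVec M (a • v) = a • matVec M v := by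
  simp [matVec, Matrix.mulVec_smul]

theorem continuous_matVec {𝕜 : Type} [RCLike 𝕜]
    (M : Matrix (Fin n ⊕ Fin n) (Fin n ⊕ Fin n) 𝕜) : Continuous (matVec M) :=
  LinearMap.continuous_of_finiteDimensional
    (⟨⟨matVec M, matVec_add M⟩, matVec_smul M⟩ : Vec 𝕜 n →ₗ[𝕜] Vec 𝕜 n)

/-- For `σ = ±1` the subspace `E_±` of `H^{1/2}(S¹, ℝ^{2n})` that consists of the functions
`u(t) = ∑_{k ≥ 1} (a_k cos kt ∓ J a_k sin kt)`. -/
def halfSpace (n : ℕ) (σ : ℝ) : Submodule ℝ (Sobolev ℝ n 1) where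
  carrier := {u | u.coeff 0 = 0 ∧
    ∀ k : ℤ, 0 < k → u.coeff (-k) = (-σ) • matVec (Matrix.J (Fin n) ℝ) (u.coeff k)}
  zero_mem' := by
    have h : ∀ k, (0 : Sobolev ℝ n 1).coeff k = 0 := fun _ => rfl
    have h0 : matVec (Matrix.J (Fin n) ℝ) 0 = 0 := by simp [matVec]
    exact ⟨h 0, fun k _ => by rw [h, h, h0, smul_zero]⟩
  add_mem' := by
    intro u v hu hv
    refine ⟨by rw [Sobolev.coeff_add, hu.1, hv.1, add_zero], fun k hk => ?_⟩
    rw [Sobolev.coeff_add, Sobolev.coeff_add, hu.2 k hk, hv.2 k hk, matVec_add, smul_add]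
  smul_mem' := by
    intro a u hu
    refine ⟨by rw [Sobolev.coeff_smul, hu.1, smul_zero], fun k hk => ?_⟩
    rw [Sobolev.coeff_smul, Sobolev.coeff_smul, hu.2 k hk, matVec_smul, smul_comm]

theorem isClosed_halfSpace (σ : ℝ) : IsClosed (halfSpace n σ : Set (Sobolev ℝ n 1)) := by
  have h : (halfSpace n σ : Set (Sobolev ℝ n 1)) = {u | u.coeff 0 = 0} ∩ ⋂ k : ℤ, ⋂ _ : 0 < k,
      {u | u.coeff (-k) = (-σ) • matVec (Matrix.J (Fin n) ℝ) (u.coeff k)} := by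
    ext u
    simp only [Set.mem_inter_iff, Set.mem_iInter]
    exact Iff.rfl
  rw [h]
  refine (isClosed_eq (Sobolev.continuous_coeff 0) continuous_const).inter
    (isClosed_iInter fun k => isClosed_iInter fun _ => isClosed_eq (Sobolev.continuous_coeff _) ?_)
  exact ((continuous_matVec _).comp (Sobolev.continuous_coeff k)).const_smul (-σ)

instance (σ : ℝ) : CompleteSpace (halfSpace n σ) :=
  (isClosed_halfSpace σ).completeSpace_coe

/-- The bilinear form `Γ(u, v) = ⟪P₊ u - P₋ u, v⟫` on `H^{1/2}(S¹, ℝ^{2n})`, with the orthogonal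
projections `P_±` onto `E_±`. -/
def Gam (u v : Sobolev ℝ n 1) : ℝ :=
  inner ℝ ((halfSpace n 1).starProjection u - (halfSpace n (-1)).starProjection u) v

end Operators

section Hamiltonian

variable {X : Type u} [TopologicalSpace X] {n : ℕ}

/-- The standing assumptions on the Hamiltonians `𝓗 : X × ℝ × ℝ^{2n} → ℝ`: each `𝓗_x` is `C²` on
`ℝ × ℝ^{2n}`, its derivatives up to order two (order zero included) are continuous on
`X × ℝ × ℝ^{2n}`, `𝓗` is `2π`-periodic in time, `u = 0` is a solution, and the gradient and the
Hessian in `u` are bounded by `a + b |u|^r` for some `a, b ≥ 0`, `r > 1`. -/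
structure IsHamiltonianFamily (𝓗 : X → ℝ → Vec ℝ n → ℝ) : Prop where
  contDiff : ∀ x, ContDiff ℝ 2 (fun p : ℝ × Vec ℝ n => 𝓗 x p.1 p.2)
  continuous_iteratedFDeriv : ∀ k : ℕ, k ≤ 2 → Continuous fun q : X × (ℝ × Vec ℝ n) =>
    iteratedFDeriv ℝ k (fun p : ℝ × Vec ℝ n => 𝓗 q.1 p.1 p.2) q.2
  periodic : ∀ x t v, 𝓗 x (t + 2 * Real.pi) v = 𝓗 x t v
  gradient_zero : ∀ x t, gradient (𝓗 x t) 0 = 0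
  growth : ∃ a b r : ℝ, 0 ≤ a ∧ 0 ≤ b ∧ 1 < r ∧ ∀ x t v,
    ‖gradient (𝓗 x t) v‖ ≤ a + b * ‖v‖ ^ r ∧
    ‖fderiv ℝ (gradient (𝓗 x t)) v‖ ≤ a + b * ‖v‖ ^ r

/-- The symmetric matrix `S_x(t)`, the Hessian of `𝓗(x, t, ·)` at `0 ∈ ℝ^{2n}`. -/
def hessianMatrix (𝓗 : X → ℝ → Vec ℝ n → ℝ) (x : X) (t : ℝ) :
    Matrix (Fin n ⊕ Fin n) (Fin n ⊕ Fin n) ℝ :=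
  Matrix.of fun i j => (fderiv ℝ (gradient (𝓗 x t)) 0 (EuclideanSpace.single j 1)).ofLp i

/-- The functional `ψ_x(u) = Γ(u, u) / 2 + ∫₀^{2π} 𝓗(x, t, u(t)) dt` on `H^{1/2}(S¹, ℝ^{2n})`. -/
def action (𝓗 : X → ℝ → Vec ℝ n → ℝ) (x : X) (u : Sobolev ℝ n 1) : ℝ :=
  Gam u u / 2 + ∫ t in (0 : ℝ)..(2 * Real.pi), 𝓗 x t ((toL2 u : L2 ℝ n) t)

/-- The Hessian `L_x` of `ψ_x` at `u = 0`, the derivative at `0` of the `H^{1/2}`-gradient. -/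
def actionHessian (𝓗 : X → ℝ → Vec ℝ n → ℝ) (x : X) : Sobolev ℝ n 1 →L[ℝ] Sobolev ℝ n 1 :=
  fderiv ℝ (gradient (action 𝓗 x)) 0

/-- The family is admissible: the Hessians `L_x` are invertible for `x ∈ Y`. -/
def IsAdmissible (𝓗 : X → ℝ → Vec ℝ n → ℝ) (Y : Set X) : Prop :=
  ∀ x ∈ Y, (actionHessian 𝓗 x).IsInvertible

/-- `κ` is the generalised Morse index, the index bundle of the complexified Hessians `L^ℂ`. The
first two fields say that the Hessians exist. -/
structure HasMorseIndex (𝓗 : X → ℝ → Vec ℝ n → ℝ) (Y : Set X) (κ : KMinusOne X Y) : Prop where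
  differentiable : ∀ x, Differentiable ℝ (action 𝓗 x)
  differentiableAt_gradient : ∀ x, DifferentiableAt ℝ (gradient (action 𝓗 x)) 0
  exists_complexification : ∃ L : C(X, Sobolev ℂ n 1 →L[ℂ] Sobolev ℂ n 1),
    (∀ (x : X) (u : Sobolev ℝ n 1), L x u.ofReal = (actionHessian 𝓗 x u).ofReal) ∧
    HasSelfAdjointIndexBundle (ContinuousLinearMap.id ℂ (Sobolev ℂ n 1)) Function.injective_id
      L Y κ

/-- `κ` is the spectral index, the index bundle of the unbounded operators `u ↦ J u' + S_x u` in
`L²(S¹, ℂ^{2n})` with domain `H¹(S¹, ℂ^{2n})`. -/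
def HasSpectralIndex (𝓗 : X → ℝ → Vec ℝ n → ℝ) (Y : Set X) (κ : KMinusOne X Y) : Prop :=
  ∃ A : C(X, Sobolev ℂ n 2 →L[ℂ] L2 ℂ n),
    (∀ (x : X) (u : Sobolev ℂ n 2), ∀ᵐ t ∂circleMeasure,
      (A x u) t = matVec (Matrix.J (Fin n) ℂ) ((toL2 (coeffDeriv u) : L2 ℂ n) t) +
        matVec ((hessianMatrix 𝓗 x t).map Complex.ofReal) ((toL2 u : L2 ℂ n) t)) ∧
    HasSelfAdjointIndexBundle toL2 toL2_injective A Y κ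

/-- `Ψ` solves `J Ψ' + S Ψ + i s Ψ = 0` on `[0, 2π]` with `Ψ(0) = I`. -/
def IsFundamentalSolution (S : ℝ → Matrix (Fin n ⊕ Fin n) (Fin n ⊕ Fin n) ℝ) (s : ℝ)
    (Ψ : ℝ → Matrix (Fin n ⊕ Fin n) (Fin n ⊕ Fin n) ℂ) : Prop :=
  Ψ 0 = 1 ∧ ∃ Ψ' : ℝ → Matrix (Fin n ⊕ Fin n) (Fin n ⊕ Fin n) ℂ,
    ∀ t ∈ Set.Icc 0 (2 * Real.pi),
      (∀ i j, HasDerivWithinAt (fun τ => Ψ τ i j) (Ψ' t i j) (Set.Icc 0 (2 * Real.pi)) t) ∧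
      Matrix.J (Fin n) ℂ * Ψ' t + (S t).map Complex.ofReal * Ψ t +
        (Complex.I * (s : ℂ)) • Ψ t = 0

/-- The triple `{Θ(ℂ^{2n}), Θ(ℂ^{2n}), Λ}` of a continuous family of matrices. -/
def matrixTriple {Z : Type u} [TopologicalSpace Z]
    (Λ : C(Z, Matrix (Fin n ⊕ Fin n) (Fin n ⊕ Fin n) ℂ)) : Triple Z where
  E₀ := VectorFamily.productBundle Z (Fin n ⊕ Fin n → ℂ)
  E₁ := VectorFamily.productBundle Z (Fin n ⊕ Fin n → ℂ)
  isVectorBundle₀ := VectorFamily.isVectorBundle_productBundle _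
  isVectorBundle₁ := VectorFamily.isVectorBundle_productBundle _
  a :=
    { map := fun z => (Λ z).mulVecLin
      continuous_total := by
        have h : Continuous (fun p : (VectorFamily.productBundle Z (Fin n ⊕ Fin n → ℂ)).Total =>
            ((p.proj, p.snd) : Z × (Fin n ⊕ Fin n → ℂ))) := continuous_induced_dom
        exact continuous_induced_rng.mpr (Continuous.prodMk (continuous_fst.comp h)
          ((Λ.continuous.comp (continuous_fst.comp h)).matrix_mulVec (continuous_snd.comp h))) }

/-- `κ` is the monodromy index, the class of the matrix family `Λ(x, s) = (I - Ψ_{(x,s)}(2π))ᵀ`. -/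
def HasMonodromyIndex (𝓗 : X → ℝ → Vec ℝ n → ℝ) (Y : Set X) (κ : KMinusOne X Y) : Prop :=
  ∃ (Ψ : X × ℝ → ℝ → Matrix (Fin n ⊕ Fin n) (Fin n ⊕ Fin n) ℂ)
    (Λ : C(X × ℝ, Matrix (Fin n ⊕ Fin n) (Fin n ⊕ Fin n) ℂ)),
    (∀ z, IsFundamentalSolution (hessianMatrix 𝓗 z.1) z.2 (Ψ z)) ∧
    (∀ z, Λ z = (1 - Ψ z (2 * Real.pi))ᵀ) ∧
    ∃ h : (matrixTriple Λ).IsRelative (Y ×ˢ Set.univ), κ = KTheory.mk (matrixTriple Λ) h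

end Hamiltonian

end

end HamiltonianIndex

/-! Let ι be the inclusion of H^{1/2} into L², ι* its adjoint, c the inclusion of H¹ into H^{1/2}.
The Hessian of the action at 0 is L = P₊ - P₋ + ι*Sι and the spectral operator is A = J d/dt + S. Up
to the constants P₊ - P₋ is the sign of J d/dt, while ι* divides the k-th Fourier coefficient by
|k|; hence L c = ι*A (`hessianOp_inclL`), and this identity ties the Morse index to the spectral
index.

Morse and spectral index. The suspension L + is is deformed to L + is ι*ι through convex
combinations of the identity and ι*ι. Off s = 0 every operator of the deformation is injective,
because the imaginary part of its quadratic form is s times a positive form; it is also an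
invertible operator plus a limit of finite-rank operators, so it has index 0 and is invertible.
Homotopy invariance applies. Then (L + is ι*ι) c = ι*(A + is ι), and solutions w of (L + is ι*ι) w =
ι*h lie in H¹. If the transversal space is chosen inside the dense range of ι*, the two kernel
bundles are therefore isomorphic (`HasIndexBundle.eq_of_intertwining`).

Spectral and monodromy index. Put B = S + is. An element u of H¹ is determined by its initial value
u(0) and by h = Ju' + Bu, and a pair (u(0), h) occurs exactly if the solution of the initial value
problem closes up after one period. This is a linear relation M u(0) = k h with M = Ψ(2π) - I and k
surjective, and it implies E(T,V) ⊕ F ≅ F ⊕ V for F = ℂ^{2n}, compatibly with T ⊕ 1 and M ⊕ 1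
(`HasIndexBundle.eq_mk_endTriple`). The initial value problem is solved in L² by a Volterra
equation, which gives continuity in all parameters. Since B is symmetric for the bilinear dot
product, Ψᵀ J Ψ = J, so that (I - Ψ)ᵀ J Ψ = J (Ψ - I): the triple of M is isomorphic to that of Λ.

Existence of the indices. `E(T, V)` is locally trivial because its fibres are the ranges of a
continuous family of projections, and replacing V by a larger space adds a trivial triple. The
Hessian exists and has the stated form because H^{1/2} embeds into every L^p with p finite, which
controls the polynomial growth of the Hamiltonian. Selfadjointness follows from symmetry and
surjectivity of the operators ± i. -/

namespace HamiltonianIndex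

noncomputable section

/-! ### Isomorphism, homotopy and stable equality of triples. -/

section KTheoryClasses

variable {X : Type u} [TopologicalSpace X] {X' : Type u} [TopologicalSpace X']

namespace VectorFamily

/-- The composition of bundle isomorphisms. -/
def Iso.trans {E F G : VectorFamily X} (φ : Iso E F) (ψ : Iso F G) : Iso E G where
  equiv x := (φ.equiv x).trans (ψ.equiv x)
  continuous_total := ψ.continuous_total.comp φ.continuous_total
  continuous_symm_total := φ.continuous_symm_total.comp ψ.continuous_symm_total

/-- The restriction of the pullback along the projection `X × T → X` to a slice. -/
def slicePullbackIso (E : VectorFamily X) (hE : Continuous (fun p : E.Total => p.proj))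
    (t : unitInterval) :
    Iso ((E.pullback (Prod.fst : X × unitInterval → X)).pullback (fun x => (x, t))) E where
  equiv _ := LinearEquiv.refl ℂ _
  continuous_total :=
    (continuous_snd.comp (continuous_pullback_pair _ E)).comp
      (continuous_snd.comp (continuous_pullback_pair _ _))
  continuous_symm_total := by
    refine continuous_induced_rng.mpr (Continuous.prodMk hE ?_)
    exact continuous_induced_rng.mpr (Continuous.prodMk (hE.prodMk continuous_const) continuous_id)

/-- Adding a bundle with zero fibres changes nothing. -/
def prodZeroIso (E : VectorFamily X) (hE : Continuous (fun p : E.Total => p.proj)) :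
    Iso E (E.prod (productBundle X PUnit.{1})) where
  equiv _ :=
    { toFun := fun v => (v, 0)
      invFun := fun v => v.1
      map_add' := fun v w => Prod.ext rfl rfl
      map_smul' := fun a v => Prod.ext rfl rfl
      left_inv := fun v => rfl
      right_inv := fun v => rfl }
  continuous_total := by
    refine continuous_induced_rng.mpr (Continuous.prodMk continuous_id ?_)
    exact continuous_induced_rng.mpr (Continuous.prodMk hE continuous_const)
  continuous_symm_total := continuous_prod_fst _ _

end VectorFamily

namespace Triple

theorem Isomorphic.trans {ξ η ζ : Triple X} (h : Isomorphic ξ η) (h' : Isomorphic η ζ) :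
    Isomorphic ξ ζ := by
  obtain ⟨φ₀, φ₁, h⟩ := h
  obtain ⟨ψ₀, ψ₁, h'⟩ := h'
  refine ⟨φ₀.trans ψ₀, φ₁.trans ψ₁, fun x v => ?_⟩
  change ζ.a.map x (ψ₀.equiv x (φ₀.equiv x v)) = ψ₁.equiv x (φ₁.equiv x _)
  rw [h', h]

theorem isomorphic_slice (ξ : Triple X) (t : unitInterval) :
    Isomorphic ((ξ.pullback (Prod.fst : X × unitInterval → X) continuous_fst).pullback
      (fun x => (x, t)) (by fun_prop)) ξ :=
  ⟨ξ.E₀.slicePullbackIso ξ.isVectorBundle₀.1 t, ξ.E₁.slicePullbackIso ξ.isVectorBundle₁.1 t,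
    fun _ _ => rfl⟩

/-- Isomorphic triples are homotopic, through the constant homotopy. -/
theorem Isomorphic.homotopic {Y : Set X} {ξ η : Triple X} (h : Isomorphic ξ η)
    (hξ : ξ.IsRelative Y) : Homotopic Y ξ η := by
  refine ⟨ξ.pullback Prod.fst continuous_fst, ?_, ξ.isomorphic_slice 0,
    (ξ.isomorphic_slice 1).trans h⟩
  have e : (ξ.pullback (Prod.fst : X × unitInterval → X) continuous_fst).supp
      = ξ.supp ×ˢ Set.univ := by
    ext p
    simp only [Set.mem_prod, Set.mem_univ, and_true]
    exact Iff.rfl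
  rw [IsRelative, e]
  exact ⟨hξ.1.prod isCompact_univ, Set.disjoint_prod.mpr (Or.inl hξ.2)⟩

/-- The trivial triple given by the identity of a product bundle. -/
def productId (X : Type u) [TopologicalSpace X] (V : Type) [NormedAddCommGroup V]
    [NormedSpace ℂ V] [FiniteDimensional ℂ V] : Triple X where
  E₀ := VectorFamily.productBundle X V
  E₁ := VectorFamily.productBundle X V
  isVectorBundle₀ := VectorFamily.isVectorBundle_productBundle V
  isVectorBundle₁ := VectorFamily.isVectorBundle_productBundle V
  a := ⟨fun _ => LinearMap.id, continuous_id⟩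

theorem isTrivial_productId (V : Type) [NormedAddCommGroup V]
    [NormedSpace ℂ V] [FiniteDimensional ℂ V] : (productId X V).IsTrivial := by
  ext x
  simp only [supp, productId, Set.mem_ofPred_eq, Set.mem_empty_iff_false, iff_false, not_not]
  exact Function.bijective_id

/-- Stable homotopy always asks for a trivial summand on both sides; the zero bundle serves where
none is needed. -/
theorem isomorphic_prod_zero (ξ : Triple X) :
    Isomorphic ξ (ξ.prod (productId X PUnit.{1})) :=
  ⟨ξ.E₀.prodZeroIso ξ.isVectorBundle₀.1, ξ.E₁.prodZeroIso ξ.isVectorBundle₁.1, fun _ _ => rfl⟩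

theorem IsTrivial.isRelative {ξ : Triple X} (h : ξ.IsTrivial) (Y : Set X) : ξ.IsRelative Y := by
  rw [IsRelative, show ξ.supp = ∅ from h]
  exact ⟨isCompact_empty, Set.empty_disjoint _⟩

end Triple

/-- Bundle isomorphisms enter K-theory in this form: the constant homotopy makes isomorphic sums
stably homotopic. -/
theorem KTheory.mk_eq_of_isomorphic_prod {Y : Set X} {ξ ξ' η η' : Triple X}
    (hξ : ξ.IsRelative Y) (hξ' : ξ'.IsRelative Y) (hη : η.IsTrivial) (hη' : η'.IsTrivial)
    (h : Triple.Isomorphic (ξ.prod η) (ξ'.prod η')) : KTheory.mk ξ hξ = KTheory.mk ξ' hξ' :=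
  Quot.sound ⟨η, η', hη, hη', h.homotopic (hξ.prod (hη.isRelative Y))⟩

theorem KTheory.mk_eq_of_homotopic {Y : Set X} {ξ ξ' : Triple X}
    (hξ : ξ.IsRelative Y) (hξ' : ξ'.IsRelative Y) (h : Triple.Homotopic Y ξ ξ') :
    KTheory.mk ξ hξ = KTheory.mk ξ' hξ' := by
  obtain ⟨Ξ, hΞ, h0, h1⟩ := h
  exact Quot.sound ⟨_, _, Triple.isTrivial_productId PUnit, Triple.isTrivial_productId PUnit,
    Ξ, hΞ, h0.trans ξ.isomorphic_prod_zero, h1.trans ξ'.isomorphic_prod_zero⟩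

theorem KTheory.mk_eq_of_isomorphic {Y : Set X} {ξ ξ' : Triple X}
    (hξ : ξ.IsRelative Y) (hξ' : ξ'.IsRelative Y) (h : Triple.Isomorphic ξ ξ') :
    KTheory.mk ξ hξ = KTheory.mk ξ' hξ' :=
  KTheory.mk_eq_of_homotopic hξ hξ' (h.homotopic hξ)

/-- The support of a triple does not change under isomorphism. -/
theorem Triple.Isomorphic.supp_eq {ξ η : Triple X} (h : Isomorphic ξ η) : ξ.supp = η.supp := by
  obtain ⟨φ₀, φ₁, h⟩ := h
  ext x
  have e : ⇑(η.a.map x) ∘ φ₀.equiv x = φ₁.equiv x ∘ ξ.a.map x := funext (h x)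
  simp only [supp, Set.mem_ofPred_eq]
  rw [← (φ₀.equiv x).bijective.of_comp_iff, e, (φ₁.equiv x).bijective.of_comp_iff']

end KTheoryClasses

/-! ### Continuity into and out of total spaces. -/

section FamilyTopology

variable {Z : Type u} [TopologicalSpace Z] {A : Type*} [TopologicalSpace A]

theorem VectorFamily.continuous_to_productBundle {V : Type} [NormedAddCommGroup V]
    [NormedSpace ℂ V] {f : A → (productBundle Z V).Total} (h : Continuous fun a => (f a).proj)
    (h' : Continuous (Y := V) fun a => (f a).snd) : Continuous f :=
  continuous_induced_rng.mpr (h.prodMk h')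

theorem VectorFamily.continuous_productBundle_pair {V : Type} [NormedAddCommGroup V]
    [NormedSpace ℂ V] :
    Continuous (fun p : (productBundle Z V).Total => ((p.proj, p.snd) : Z × V)) :=
  continuous_induced_dom

theorem VectorFamily.continuous_to_prod {E F : VectorFamily Z} {f : A → (E.prod F).Total}
    (h : Continuous fun a => (⟨(f a).proj, (f a).snd.1⟩ : E.Total))
    (h' : Continuous fun a => (⟨(f a).proj, (f a).snd.2⟩ : F.Total)) : Continuous f :=
  continuous_induced_rng.mpr (h.prodMk h')

variable {W H : Type} [NormedAddCommGroup W] [InnerProductSpace ℂ W] [NormedAddCommGroup H]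
  [InnerProductSpace ℂ H]

theorem continuous_kernelFamily_pair (T : C(Z, W →L[ℂ] H)) (V : Submodule ℂ H) :
    Continuous (fun p : (kernelFamily T V).Total => ((p.proj, p.snd.1) : Z × W)) :=
  continuous_induced_dom

theorem continuous_to_kernelFamily {T : C(Z, W →L[ℂ] H)} {V : Submodule ℂ H}
    {f : A → (kernelFamily T V).Total} (h : Continuous fun a => (f a).proj)
    (h' : Continuous (Y := W) fun a => (f a).snd.1) : Continuous f :=
  continuous_induced_rng.mpr (h.prodMk h')

end FamilyTopology

/-! ### Surjective operators between Hilbert spaces: openness and right inverses. -/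

section SurjectiveOperators

variable {W K : Type*} [NormedAddCommGroup W] [InnerProductSpace ℂ W] [CompleteSpace W]
  [NormedAddCommGroup K] [InnerProductSpace ℂ K] [CompleteSpace K]

/-- Units are open and inversion is continuous, so surjectivity is traded for a unit. By the open
mapping theorem x = q w with |w| ≤ C |x|, hence |x|² = ⟨w, q*x⟩ ≤ C |x| |q*x|, which bounds the form
⟨q q*x, x⟩ = |q*x|² below by C⁻² |x|². -/
theorem isUnit_comp_adjoint_iff_surjective (q : W →L[ℂ] K) :
    IsUnit (q ∘L ContinuousLinearMap.adjoint q) ↔ Function.Surjective q := by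
  constructor
  · intro h
    rw [ContinuousLinearMap.isUnit_iff_bijective] at h
    exact fun y => (h.2 y).imp' (ContinuousLinearMap.adjoint q) fun _ hx => hx
  intro hq
  obtain ⟨C, hC, h⟩ := q.exists_preimage_norm_le hq
  refine ContinuousLinearMap.isUnit_of_forall_le_norm_inner_map _ (c := ⟨(C ^ 2)⁻¹, by positivity⟩)
    (by change (0 : ℝ) < _; positivity) fun x => ?_
  obtain ⟨w, rfl, hw⟩ := h x
  set x := q w
  set y := ContinuousLinearMap.adjoint q x
  have e : inner ℂ ((q ∘L ContinuousLinearMap.adjoint q) x) x = ((‖y‖ ^ 2 : ℝ) : ℂ) := by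
    rw [ContinuousLinearMap.comp_apply, ← ContinuousLinearMap.adjoint_inner_right,
      inner_self_eq_norm_sq_to_K]
    norm_cast
  rw [e, Complex.norm_real, Real.norm_of_nonneg (by positivity)]
  have h1 : ‖x‖ ^ 2 ≤ C * ‖x‖ * ‖y‖ := by
    calc ‖x‖ ^ 2 = ‖inner ℂ x x‖ := by rw [inner_self_eq_norm_sq_to_K]; simp
      _ = ‖inner ℂ w y‖ := by rw [ContinuousLinearMap.adjoint_inner_right]
      _ ≤ ‖w‖ * ‖y‖ := norm_inner_le_norm _ _
      _ ≤ _ := by gcongr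
  have h2 : ‖x‖ ≤ C * ‖y‖ := by
    rcases (norm_nonneg x).eq_or_lt with h0 | h0
    · rw [← h0]; positivity
    · nlinarith
  change ‖x‖ ^ 2 * (C ^ 2)⁻¹ ≤ _
  rw [← div_eq_mul_inv, div_le_iff₀ (by positivity)]
  calc ‖x‖ ^ 2 ≤ (C * ‖y‖) ^ 2 := by gcongr
    _ = _ := by ring

theorem isOpen_setOf_surjective : IsOpen {q : W →L[ℂ] K | Function.Surjective q} := by
  simp_rw [← isUnit_comp_adjoint_iff_surjective]
  exact Units.isOpen.preimage
    (continuous_id.clm_comp (ContinuousLinearMap.adjoint (𝕜 := ℂ)).continuous)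

/-- A continuous family of surjective operators between Hilbert spaces has a continuous family of
right inverses. -/
theorem exists_continuous_rightInverse {Z : Type*} [TopologicalSpace Z] (q : C(Z, W →L[ℂ] K))
    (hq : ∀ z, Function.Surjective (q z)) : ∃ R : C(Z, K →L[ℂ] W), ∀ z y, q z (R z y) = y := by
  have hG : Continuous fun z => q z ∘L ContinuousLinearMap.adjoint (q z) :=
    q.continuous.clm_comp ((ContinuousLinearMap.adjoint (𝕜 := ℂ)).continuous.comp q.continuous)
  have hu := fun z => (isUnit_comp_adjoint_iff_surjective (q z)).mpr (hq z)
  have hi : Continuous fun z => Ring.inverse (q z ∘L ContinuousLinearMap.adjoint (q z)) := by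
    refine continuous_iff_continuousAt.mpr fun z => ?_
    obtain ⟨g, hg⟩ := hu z
    exact ContinuousAt.comp (f := fun z => q z ∘L ContinuousLinearMap.adjoint (q z))
      (by rw [← hg]; exact NormedRing.inverse_continuousAt g) hG.continuousAt
  -- The right inverse is q*(q q*)⁻¹.
  refine ⟨⟨_, ((ContinuousLinearMap.adjoint (𝕜 := ℂ)).continuous.comp q.continuous).clm_comp hi⟩,
    fun z y => ?_⟩
  exact congrArg (fun f : K →L[ℂ] K => f y) (Ring.mul_inverse_cancel _ (hu z))

end SurjectiveOperators

/-! ### Finite-dimensional transversal subspaces. -/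

section Transversality

variable {Z : Type u} [TopologicalSpace Z] {W H : Type}
  [NormedAddCommGroup W] [InnerProductSpace ℂ W] [NormedAddCommGroup H] [InnerProductSpace ℂ H]

theorem orthogonalProjectionOnto_orthogonal_eq_zero_iff (V : Submodule ℂ H)
    [FiniteDimensional ℂ V] (h : H) : Vᗮ.orthogonalProjectionOnto h = 0 ↔ h ∈ V := by
  rw [Submodule.orthogonalProjectionOnto_eq_zero_iff, Submodule.orthogonal_orthogonal]

/-- Transversality becomes surjectivity of an operator onto the Hilbert space `Vᗮ`, so that it is
open and admits continuous right inverses. -/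
theorem range_sup_eq_top_iff (T : W →L[ℂ] H) (V : Submodule ℂ H) [FiniteDimensional ℂ V] :
    T.range ⊔ V = ⊤ ↔ Function.Surjective (Vᗮ.orthogonalProjectionOnto ∘L T) := by
  constructor
  · intro h y
    obtain ⟨a, ⟨w, rfl⟩, v, hv, e⟩ := Submodule.mem_sup.mp (h ▸ Submodule.mem_top : (y : H) ∈ _)
    refine ⟨w, ?_⟩
    have e' := congrArg Vᗮ.orthogonalProjectionOnto e
    rw [map_add, (orthogonalProjectionOnto_orthogonal_eq_zero_iff V v).mpr hv, add_zero,
      Submodule.orthogonalProjectionOnto_mem_subspace_eq_self] at e'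
    exact e'
  · intro h
    refine eq_top_iff.mpr fun y _ => ?_
    obtain ⟨w, hw⟩ := h (Vᗮ.orthogonalProjectionOnto y)
    refine Submodule.mem_sup.mpr ⟨T w, ⟨w, rfl⟩, y - T w, ?_, add_sub_cancel _ _⟩
    rw [← orthogonalProjectionOnto_orthogonal_eq_zero_iff, map_sub, sub_eq_zero]
    exact hw.symm

/-- A continuous family of right inverses of `T` modulo `V`. -/
structure IsSection (T : C(Z, W →L[ℂ] H)) (V : Submodule ℂ H) (R : C(Z, H →L[ℂ] W)) : Prop where
  sub_mem : ∀ z h, h - T z (R z h) ∈ V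
  eq_zero : ∀ z, ∀ v ∈ V, R z v = 0

variable [CompleteSpace W] [CompleteSpace H]

/-- A continuous right inverse of the operator projected to `Vᗮ`, preceded by that projection; so it
kills `V`. -/
theorem IsTransversal.exists_isSection {T : C(Z, W →L[ℂ] H)} {V : Submodule ℂ H}
    [FiniteDimensional ℂ V] (h : IsTransversal T V) : ∃ R, IsSection T V R := by
  obtain ⟨R, hR⟩ := exists_continuous_rightInverse
    (⟨fun z => Vᗮ.orthogonalProjectionOnto ∘L T z, by fun_prop⟩ : C(Z, W →L[ℂ] Vᗮ))
    fun z => (range_sup_eq_top_iff (T z) V).mp (h z)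
  refine ⟨⟨fun z => R z ∘L Vᗮ.orthogonalProjectionOnto, by fun_prop⟩, fun z y => ?_,
    fun z v hv => ?_⟩
  · rw [← orthogonalProjectionOnto_orthogonal_eq_zero_iff, map_sub, sub_eq_zero]
    exact (hR z _).symm
  · change R z (Vᗮ.orthogonalProjectionOnto v) = 0
    rw [(orthogonalProjectionOnto_orthogonal_eq_zero_iff V v).mpr hv, map_zero]

omit [CompleteSpace W] [CompleteSpace H] in
theorem IsTransversal.mono {T : C(Z, W →L[ℂ] H)} {V V' : Submodule ℂ H} (h : IsTransversal T V)
    (hV : V ≤ V') : IsTransversal T V' := fun z =>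
  top_le_iff.mp ((h z).symm.le.trans (sup_le_sup_left hV _))

omit [CompleteSpace W] [CompleteSpace H] in
/-- A dense subspace contains a finite-dimensional complement of the range of a Fredholm
operator. -/
theorem exists_finiteDimensional_le_range_sup (T : W →L[ℂ] H) (hT : T.IsFredholm)
    (D : Submodule ℂ H) (hD : Dense (D : Set H)) :
    ∃ V ≤ D, FiniteDimensional ℂ V ∧ T.range ⊔ V = ⊤ := by
  have := hT.isClosed_range
  have := hT.finite_coker
  have hfin : FiniteDimensional ℂ (H ⧸ T.range) := this
  -- The image of a dense subspace in a finite-dimensional quotient is dense and closed, hence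
  -- everything.
  have htop : D.map T.range.mkQ = ⊤ := by
    have hc : IsClosed (D.map T.range.mkQ : Set (H ⧸ T.range)) :=
      Submodule.closed_of_finiteDimensional _
    have hd : Dense (D.map T.range.mkQ : Set (H ⧸ T.range)) := by
      rw [Submodule.map_coe]
      exact (T.range.mkQ_surjective.denseRange).dense_image T.range.mkQL.continuous hD
    exact SetLike.coe_injective (hc.closure_eq ▸ hd.closure_eq)
  let b := Module.finBasis ℂ (H ⧸ T.range)
  have hb : ∀ i, ∃ d ∈ D, T.range.mkQ d = b i := fun i =>
    Submodule.mem_map.mp (htop ▸ Submodule.mem_top)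
  choose d hd hdb using hb
  refine ⟨Submodule.span ℂ (Set.range d), Submodule.span_le.mpr (by rintro _ ⟨i, rfl⟩; exact hd i),
    FiniteDimensional.span_of_finite ℂ (Set.finite_range d), ?_⟩
  have h1 : (Submodule.span ℂ (Set.range d)).map T.range.mkQ = ⊤ := by
    rw [Submodule.map_span, ← Set.range_comp, ← b.span_eq]
    congr 2
    exact funext hdb
  have h2 := congrArg (Submodule.comap T.range.mkQ) h1
  rw [Submodule.comap_map_mkQ, Submodule.comap_top] at h2
  exact h2

/-- A complement of one range is transversal nearby, so finitely many of them suffice over the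
compact set; elsewhere the operators are surjective. The dense `D` allows `V` to be taken inside the
range of an intertwiner later on. -/
theorem exists_transversal_le (T : C(Z, W →L[ℂ] H)) (hT : ∀ z, (T z).IsFredholm)
    (hK : ∃ K : Set Z, IsCompact K ∧ ∀ z ∉ K, (T z).IsInvertible)
    (D : Submodule ℂ H) (hD : Dense (D : Set H)) :
    ∃ V ≤ D, FiniteDimensional ℂ V ∧ IsTransversal T V := by
  obtain ⟨K, hK, hinv⟩ := hK
  choose V hVD hVfin hV using fun z => exists_finiteDimensional_le_range_sup (T z) (hT z) D hD
  have hopen : ∀ z, IsOpen {z' | (T z').range ⊔ V z = ⊤} := fun z => by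
    simp_rw [range_sup_eq_top_iff]
    exact isOpen_setOf_surjective.preimage
      (f := fun z' => (V z)ᗮ.orthogonalProjectionOnto ∘L T z') (by fun_prop)
  obtain ⟨t, ht⟩ := hK.elim_finite_subcover _ hopen fun z _ => Set.mem_iUnion.mpr ⟨z, hV z⟩
  refine ⟨t.sup V, Finset.sup_le fun z _ => hVD z, Submodule.finiteDimensional_finset_sup t V,
    fun z => ?_⟩
  by_cases hz : z ∈ K
  · obtain ⟨z', hz', h⟩ := Set.mem_iUnion₂.mp (ht hz)
    have h' : (T z).range ⊔ V z' = ⊤ := h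
    exact top_le_iff.mp (h'.symm.le.trans (sup_le_sup_left (Finset.le_sup hz') _))
  · rw [LinearMap.range_eq_top.mpr (hinv z hz).surjective, top_sup_eq]

end Transversality

/-! ### The bundle `E(T, V)`, its class, and independence of `V`. -/

section BundleOfKernels

variable {Z : Type u} [TopologicalSpace Z] {W H : Type}
  [NormedAddCommGroup W] [InnerProductSpace ℂ W] [CompleteSpace W]
  [NormedAddCommGroup H] [InnerProductSpace ℂ H]
  {T : C(Z, W →L[ℂ] H)} {V : Submodule ℂ H} {R : C(Z, H →L[ℂ] W)}

omit [CompleteSpace W] in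
theorem IsSection.mem (hR : IsSection T V R) (z : Z) (w : W) : T z (w - R z (T z w)) ∈ V := by
  rw [map_sub]
  exact hR.sub_mem z _

/-- The fibre at z is the range of the projection `Q z` = 1 - R T, which depends continuously on z.
Nearby projections are conjugate, and the conjugating operator trivialises the family. -/
theorem IsSection.isVectorBundle (hR : IsSection T V R) [FiniteDimensional ℂ V]
    (hT : ∀ z, FiniteDimensional ℂ (T z).ker) : (kernelFamily T V).IsVectorBundle := by
  refine ⟨continuous_fst.comp (continuous_kernelFamily_pair T V), fun z₀ => ?_⟩
  let Q : Z → W →L[ℂ] W := fun z => 1 - R z ∘L T z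
  have hQV : ∀ z w, T z (Q z w) ∈ V := hR.mem
  have hQ : ∀ z w, T z w ∈ V → Q z w = w := fun z w hw => by
    change w - R z (T z w) = w
    rw [hR.eq_zero z _ hw, sub_zero]
  have hQQ : ∀ z, Q z * Q z = Q z := fun z =>
    ContinuousLinearMap.ext fun w => hQ z _ (hQV z w)
  -- The classical intertwiner of two projections: `G z * Q z = Q z₀ * G z`, and `G z₀ = 1`, so that
  -- it is a unit near `z₀`.
  let G : Z → W →L[ℂ] W := fun z => Q z₀ * Q z + (1 - Q z₀) * (1 - Q z)
  have hGc : Continuous G := by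
    have : Continuous Q := by fun_prop
    fun_prop
  have hG₀ : G z₀ = 1 := by
    simp only [G, mul_sub, sub_mul, hQQ, mul_one, one_mul]
    abel
  have hGQ : ∀ z, G z * Q z = Q z₀ * G z := fun z => by
    simp only [G, mul_sub, sub_mul, mul_add, add_mul, mul_one, one_mul, mul_assoc, hQQ]
    simp only [← mul_assoc, hQQ]
    abel
  have hU : IsOpen {z | IsUnit (G z)} := Units.isOpen.preimage hGc
  have := hT z₀
  have hfin : FiniteDimensional ℂ (V.comap (T z₀).toLinearMap) := inferInstance
  let ψ : V.comap (T z₀).toLinearMap ≃L[ℂ]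
      (Fin (Module.finrank ℂ (V.comap (T z₀).toLinearMap)) → ℂ) :=
    ContinuousLinearEquiv.ofFinrankEq (by simp)
  have hmem : ∀ z w, T z w ∈ V → T z₀ (G z w) ∈ V := fun z w hw => by
    have h : Q z₀ (G z w) = G z (Q z w) := (congrArg (fun f : W →L[ℂ] W => f w) (hGQ z)).symm
    rw [hQ z w hw] at h
    rw [← h]
    exact hQV _ _
  have hmem' : ∀ z, IsUnit (G z) → ∀ w, T z₀ w ∈ V → T z (Ring.inverse (G z) w) ∈ V := by
    intro z hz w hw
    have h : Q z * Ring.inverse (G z) = Ring.inverse (G z) * Q z₀ := by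
      rw [← Ring.inverse_mul_cancel_left (G z) (Q z * _) hz, ← mul_assoc (G z), hGQ, mul_assoc,
        Ring.mul_inverse_cancel _ hz, mul_one]
    have h' : Q z (Ring.inverse (G z) w) = Ring.inverse (G z) (Q z₀ w) :=
      congrArg (fun f : W →L[ℂ] W => f w) h
    rw [hQ z₀ w hw] at h'
    rw [← h']
    exact hQV _ _
  let φ : ∀ z : {z | IsUnit (G z)}, V.comap (T z).toLinearMap ≃ₗ[ℂ] V.comap (T z₀).toLinearMap :=
    fun z =>
    { toFun := fun w => ⟨G z w.1, hmem z w.1 w.2⟩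
      map_add' := fun v w => Subtype.ext (map_add (G z) v.1 w.1)
      map_smul' := fun a w => Subtype.ext (map_smul (G z) a w.1)
      invFun := fun w => ⟨Ring.inverse (G z) w.1, hmem' z z.2 w.1 w.2⟩
      left_inv := fun w => Subtype.ext
        (congrArg (fun f : W →L[ℂ] W => f w.1) (Ring.inverse_mul_cancel _ z.2))
      right_inv := fun w => Subtype.ext
        (congrArg (fun f : W →L[ℂ] W => f w.1) (Ring.mul_inverse_cancel _ z.2)) }
  have hGi : Continuous fun z : {z | IsUnit (G z)} => Ring.inverse (G z) := by
    refine continuous_iff_continuousAt.mpr fun z => ?_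
    obtain ⟨g, hg⟩ := z.2
    exact ContinuousAt.comp (f := fun z : {z | IsUnit (G z)} => G z)
      (by rw [← hg]; exact NormedRing.inverse_continuousAt g)
      (hGc.comp continuous_subtype_val).continuousAt
  refine ⟨_, hU, by simp [hG₀], _, fun z => (φ z).trans ψ.toLinearEquiv, ?_, ?_⟩
  · refine ψ.continuous.comp (Continuous.subtype_mk ?_ _)
    have h := (continuous_kernelFamily_pair T V).comp
      (continuous_subtype_val (p := fun p : (kernelFamily T V).Total => IsUnit (G p.proj)))
    exact (hGc.comp (continuous_fst.comp h)).clm_apply (continuous_snd.comp h)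
  · refine continuous_to_kernelFamily (continuous_subtype_val.comp continuous_fst) ?_
    exact (hGi.comp continuous_fst).clm_apply
      (continuous_subtype_val.comp (ψ.symm.continuous.comp continuous_snd))

omit [CompleteSpace W] in
/-- On a transversal subspace, the restricted morphism is bijective exactly where the operator
is. -/
theorem bijective_restrictedMorphism_iff (hV : IsTransversal T V) (z : Z) :
    Function.Bijective ((restrictedMorphism T V).map z) ↔ Function.Bijective (T z) := by
  constructor
  · rintro ⟨h1, h2⟩
    constructor
    · refine (injective_iff_map_eq_zero _).mpr fun w hw => ?_
      have := @h1 ⟨w, by simp [hw]⟩ 0 (Subtype.ext (by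
        rw [map_zero]
        exact hw))
      exact congrArg Subtype.val this
    · intro y
      obtain ⟨a, ⟨w, rfl⟩, v, hv, e⟩ :=
        Submodule.mem_sup.mp (hV z ▸ Submodule.mem_top : (y : H) ∈ _)
      obtain ⟨w', hw'⟩ := h2 ⟨v, hv⟩
      refine ⟨w + w'.1, ?_⟩
      rw [map_add, ← e]
      exact congrArg₂ _ rfl (congrArg Subtype.val hw')
  · rintro ⟨h1, h2⟩
    constructor
    · intro v w h
      exact Subtype.ext (h1 (congrArg Subtype.val h))
    · intro v
      obtain ⟨w, hw⟩ := h2 v.1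
      exact ⟨⟨w, by change T z w ∈ V; rw [hw]; exact v.2⟩, Subtype.ext hw⟩

variable [CompleteSpace H]

/-- By transversality the support is exactly the set of non-invertibility. This set is closed, as
invertibility is open, and it lies in the given compact set. -/
theorem isRelative_indexTriple {Y : Set Z} [FiniteDimensional ℂ V]
    (hK : ∃ K : Set Z, IsCompact K ∧ ∀ z ∉ K, (T z).IsInvertible)
    (hY : ∀ z ∈ Y, (T z).IsInvertible) (hV : IsTransversal T V)
    (h : (kernelFamily T V).IsVectorBundle) : (indexTriple T V h).IsRelative Y := by
  have e : (indexTriple T V h).supp = {z | ¬ (T z).IsInvertible} := by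
    ext z
    refine not_congr ((bijective_restrictedMorphism_iff hV z).trans ?_)
    refine ⟨fun hb => ?_, fun hi => hi.bijective⟩
    exact ⟨ContinuousLinearEquiv.ofBijective (T z) (LinearMap.ker_eq_bot.mpr hb.1)
      (LinearMap.range_eq_top.mpr hb.2), rfl⟩
  rw [Triple.IsRelative, e]
  obtain ⟨K, hK, hinv⟩ := hK
  refine ⟨hK.of_isClosed_subset ?_ fun z hz => by_contra fun hn => hz (hinv z hn),
    Set.disjoint_left.mpr fun z hz hz' => hz (hY z hz')⟩
  exact isClosed_compl_iff.mpr ((ContinuousLinearEquiv.isOpen (𝕜 := ℂ) (E := W) (F := H)).preimage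
    T.continuous)

omit [CompleteSpace W] [CompleteSpace H] in
/-- Enlarging the transversal subspace adds a trivial triple. -/
theorem IsSection.isomorphic_of_le {V' : Submodule ℂ H} [FiniteDimensional ℂ V]
    [FiniteDimensional ℂ V'] (hR : IsSection T V R) (hV : V ≤ V')
    (h : (kernelFamily T V).IsVectorBundle) (h' : (kernelFamily T V').IsVectorBundle) :
    Triple.Isomorphic
      ((indexTriple T V h).prod (Triple.productId Z (Vᗮ ⊓ V' : Submodule ℂ H)))
      ((indexTriple T V' h').prod (Triple.productId Z PUnit.{1})) := by
  refine Triple.Isomorphic.trans ?_ (Triple.isomorphic_prod_zero _)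
  set P : H →L[ℂ] H := Vᗮ.starProjection
  have hPV : ∀ y, y - P y ∈ V := fun y => by
    have := Submodule.sub_starProjection_mem_orthogonal (K := Vᗮ) y
    rwa [Submodule.orthogonal_orthogonal] at this
  have hPm : ∀ y, P y ∈ Vᗮ := fun y => Submodule.starProjection_apply_mem _ y
  have hPN : ∀ y ∈ V', P y ∈ (Vᗮ ⊓ V' : Submodule ℂ H) := fun y hy => ⟨hPm y, by
    have := V'.sub_mem hy (hV (hPV y))
    rwa [sub_sub_cancel] at this⟩
  have hP0 : ∀ v ∈ V, P v = 0 := fun v hv => by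
    rw [Submodule.starProjection_apply_eq_zero_iff, Submodule.orthogonal_orthogonal]
    exact hv
  have hP1 : ∀ y ∈ Vᗮ, P y = y := fun y hy => Submodule.starProjection_eq_self_iff.mpr hy
  -- Modulo `V` the operator `R z` is a right inverse of `T z`, and `P` forgets exactly `V`.
  have hPT : ∀ z y, P (T z (R z y)) = P y := fun z y => by
    have := hP0 _ (hR.sub_mem z y)
    rw [map_sub, sub_eq_zero] at this
    exact this.symm
  have hRP : ∀ z y, R z (P y) = R z y := fun z y => by
    have := hR.eq_zero z _ (hPV y)
    rw [map_sub, sub_eq_zero] at this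
    exact this.symm
  have hRT : ∀ z y, R z (T z (R z y)) = R z y := fun z y => by rw [← hRP, hPT, hRP]
  have hTR' : ∀ z, ∀ y ∈ V', T z (R z y) ∈ V' := fun z y hy => by
    have := V'.sub_mem hy (hV (hR.sub_mem z y))
    rwa [sub_sub_cancel] at this
  -- With N = Vᗮ ⊓ V' the isomorphisms are (w, y) ↦ w + R y from E(T,V) ⊕ N to E(T,V') and (v, y) ↦
  -- v + T R y from V ⊕ N to V'; their inverses split off w - R T w and w - T R w. They carry T ⊕ 1
  -- to T by linearity.
  refine ⟨⟨fun z =>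
    { toFun := fun p => (⟨p.1.1 + R z p.2.1, by
        change T z _ ∈ V'
        rw [map_add]
        exact V'.add_mem (hV p.1.2) (hTR' z _ p.2.2.2)⟩ : V'.comap (T z).toLinearMap)
      invFun := fun w => ((⟨w.1 - R z (T z w.1), hR.mem z w.1⟩ : V.comap (T z).toLinearMap),
        (⟨P (T z w.1), hPN _ w.2⟩ : (Vᗮ ⊓ V' : Submodule ℂ H)))
      map_add' := ?_, map_smul' := ?_, left_inv := ?_, right_inv := ?_ }, ?_, ?_⟩,
    ⟨fun z =>
    { toFun := fun p => (⟨p.1.1 + T z (R z p.2.1), V'.add_mem (hV p.1.2) (hTR' z _ p.2.2.2)⟩ : V')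
      invFun := fun w => ((⟨w.1 - T z (R z w.1), hR.sub_mem z w.1⟩ : V),
        (⟨P w.1, hPN _ w.2⟩ : (Vᗮ ⊓ V' : Submodule ℂ H)))
      map_add' := ?_, map_smul' := ?_, left_inv := ?_, right_inv := ?_ }, ?_, ?_⟩, ?_⟩
  · intro p q
    refine Subtype.ext ?_
    change (p.1.1 + q.1.1) + R z (p.2.1 + q.2.1) = (p.1.1 + R z p.2.1) + (q.1.1 + R z q.2.1)
    rw [map_add]
    abel
  · intro a p
    refine Subtype.ext ?_
    change a • p.1.1 + R z (a • p.2.1) = a • (p.1.1 + R z p.2.1)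
    rw [map_smul, smul_add]
  · rintro ⟨⟨w, hw : T z w ∈ V⟩, ⟨y, hy⟩⟩
    refine Prod.ext (Subtype.ext ?_) (Subtype.ext ?_)
    · change (w + R z y) - R z (T z (w + R z y)) = w
      rw [map_add, map_add, hR.eq_zero z _ hw, hRT]
      abel
    · change P (T z (w + R z y)) = y
      rw [map_add, map_add, hP0 _ hw, hPT, hP1 y hy.1, zero_add]
  · rintro ⟨w, hw⟩
    refine Subtype.ext ?_
    change (w - R z (T z w)) + R z (P (T z w)) = w
    rw [hRP]
    abel
  · have h1 := (continuous_kernelFamily_pair T V).comp (VectorFamily.continuous_prod_fst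
      (kernelFamily T V) (VectorFamily.productBundle Z (Vᗮ ⊓ V' : Submodule ℂ H)))
    have h2 := VectorFamily.continuous_productBundle_pair.comp (VectorFamily.continuous_prod_snd
      (kernelFamily T V) (VectorFamily.productBundle Z (Vᗮ ⊓ V' : Submodule ℂ H)))
    refine continuous_to_kernelFamily (continuous_fst.comp h1) ?_
    exact (continuous_snd.comp h1).add ((R.continuous.comp (continuous_fst.comp h1)).clm_apply
      (continuous_subtype_val.comp (continuous_snd.comp h2)))
  · have h1 := continuous_kernelFamily_pair T V'
    have hT : Continuous fun p : (kernelFamily T V').Total => T p.proj p.snd.1 :=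
      (T.continuous.comp (continuous_fst.comp h1)).clm_apply (continuous_snd.comp h1)
    refine VectorFamily.continuous_to_prod
      (continuous_to_kernelFamily (continuous_fst.comp h1) ?_)
      (VectorFamily.continuous_to_productBundle (continuous_fst.comp h1) ?_)
    · exact (continuous_snd.comp h1).sub ((R.continuous.comp (continuous_fst.comp h1)).clm_apply hT)
    · exact Continuous.subtype_mk (P.continuous.comp hT) _
  · intro p q
    refine Subtype.ext ?_
    change (p.1.1 + q.1.1) + T z (R z (p.2.1 + q.2.1))
      = (p.1.1 + T z (R z p.2.1)) + (q.1.1 + T z (R z q.2.1))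
    rw [map_add, map_add]
    abel
  · intro a p
    refine Subtype.ext ?_
    change a • p.1.1 + T z (R z (a • p.2.1)) = a • (p.1.1 + T z (R z p.2.1))
    rw [map_smul, map_smul, smul_add]
  · rintro ⟨⟨w, hw⟩, ⟨y, hy⟩⟩
    refine Prod.ext (Subtype.ext ?_) (Subtype.ext ?_)
    · change (w + T z (R z y)) - T z (R z (w + T z (R z y))) = w
      rw [map_add, hR.eq_zero z _ hw, hRT]
      simp
    · change P (w + T z (R z y)) = y
      rw [map_add, hP0 _ hw, hPT, hP1 y hy.1, zero_add]
  · rintro ⟨w, hw⟩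
    refine Subtype.ext ?_
    change (w - T z (R z w)) + T z (R z (P w)) = w
    rw [hRP]
    abel
  · have h1 := VectorFamily.continuous_productBundle_pair.comp (VectorFamily.continuous_prod_fst
      (VectorFamily.productBundle Z V)
      (VectorFamily.productBundle Z (Vᗮ ⊓ V' : Submodule ℂ H)))
    have h2 := VectorFamily.continuous_productBundle_pair.comp (VectorFamily.continuous_prod_snd
      (VectorFamily.productBundle Z V)
      (VectorFamily.productBundle Z (Vᗮ ⊓ V' : Submodule ℂ H)))
    refine VectorFamily.continuous_to_productBundle (continuous_fst.comp h1) ?_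
    exact Continuous.subtype_mk ((continuous_subtype_val.comp (continuous_snd.comp h1)).add
      ((T.continuous.comp (continuous_fst.comp h1)).clm_apply
        ((R.continuous.comp (continuous_fst.comp h1)).clm_apply
          (continuous_subtype_val.comp (continuous_snd.comp h2))))) _
  · have h1 := VectorFamily.continuous_productBundle_pair (Z := Z) (V := V')
    have h2 := continuous_subtype_val.comp (continuous_snd.comp h1)
    refine VectorFamily.continuous_to_prod
      (VectorFamily.continuous_to_productBundle (continuous_fst.comp h1) ?_)
      (VectorFamily.continuous_to_productBundle (continuous_fst.comp h1) ?_)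
    · exact Continuous.subtype_mk (h2.sub ((T.continuous.comp (continuous_fst.comp h1)).clm_apply
        ((R.continuous.comp (continuous_fst.comp h1)).clm_apply h2))) _
    · exact Continuous.subtype_mk (P.continuous.comp h2) _
  · rintro z ⟨w, y⟩
    refine Subtype.ext ?_
    change T z (w.1 + R z y.1) = T z w.1 + T z (R z y.1)
    exact map_add _ _ _

/-- Both classes are compared with the one of `V ⊔ V'`. -/
theorem mk_indexTriple_eq {Y : Set Z} {V' : Submodule ℂ H} [FiniteDimensional ℂ V]
    [FiniteDimensional ℂ V'] (hT : ∀ z, FiniteDimensional ℂ (T z).ker)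
    (hK : ∃ K : Set Z, IsCompact K ∧ ∀ z ∉ K, (T z).IsInvertible)
    (hY : ∀ z ∈ Y, (T z).IsInvertible) (hV : IsTransversal T V) (hV' : IsTransversal T V')
    (h : (kernelFamily T V).IsVectorBundle) (h' : (kernelFamily T V').IsVectorBundle) :
    KTheory.mk (indexTriple T V h) (isRelative_indexTriple hK hY hV h)
      = KTheory.mk (indexTriple T V' h') (isRelative_indexTriple hK hY hV' h') := by
  obtain ⟨R, hR⟩ := hV.exists_isSection
  obtain ⟨R', hR'⟩ := hV'.exists_isSection
  have hs := hV.mono (le_sup_left : V ≤ V ⊔ V')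
  obtain ⟨S, hS⟩ := hs.exists_isSection
  have h'' := hS.isVectorBundle hT
  have hrel := isRelative_indexTriple hK hY hs h''
  exact (KTheory.mk_eq_of_isomorphic_prod _ hrel (Triple.isTrivial_productId _)
    (Triple.isTrivial_productId _) (hR.isomorphic_of_le le_sup_left h h'')).trans
    (KTheory.mk_eq_of_isomorphic_prod _ hrel (Triple.isTrivial_productId _)
    (Triple.isTrivial_productId _) (hR'.isomorphic_of_le le_sup_right h' h'')).symm

/-- A family of Fredholm operators of index `0` that is invertible on `Y` and outside a compact set
has an index bundle. -/
theorem exists_hasIndexBundle (T : C(Z, W →L[ℂ] H)) (Y : Set Z) (hT : ∀ z, (T z).IsFredholm)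
    (hind : ∀ z, Module.finrank ℂ (T z).ker = Module.finrank ℂ (H ⧸ (T z).range))
    (hK : ∃ K : Set Z, IsCompact K ∧ ∀ z ∉ K, (T z).IsInvertible)
    (hY : ∀ z ∈ Y, (T z).IsInvertible) : ∃ κ, HasIndexBundle T Y κ := by
  obtain ⟨V, -, hfin, hV⟩ := exists_transversal_le T hT hK ⊤ dense_univ
  obtain ⟨R, hR⟩ := hV.exists_isSection
  have hk : ∀ z, FiniteDimensional ℂ (T z).ker := fun z => (hT z).finite_ker
  refine ⟨KTheory.mk (indexTriple T V (hR.isVectorBundle hk))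
    (isRelative_indexTriple hK hY hV _), hT, hind, hK, hY, ⟨V, hfin, hV⟩, fun V' _ hV' => ?_⟩
  obtain ⟨R', hR'⟩ := hV'.exists_isSection
  exact ⟨hR'.isVectorBundle hk, isRelative_indexTriple hK hY hV' _,
    mk_indexTriple_eq hk hK hY hV hV' _ _⟩

end BundleOfKernels

/-! ### Homotopy invariance, intertwined families, reduction to matrices. -/

section Comparison

variable {Z : Type u} [TopologicalSpace Z] {W H W' H' : Type}
  [NormedAddCommGroup W] [InnerProductSpace ℂ W] [CompleteSpace W]
  [NormedAddCommGroup H] [InnerProductSpace ℂ H] [CompleteSpace H]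
  [NormedAddCommGroup W'] [InnerProductSpace ℂ W'] [CompleteSpace W']
  [NormedAddCommGroup H'] [InnerProductSpace ℂ H'] [CompleteSpace H']

omit [CompleteSpace W] [CompleteSpace H] in
theorem isomorphic_slice_indexTriple (T : C(Z × unitInterval, W →L[ℂ] H)) (t : unitInterval)
    (S : C(Z, W →L[ℂ] H)) (hS : ∀ z, S z = T (z, t)) {V : Submodule ℂ H} [FiniteDimensional ℂ V]
    (h : (kernelFamily T V).IsVectorBundle) (h' : (kernelFamily S V).IsVectorBundle) :
    Triple.Isomorphic ((indexTriple T V h).pullback (fun z => (z, t)) (by fun_prop))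
      (indexTriple S V h') := by
  have hST : ∀ z, V.comap (T (z, t)).toLinearMap = V.comap (S z).toLinearMap := fun z => by
    rw [hS]
  refine ⟨⟨fun z => LinearEquiv.ofEq _ _ (hST z), ?_, ?_⟩, ⟨fun z => LinearEquiv.refl ℂ V, ?_, ?_⟩,
    fun z v => Subtype.ext ?_⟩
  · have h1 := VectorFamily.continuous_pullback_pair (fun z : Z => (z, t)) (kernelFamily T V)
    refine continuous_to_kernelFamily (continuous_fst.comp h1) ?_
    exact continuous_snd.comp ((continuous_kernelFamily_pair T V).comp (continuous_snd.comp h1))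
  · have h1 := continuous_kernelFamily_pair S V
    refine continuous_induced_rng.mpr ((continuous_fst.comp h1).prodMk ?_)
    exact continuous_to_kernelFamily ((continuous_fst.comp h1).prodMk continuous_const)
      (continuous_snd.comp h1)
  · have h1 := VectorFamily.continuous_pullback_pair (fun z : Z => (z, t))
      (VectorFamily.productBundle (Z × unitInterval) V)
    refine VectorFamily.continuous_to_productBundle (continuous_fst.comp h1) ?_
    exact continuous_snd.comp (VectorFamily.continuous_productBundle_pair.comp
      (continuous_snd.comp h1))
  · have h1 := VectorFamily.continuous_productBundle_pair (Z := Z) (V := V)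
    refine continuous_induced_rng.mpr ((continuous_fst.comp h1).prodMk ?_)
    exact VectorFamily.continuous_to_productBundle
      ((continuous_fst.comp h1).prodMk continuous_const) (continuous_snd.comp h1)
  · change S z v.1 = T (z, t) v.1
    rw [hS]

omit [CompleteSpace W] [CompleteSpace H] in
/-- Homotopy invariance of the index bundle. -/
theorem HasIndexBundle.eq_of_homotopy {T : C(Z × unitInterval, W →L[ℂ] H)} {Y : Set Z}
    {κ' : KTheory (Z × unitInterval) (Y ×ˢ Set.univ)} (hT : HasIndexBundle T (Y ×ˢ Set.univ) κ')
    {S₀ S₁ : C(Z, W →L[ℂ] H)} (h₀ : ∀ z, S₀ z = T (z, 0)) (h₁ : ∀ z, S₁ z = T (z, 1))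
    {κ₀ κ₁ : KTheory Z Y} (hS₀ : HasIndexBundle S₀ Y κ₀) (hS₁ : HasIndexBundle S₁ Y κ₁) :
    κ₀ = κ₁ := by
  -- A space that is transversal over the whole cylinder is so at both ends, and its index triple is
  -- the homotopy.
  obtain ⟨V, hfin, hV⟩ := hT.exists_transversal
  obtain ⟨b, hb, -⟩ := hT.eq_mk V hV
  obtain ⟨b₀, hb₀, rfl⟩ := hS₀.eq_mk V fun z => by rw [h₀]; exact hV _
  obtain ⟨b₁, hb₁, rfl⟩ := hS₁.eq_mk V fun z => by rw [h₁]; exact hV _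
  exact KTheory.mk_eq_of_homotopic _ _ ⟨_, hb, isomorphic_slice_indexTriple T 0 S₀ h₀ b b₀,
    isomorphic_slice_indexTriple T 1 S₁ h₁ b b₁⟩

omit [CompleteSpace W] [CompleteSpace H] in
/-- Two families that are intertwined by injective operators, and for which the second one has
the regularity property that `T' w = j h` only has solutions in the image of `c`, given by a
continuous parametrix, have the same index bundle. -/
theorem HasIndexBundle.eq_of_intertwining {T : C(Z, W →L[ℂ] H)} {T' : C(Z, W' →L[ℂ] H')}
    {Y : Set Z} {κ κ' : KTheory Z Y} (hT : HasIndexBundle T Y κ) (hT' : HasIndexBundle T' Y κ')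
    (c : W →L[ℂ] W') (j : H →L[ℂ] H') (hc : Function.Injective c) (hj : Function.Injective j)
    (hjd : DenseRange j) (hcj : ∀ z u, T' z (c u) = j (T z u)) (G : C(Z, W' →L[ℂ] W))
    (F : H →L[ℂ] W) (hG : ∀ z w h, T' z w = j h → w = c (G z w + F h)) : κ = κ' := by
  -- With `V'` inside the range of `j`, the preimage `V` is mapped isomorphically onto `V'`.
  obtain ⟨V', hV'j, hfin', hV'⟩ := exists_transversal_le T' hT'.isFredholm hT'.exists_isCompact
    j.range hjd
  let V : Submodule ℂ H := V'.comap j.toLinearMap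
  have hmem : ∀ h, h ∈ V ↔ j h ∈ V' := fun h => Iff.rfl
  have hjk : j.toLinearMap.ker = ⊥ := LinearMap.ker_eq_bot.mpr hj
  have : FiniteDimensional ℂ j.toLinearMap.ker := by rw [hjk]; infer_instance
  have hfin : FiniteDimensional ℂ V := inferInstance
  let ej : V ≃ₗ[ℂ] V' := LinearEquiv.ofBijective
    (j.toLinearMap.restrict (p := V) (q := V') fun _ h => h) ⟨fun v w h => Subtype.ext
      (hj (congrArg Subtype.val h)), fun v => by
        obtain ⟨h, hh⟩ := hV'j v.2
        exact ⟨⟨h, (hmem h).mpr (by rw [show j h = v.1 from hh]; exact v.2)⟩, Subtype.ext hh⟩⟩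
  have hej : ∀ v : V', j (ej.symm v).1 = v.1 := fun v =>
    congrArg Subtype.val (ej.apply_symm_apply v)
  -- Write j h = T' w + v with v in `V'`. Then T' w lies in the range of `j`, regularity gives w = c
  -- u, and injectivity of `j` brings the decomposition back to `H`.
  have hV : IsTransversal T V := fun z => eq_top_iff.mpr fun h _ => by
    obtain ⟨a, ⟨w, rfl⟩, v, hv, e⟩ :=
      Submodule.mem_sup.mp (hV' z ▸ Submodule.mem_top : (j h : H') ∈ _)
    have e1 : T' z w = j (h - (ej.symm ⟨v, hv⟩).1) := by
      rw [map_sub, hej, ← e]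
      exact (add_sub_cancel_right _ _).symm
    rw [hG z w _ e1, hcj] at e1
    rw [← sub_add_cancel h (ej.symm ⟨v, hv⟩).1]
    exact Submodule.add_mem_sup ⟨_, hj e1⟩ (ej.symm ⟨v, hv⟩).2
  obtain ⟨b, hb, rfl⟩ := hT.eq_mk V hV
  obtain ⟨b', hb', rfl⟩ := hT'.eq_mk V' hV'
  refine KTheory.mk_eq_of_isomorphic _ _ ?_
  -- The map `c` need not have a bounded inverse on its range. On the fibres the parametrix
  -- expresses the preimage of w continuously through w and T' w.
  have hej' : ∀ (z) (w : V'.comap (T' z).toLinearMap),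
      w.1 = c (G z w.1 + F (ej.symm ⟨T' z w.1, w.2⟩).1) := fun z w => hG z w.1 _ (hej ⟨T' z w.1, w.2⟩).symm
  refine ⟨⟨fun z =>
    { toFun := fun u => (⟨c u.1, by
        change T' z (c u.1) ∈ V'
        rw [hcj]
        exact u.2⟩ : V'.comap (T' z).toLinearMap)
      invFun := fun w => (⟨G z w.1 + F (ej.symm ⟨T' z w.1, w.2⟩).1, by
        change j (T z _) ∈ V'
        rw [← hcj]
        exact (congrArg (fun x => T' z x ∈ V') (hej' z w)).mp w.2⟩ : V.comap (T z).toLinearMap)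
      map_add' := fun u v => Subtype.ext (map_add c _ _)
      map_smul' := fun a u => Subtype.ext (map_smul c _ _)
      left_inv := fun u => Subtype.ext (hc (hej' z _).symm)
      right_inv := fun w => Subtype.ext (hej' z w).symm }, ?_, ?_⟩,
    ⟨fun z => ej, ?_, ?_⟩, fun z u => Subtype.ext (hcj z u.1)⟩
  · have h1 := continuous_kernelFamily_pair T V
    exact continuous_to_kernelFamily (continuous_fst.comp h1)
      (c.continuous.comp (continuous_snd.comp h1))
  · have h1 := continuous_kernelFamily_pair T' V'
    refine continuous_to_kernelFamily (continuous_fst.comp h1) ?_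
    refine Continuous.add ((G.continuous.comp (continuous_fst.comp h1)).clm_apply
      (continuous_snd.comp h1)) (F.continuous.comp (continuous_subtype_val.comp
      (ej.symm.toLinearMap.continuous_of_finiteDimensional.comp (Continuous.subtype_mk ?_ _))))
    exact (T'.continuous.comp (continuous_fst.comp h1)).clm_apply (continuous_snd.comp h1)
  · have h1 := VectorFamily.continuous_productBundle_pair (Z := Z) (V := V)
    exact VectorFamily.continuous_to_productBundle (continuous_fst.comp h1)
      (ej.toLinearMap.continuous_of_finiteDimensional.comp (continuous_snd.comp h1))
  · have h1 := VectorFamily.continuous_productBundle_pair (Z := Z) (V := V')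
    exact VectorFamily.continuous_to_productBundle (continuous_fst.comp h1)
      (ej.symm.toLinearMap.continuous_of_finiteDimensional.comp (continuous_snd.comp h1))

/-- The triple of a continuous family of endomorphisms of a finite-dimensional space. -/
def endTriple {F : Type} [NormedAddCommGroup F] [NormedSpace ℂ F] [FiniteDimensional ℂ F]
    (Λ : C(Z, F →L[ℂ] F)) : Triple Z where
  E₀ := VectorFamily.productBundle Z F
  E₁ := VectorFamily.productBundle Z F
  isVectorBundle₀ := VectorFamily.isVectorBundle_productBundle F
  isVectorBundle₁ := VectorFamily.isVectorBundle_productBundle F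
  a := ⟨fun z => (Λ z).toLinearMap, by
    have h := VectorFamily.continuous_productBundle_pair (Z := Z) (V := F)
    exact VectorFamily.continuous_to_productBundle (continuous_fst.comp h)
      ((Λ.continuous.comp (continuous_fst.comp h)).clm_apply (continuous_snd.comp h))⟩

set_option maxHeartbeats 1000000 in
/-- If `(ev, T) : W → F × H` identifies `W` with the space of the pairs `(c, h)` with `Λ c = k h`,
where `F` is finite-dimensional and `k` is surjective, then the index bundle of `T` is `[F, F, Λ]`. -/
theorem HasIndexBundle.eq_mk_endTriple {F : Type} [NormedAddCommGroup F] [NormedSpace ℂ F]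
    [FiniteDimensional ℂ F] {T : C(Z, W →L[ℂ] H)} {Y : Set Z} {κ : KTheory Z Y}
    (hT : HasIndexBundle T Y κ) (ev : W →L[ℂ] F) (Λ : C(Z, F →L[ℂ] F)) (k : C(Z, H →L[ℂ] F))
    (s : C(Z, F →L[ℂ] H)) (hs : ∀ z c, k z (s z c) = c) (G : C(Z, F × H →L[ℂ] W))
    (hk : ∀ z u, Λ z (ev u) = k z (T z u))
    (hG : ∀ z c h, Λ z c = k z h → ev (G z (c, h)) = c ∧ T z (G z (c, h)) = h)
    (hG' : ∀ z u, G z (ev u, T z u) = u) (hΛ : (endTriple Λ).IsRelative Y) :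
    κ = KTheory.mk (endTriple Λ) hΛ := by
  obtain ⟨V, hfin, hV⟩ := hT.exists_transversal
  obtain ⟨b, hb, rfl⟩ := hT.eq_mk V hV
  obtain ⟨R, hR⟩ := hV.exists_isSection
  refine KTheory.mk_eq_of_isomorphic_prod _ _ (Triple.isTrivial_productId F)
    (Triple.isTrivial_productId V) ?_
  -- The map (c, v) ↦ Λ c - k v from F × V to F has kernel E(T,V), embedded by (ev, T). The pair
  -- (`σ₁`, `σ₂`) is a section of it, built from the section `R` of T modulo V and the section `s`
  -- of `k`.
  let σ₁ : Z → F →L[ℂ] F := fun z => ev ∘L R z ∘L s z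
  let σ₂ : Z → F →L[ℂ] V := fun z => (T z ∘L R z ∘L s z - s z).codRestrict V fun c => by
    have := V.neg_mem (hR.sub_mem z (s z c))
    rwa [neg_sub] at this
  have hσ₁ : Continuous fun p : Z × F => σ₁ p.1 p.2 := by fun_prop
  have hσ₂ : Continuous fun p : Z × F => σ₂ p.1 p.2 := by
    refine Continuous.subtype_mk (f := fun p : Z × F => T p.1 (R p.1 (s p.1 p.2)) - s p.1 p.2)
      ?_ _
    fun_prop
  have hσ : ∀ z c, Λ z (σ₁ z c) - k z (σ₂ z c).1 = c := fun z c => by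
    change Λ z (ev (R z (s z c))) - k z (T z (R z (s z c)) - s z c) = c
    rw [hk, map_sub, sub_sub_cancel, hs]
  have hsub : ∀ z c (v : V), Λ z (c - σ₁ z (Λ z c - k z v.1))
      = k z (v - σ₂ z (Λ z c - k z v.1)).1 := fun z c v => by
    obtain ⟨d, hd⟩ : ∃ d, d = Λ z c - k z v.1 := ⟨_, rfl⟩
    rw [← hd, map_sub, Submodule.coe_sub, map_sub, sub_eq_iff_eq_add.mp (hσ z d), hd]
    abel
  -- Kernel plus section: (u, c) ↦ (ev u, T u) + σ c. The inverse reads off c = Λ c' - k v and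
  -- recovers u from the remaining pair by `G`.
  let φ₀ : ∀ z, (V.comap (T z).toLinearMap × F) ≃ₗ[ℂ] (F × V) := fun z =>
    { toFun := fun p => (ev p.1.1 + σ₁ z p.2, (⟨T z p.1.1, p.1.2⟩ : V) + σ₂ z p.2)
      invFun := fun q => (⟨G z (q.1 - σ₁ z (Λ z q.1 - k z q.2.1),
          (q.2 - σ₂ z (Λ z q.1 - k z q.2.1)).1), by
            change T z _ ∈ V
            rw [(hG z _ _ (hsub z q.1 q.2)).2]
            exact Subtype.property _⟩, Λ z q.1 - k z q.2.1)
      map_add' := ?_, map_smul' := ?_, left_inv := ?_, right_inv := ?_ }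
  rotate_left
  · rintro ⟨u, c⟩ ⟨u', c'⟩
    refine Prod.ext ?_ (Subtype.ext ?_)
    · change ev (u.1 + u'.1) + σ₁ z (c + c') = (ev u.1 + σ₁ z c) + (ev u'.1 + σ₁ z c')
      rw [map_add, map_add]
      abel
    · change T z (u.1 + u'.1) + (σ₂ z (c + c')).1
        = (T z u.1 + (σ₂ z c).1) + (T z u'.1 + (σ₂ z c').1)
      rw [map_add, map_add, Submodule.coe_add]
      abel
  · rintro a ⟨u, c⟩
    refine Prod.ext ?_ (Subtype.ext ?_)
    · change ev (a • u.1) + σ₁ z (a • c) = a • (ev u.1 + σ₁ z c)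
      rw [map_smul, map_smul, smul_add]
    · change T z (a • u.1) + (σ₂ z (a • c)).1 = a • (T z u.1 + (σ₂ z c).1)
      rw [map_smul, map_smul, smul_add, Submodule.coe_smul]
  · rintro ⟨u, c⟩
    have e : Λ z (ev u.1 + σ₁ z c) - k z (T z u.1 + (σ₂ z c).1) = c := by
      rw [map_add, map_add, hk, add_sub_add_left_eq_sub, hσ]
    refine Prod.ext (Subtype.ext ?_) e
    change G z (ev u.1 + σ₁ z c - σ₁ z (Λ z (ev u.1 + σ₁ z c) - k z (T z u.1 + (σ₂ z c).1)),
      (T z u.1 + (σ₂ z c).1) - (σ₂ z (Λ z (ev u.1 + σ₁ z c) - k z (T z u.1 + (σ₂ z c).1))).1) = u.1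
    rw [e, add_sub_cancel_right, add_sub_cancel_right, hG']
  · rintro ⟨c, v⟩
    have h := hG z _ _ (hsub z c v)
    refine Prod.ext ?_ (Subtype.ext ?_)
    · change ev (G z _) + σ₁ z (Λ z c - k z v.1) = c
      rw [h.1, sub_add_cancel]
    · change T z (G z _) + (σ₂ z (Λ z c - k z v.1)).1 = v.1
      rw [h.2, Submodule.coe_sub, sub_add_cancel]
  -- The shears that are forced by the square: Λ ⊕ 1 sends φ₀(u, c) to (k(T u + σ₂ c) + c, T u + σ₂
  -- c), and this has to be φ₁(T u, c).
  let φ₁ : ∀ z, (V × F) ≃ₗ[ℂ] (F × V) := fun z =>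
    { toFun := fun p => (p.2 + k z (p.1 + σ₂ z p.2).1, p.1 + σ₂ z p.2)
      invFun := fun q => (q.2 - σ₂ z (q.1 - k z q.2.1), q.1 - k z q.2.1)
      map_add' := ?_, map_smul' := ?_, left_inv := ?_, right_inv := ?_ }
  rotate_left
  · rintro ⟨v, c⟩ ⟨v', c'⟩
    have e : (v + v') + σ₂ z (c + c') = (v + σ₂ z c) + (v' + σ₂ z c') := by
      rw [map_add]
      abel
    refine Prod.ext ?_ e
    change (c + c') + k z ((v + v') + σ₂ z (c + c') : V).1
      = (c + k z (v + σ₂ z c : V).1) + (c' + k z (v' + σ₂ z c' : V).1)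
    rw [e, Submodule.coe_add, map_add]
    abel
  · rintro a ⟨v, c⟩
    have e : a • v + σ₂ z (a • c) = a • (v + σ₂ z c) := by rw [map_smul, smul_add]
    refine Prod.ext ?_ e
    change a • c + k z (a • v + σ₂ z (a • c) : V).1 = a • (c + k z (v + σ₂ z c : V).1)
    rw [e, Submodule.coe_smul, map_smul, smul_add]
  · rintro ⟨v, c⟩
    have e : (c + k z (v + σ₂ z c : V).1) - k z (v + σ₂ z c : V).1 = c := add_sub_cancel_right _ _
    refine Prod.ext ?_ e
    change (v + σ₂ z c) - σ₂ z ((c + k z (v + σ₂ z c : V).1) - k z (v + σ₂ z c : V).1) = v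
    rw [e, add_sub_cancel_right]
  · rintro ⟨c, v⟩
    have e : (v - σ₂ z (c - k z v.1)) + σ₂ z (c - k z v.1) = v := sub_add_cancel _ _
    refine Prod.ext ?_ e
    change (c - k z v.1) + k z ((v - σ₂ z (c - k z v.1)) + σ₂ z (c - k z v.1) : V).1 = c
    rw [e, sub_add_cancel]
  refine ⟨⟨φ₀, ?_, ?_⟩, ⟨φ₁, ?_, ?_⟩, ?_⟩
  · have h1 := (continuous_kernelFamily_pair T V).comp (VectorFamily.continuous_prod_fst
      (kernelFamily T V) (VectorFamily.productBundle Z F))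
    have h2 := VectorFamily.continuous_productBundle_pair.comp (VectorFamily.continuous_prod_snd
      (kernelFamily T V) (VectorFamily.productBundle Z F))
    refine VectorFamily.continuous_to_prod
      (VectorFamily.continuous_to_productBundle (continuous_fst.comp h1) ?_)
      (VectorFamily.continuous_to_productBundle (continuous_fst.comp h1) ?_)
    · exact (ev.continuous.comp (continuous_snd.comp h1)).add (hσ₁.comp h2)
    · exact Continuous.add (Continuous.subtype_mk ((T.continuous.comp
        (continuous_fst.comp h1)).clm_apply (continuous_snd.comp h1)) _) (hσ₂.comp h2)
  · have h1 := VectorFamily.continuous_productBundle_pair.comp (VectorFamily.continuous_prod_fst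
      (VectorFamily.productBundle Z F) (VectorFamily.productBundle Z V))
    have h2 := VectorFamily.continuous_productBundle_pair.comp (VectorFamily.continuous_prod_snd
      (VectorFamily.productBundle Z F) (VectorFamily.productBundle Z V))
    have hz := continuous_fst.comp h1
    have hd := ((Λ.continuous.comp hz).clm_apply (continuous_snd.comp h1)).sub
      ((k.continuous.comp hz).clm_apply (continuous_subtype_val.comp (continuous_snd.comp h2)))
    refine VectorFamily.continuous_to_prod (continuous_to_kernelFamily hz ?_)
      (VectorFamily.continuous_to_productBundle hz hd)
    exact (G.continuous.comp hz).clm_apply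
      (((continuous_snd.comp h1).sub (hσ₁.comp (hz.prodMk hd))).prodMk
      (continuous_subtype_val.comp ((continuous_snd.comp h2).sub (hσ₂.comp (hz.prodMk hd)))))
  · have h1 := VectorFamily.continuous_productBundle_pair.comp (VectorFamily.continuous_prod_fst
      (VectorFamily.productBundle Z V) (VectorFamily.productBundle Z F))
    have h2 := VectorFamily.continuous_productBundle_pair.comp (VectorFamily.continuous_prod_snd
      (VectorFamily.productBundle Z V) (VectorFamily.productBundle Z F))
    have hz := continuous_fst.comp h1
    have hv := (continuous_snd.comp h1).add (hσ₂.comp h2)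
    refine VectorFamily.continuous_to_prod (VectorFamily.continuous_to_productBundle hz ?_)
      (VectorFamily.continuous_to_productBundle hz hv)
    exact (continuous_snd.comp h2).add
      ((k.continuous.comp hz).clm_apply (continuous_subtype_val.comp hv))
  · have h1 := VectorFamily.continuous_productBundle_pair.comp (VectorFamily.continuous_prod_fst
      (VectorFamily.productBundle Z F) (VectorFamily.productBundle Z V))
    have h2 := VectorFamily.continuous_productBundle_pair.comp (VectorFamily.continuous_prod_snd
      (VectorFamily.productBundle Z F) (VectorFamily.productBundle Z V))
    have hz := continuous_fst.comp h1
    have hd := (continuous_snd.comp h1).sub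
      ((k.continuous.comp hz).clm_apply (continuous_subtype_val.comp (continuous_snd.comp h2)))
    exact VectorFamily.continuous_to_prod (VectorFamily.continuous_to_productBundle hz
      ((continuous_snd.comp h2).sub (hσ₂.comp (hz.prodMk hd))))
      (VectorFamily.continuous_to_productBundle hz hd)
  · have key : ∀ (z : Z) (u : W) (c : F),
        Λ z (ev u + σ₁ z c) = c + k z (T z u + (σ₂ z c).1) := fun z u c => by
      rw [map_add, map_add, hk, sub_eq_iff_eq_add.mp (hσ z c)]
      abel
    rintro z ⟨u, c⟩
    exact Prod.ext (key z u.1 c) rfl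

end Comparison

/-! ### Limits of finite-rank operators and Fredholm operators of index zero. -/

section FiniteRank

variable {W H G : Type*} [NormedAddCommGroup W] [NormedSpace ℂ W] [NormedAddCommGroup H]
  [NormedSpace ℂ H] [NormedAddCommGroup G] [NormedSpace ℂ G]

/-- The operators of finite rank. -/
def finiteRankOperators (W H : Type*) [NormedAddCommGroup W] [NormedSpace ℂ W]
    [NormedAddCommGroup H] [NormedSpace ℂ H] : Submodule ℂ (W →L[ℂ] H) where
  carrier := {F | FiniteDimensional ℂ F.range}
  zero_mem' := by
    have h : (0 : W →L[ℂ] H).range = ⊥ := LinearMap.range_zero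
    change FiniteDimensional ℂ (0 : W →L[ℂ] H).range
    rw [h]
    infer_instance
  add_mem' {A B} hA hB := by
    have : FiniteDimensional ℂ A.range := hA
    have : FiniteDimensional ℂ B.range := hB
    exact Submodule.finiteDimensional_of_le (S₂ := A.range ⊔ B.range) (by
      rintro _ ⟨w, rfl⟩
      exact Submodule.add_mem_sup ⟨w, rfl⟩ ⟨w, rfl⟩)
  smul_mem' a A hA := by
    have : FiniteDimensional ℂ A.range := hA
    exact Submodule.finiteDimensional_of_le (S₂ := A.range) (by
      rintro _ ⟨w, rfl⟩
      exact A.range.smul_mem a ⟨w, rfl⟩)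

/-- The norm limits of operators of finite rank. -/
def approximableOperators (W H : Type*) [NormedAddCommGroup W] [NormedSpace ℂ W]
    [NormedAddCommGroup H] [NormedSpace ℂ H] : Submodule ℂ (W →L[ℂ] H) :=
  (finiteRankOperators W H).topologicalClosure

theorem comp_left_mem_approximableOperators (A : H →L[ℂ] G) {K : W →L[ℂ] H}
    (hK : K ∈ approximableOperators W H) : A ∘L K ∈ approximableOperators W G := by
  refine map_mem_closure (f := fun K => A ∘L K) (by fun_prop) hK fun F hF => ?_
  have : FiniteDimensional ℂ F.range := hF
  exact Submodule.finiteDimensional_of_le (S₂ := F.range.map A.toLinearMap) (by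
    rintro _ ⟨w, rfl⟩
    exact ⟨F w, ⟨w, rfl⟩, rfl⟩)

theorem comp_right_mem_approximableOperators (A : G →L[ℂ] W) {K : W →L[ℂ] H}
    (hK : K ∈ approximableOperators W H) : K ∘L A ∈ approximableOperators G H := by
  refine map_mem_closure (f := fun K => K ∘L A) (by fun_prop) hK fun F hF => ?_
  have : FiniteDimensional ℂ F.range := hF
  exact Submodule.finiteDimensional_of_le (S₂ := F.range) (by
    rintro _ ⟨w, rfl⟩
    exact ⟨A w, rfl⟩)

/-- Kernel and cokernel of B + F are those of the endomorphism 1 + F B⁻¹ of the finite-dimensional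
range of `F`, to which rank-nullity applies: a kernel vector w has B w = -F w in that range, and
every h is congruent to -F B⁻¹ h modulo the range of B + F. -/
theorem finrank_ker_eq_finrank_quotient_range (B : W ≃ₗ[ℂ] H) (F : W →ₗ[ℂ] H)
    [FiniteDimensional ℂ F.range] :
    Module.finrank ℂ (B.toLinearMap + F).ker
      = Module.finrank ℂ (H ⧸ (B.toLinearMap + F).range) := by
  set T := B.toLinearMap + F with hT
  have hTB : ∀ h, T (B.symm h) = h + F (B.symm h) := fun h => by
    simp [hT]
  let f : F.range →ₗ[ℂ] F.range :=
    { toFun := fun r => r + ⟨F (B.symm r.1), ⟨_, rfl⟩⟩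
      map_add' := fun r r' => Subtype.ext (by simp; abel)
      map_smul' := fun a r => Subtype.ext (by simp) }
  have hf : ∀ r, (f r).1 = T (B.symm r.1) := fun r => (hTB r.1).symm
  let φ : F.range →ₗ[ℂ] H ⧸ T.range := T.range.mkQ ∘ₗ F.range.subtype
  have hφ : Function.Surjective φ := fun q => by
    obtain ⟨h, rfl⟩ := T.range.mkQ_surjective q
    refine ⟨⟨-F (B.symm h), F.range.neg_mem ⟨_, rfl⟩⟩, ?_⟩
    change T.range.mkQ (-F (B.symm h)) = T.range.mkQ h
    rw [← sub_eq_zero, ← map_sub, ← LinearMap.mem_ker, Submodule.ker_mkQ]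
    refine ⟨-B.symm h, ?_⟩
    rw [map_neg, hTB]
    abel
  have hker : φ.ker = f.range := by
    ext r
    change T.range.mkQ r.1 = 0 ↔ _
    rw [← LinearMap.mem_ker, Submodule.ker_mkQ]
    constructor
    · rintro ⟨w, hw⟩
      have hBw : B w = r.1 - F w := by
        rw [← hw]
        simp [hT]
      refine ⟨⟨B w, by rw [hBw]; exact F.range.sub_mem r.2 ⟨w, rfl⟩⟩, Subtype.ext ?_⟩
      rw [hf, B.symm_apply_apply, hw]
    · rintro ⟨r', rfl⟩
      exact ⟨_, (hf r').symm⟩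
  let e : f.ker ≃ₗ[ℂ] T.ker := LinearEquiv.ofBijective
    ((B.symm.toLinearMap ∘ₗ F.range.subtype).restrict (p := f.ker) (q := T.ker) (fun r hr => by
      rw [LinearMap.mem_ker] at hr ⊢
      have := hf r
      rw [hr] at this
      exact this.symm)) ⟨fun r r' h => by
        have := congrArg Subtype.val h
        exact Subtype.ext (Subtype.ext (B.symm.injective this)), fun w => by
        have hw : B w.1 + F w.1 = 0 := w.2
        have hBw : B w.1 = F (-w.1) := by
          rw [map_neg]
          exact eq_neg_of_add_eq_zero_left hw
        refine ⟨⟨⟨B w.1, ⟨_, hBw.symm⟩⟩, Subtype.ext ?_⟩, Subtype.ext (B.symm_apply_apply _)⟩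
        rw [hf]
        simp⟩
  have h1 := LinearMap.finrank_range_add_finrank_ker f
  have h2 := LinearMap.finrank_range_add_finrank_ker φ
  rw [LinearMap.range_eq_top.mpr hφ, finrank_top, hker] at h2
  rw [← e.finrank_eq]
  omega

variable [CompleteSpace W]

/-- An operator of the form `B + K` with `B` invertible and `K` approximable by operators of finite
rank is a Fredholm operator of index `0`. -/
theorem isFredholm_of_invertible_add {T B K : W →L[ℂ] H} (hT : T = B + K) (hB : B.IsInvertible)
    (hK : K ∈ approximableOperators W H) : T.IsFredholm ∧
      Module.finrank ℂ T.ker = Module.finrank ℂ (H ⧸ T.range) := by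
  -- Invertibility is open, so for a finite-rank `F` close to `K` the difference K - F can be
  -- absorbed into the invertible part.
  have hopen : IsOpen {K' : W →L[ℂ] H | (B + (K - K')).IsInvertible} :=
    (ContinuousLinearEquiv.isOpen (𝕜 := ℂ) (E := W) (F := H)).preimage (by fun_prop)
  obtain ⟨F, ⟨e, he⟩, hF⟩ := mem_closure_iff.mp hK _ hopen (by simpa using hB)
  have : FiniteDimensional ℂ F.range := hF
  have hTe : T = (e : W →L[ℂ] H) + F := by
    rw [he, hT]
    abel
  constructor
  · open scoped LinearMap.FiniteRangeSetoid in
    refine ContinuousLinearMap.IsFredholm.of_isQuasiInverse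
      (v := (e.symm : H →L[ℂ] W)) ((e.toLinearEquiv.isQuasiInverse).congr (Setoid.refl _) ?_)
    rw [LinearMap.FiniteRangeSetoid.equiv_iff_hasFiniteRange,
      LinearMap.hasFiniteRange_iff_range, hTe]
    have h : (((e : W →L[ℂ] H) + F : W →L[ℂ] H) : W →ₗ[ℂ] H) - (e.toLinearEquiv : W →ₗ[ℂ] H)
        = F.toLinearMap := by
      ext w
      simp
    rw [h]
    exact (Submodule.fg_iff_finiteDimensional _).mpr this
  · rw [hTe]
    exact finrank_ker_eq_finrank_quotient_range e.toLinearEquiv F.toLinearMap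

theorem isInvertible_of_injective_of_finrank_eq [CompleteSpace H] {T : W →L[ℂ] H}
    (hF : T.IsFredholm) (hind : Module.finrank ℂ T.ker = Module.finrank ℂ (H ⧸ T.range))
    (hT : Function.Injective T) : T.IsInvertible := by
  have hk : T.ker = ⊥ := LinearMap.ker_eq_bot.mpr hT
  -- Needed because `Module.finrank` is also 0 on infinite-dimensional spaces; only a
  -- finite-dimensional cokernel of rank 0 vanishes.
  have hfin : FiniteDimensional ℂ (H ⧸ T.range) := hF.finite_coker
  have hr : T.range = ⊤ := by
    rw [hk, finrank_bot] at hind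
    have := Module.finrank_zero_iff.mp hind.symm
    exact Submodule.Quotient.subsingleton_iff.mp this
  exact ⟨ContinuousLinearEquiv.ofBijective T hk hr, rfl⟩

end FiniteRank

/-! ### Symmetric families, selfadjointness and their suspensions. -/

section SelfAdjoint

variable {W H : Type} [NormedAddCommGroup W] [InnerProductSpace ℂ W] [NormedAddCommGroup H]
  [InnerProductSpace ℂ H] (ι : W →L[ℂ] H) (D : W →L[ℂ] H)

theorem im_inner_suspension_eq (hD : ∀ u v, inner ℂ (D u) (ι v) = inner ℂ (ι u) (D v)) (s : ℝ)
    (C : W →L[ℂ] H) (u : W) :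
    (inner ℂ (ι u) ((D + (Complex.I * (s : ℂ)) • C) u)).im = s * (inner ℂ (ι u) (C u)).re := by
  have h : (inner ℂ (ι u) (D u)).im = 0 := by
    rw [← Complex.conj_eq_iff_im, inner_conj_symm, hD]
  simp [h, Complex.add_im, Complex.mul_im]

/-- By symmetry ⟨u, D u⟩ is real, so the imaginary part of the form of D + isC is s times the
positive form of C. With index 0 this gives invertibility off s = 0. -/
theorem injective_suspension
    (hD : ∀ u v, inner ℂ (D u) (ι v) = inner ℂ (ι u) (D v)) {s : ℝ} (hs : s ≠ 0) (C : W →L[ℂ] H)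
    (hC : ∀ u, (inner ℂ (ι u) (C u)).re = 0 → u = 0) :
    Function.Injective (D + (Complex.I * (s : ℂ)) • C) := by
  refine (injective_iff_map_eq_zero _).mpr fun u hu => hC u ?_
  have := im_inner_suspension_eq ι D hD s C u
  rw [hu, inner_zero_right, Complex.zero_im, eq_comm, mul_eq_zero] at this
  exact this.resolve_left hs

variable [CompleteSpace H]

/-- The classical criterion: a symmetric operator is selfadjoint if D + i and D - i are onto. The
domain is dense since f = (D + i) u orthogonal to it gives |u|² = Im ⟨u, f⟩ = 0. -/
theorem isSelfAdjoint_toLinearPMap (hι : Function.Injective ι)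
    (hD : ∀ u v, inner ℂ (D u) (ι v) = inner ℂ (ι u) (D v))
    (hs : ∀ s : ℝ, s ≠ 0 → Function.Surjective (D + (Complex.I * (s : ℂ)) • ι)) :
    IsSelfAdjoint (toLinearPMap ι hι D) := by
  have hsurj := hs 1 one_ne_zero
  simp only [Complex.ofReal_one, mul_one] at hsurj
  have hdom : ∀ x : (toLinearPMap ι hι D).domain, ∃ u, ι u = x ∧ toLinearPMap ι hι D x = D u := by
    rintro ⟨_, u, rfl⟩
    refine ⟨u, rfl, ?_⟩
    change D ((LinearEquiv.ofInjective ι.toLinearMap hι).symm _) = D u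
    congr 1
    exact (LinearEquiv.ofInjective ι.toLinearMap hι).symm_apply_apply u
  have hdense : Dense ((toLinearPMap ι hι D).domain : Set H) := by
    change Dense (ι.range : Set H)
    rw [Submodule.dense_iff_topologicalClosure_eq_top, Submodule.topologicalClosure_eq_top_iff,
      Submodule.eq_bot_iff]
    intro f hf
    obtain ⟨u, rfl⟩ := hsurj f
    have h := im_inner_suspension_eq ι D hD 1 ι u
    simp only [Complex.ofReal_one, mul_one, one_mul] at h
    rw [hf (ι u) ⟨u, rfl⟩, Complex.zero_im, inner_self_eq_norm_sq_to_K] at h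
    have hu : ι u = 0 := by
      rw [← norm_eq_zero]
      have h' : ‖ι u‖ ^ 2 = 0 := by
        rw [h]
        norm_cast
      exact pow_eq_zero_iff two_ne_zero |>.mp h'
    rw [hι (hu.trans (map_zero ι).symm), map_zero]
  have hle : toLinearPMap ι hι D ≤ LinearPMap.adjoint (toLinearPMap ι hι D) := by
    refine LinearPMap.IsFormalAdjoint.le_adjoint hdense fun x y => ?_
    obtain ⟨u, hu, hDu⟩ := hdom x
    obtain ⟨v, hv, hDv⟩ := hdom y
    rw [hDu, hDv, ← hu, ← hv, hD]
  refine (LinearPMap.eq_of_le_of_domain_eq hle (le_antisymm hle.1 fun y hy => ?_)).symm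
  have hadj := LinearPMap.adjoint_isFormalAdjoint hdense ⟨y, hy⟩
  set w := LinearPMap.adjoint (toLinearPMap ι hι D) ⟨y, hy⟩
  -- For y in the domain of the adjoint and w = D*y, solve (D - i) u₀ = w - i y. Then y - u₀ is
  -- orthogonal to the range of D + i, that is, to everything, so y lies in the domain of D.
  obtain ⟨u₀, hu₀⟩ := hs (-1) (by norm_num) (w - Complex.I • y)
  simp only [Complex.ofReal_neg, Complex.ofReal_one, mul_neg, mul_one] at hu₀
  have key : ∀ f, inner ℂ (y - ι u₀) f = 0 := fun f => by
    obtain ⟨u, rfl⟩ := hsurj f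
    have hmem : ι u ∈ (toLinearPMap ι hι D).domain := ⟨u, rfl⟩
    obtain ⟨u', hu', hDu'⟩ := hdom ⟨ι u, hmem⟩
    have h1 := hadj ⟨ι u, hmem⟩
    rw [hDu', hι hu'] at h1
    have h2 : inner ℂ (w - Complex.I • y) (ι u) = inner ℂ (ι u₀) ((D + Complex.I • ι) u) := by
      rw [← hu₀]
      simp [hD, inner_smul_left]
    have h3 : inner ℂ (w - Complex.I • y) (ι u) = inner ℂ y ((D + Complex.I • ι) u) := by
      have h1' : inner ℂ w (ι u) = inner ℂ y (D u) := h1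
      simp [h1', mul_comm]
    rw [inner_sub_left, ← h2, ← h3, sub_self]
  have := inner_self_eq_zero.mp (key (y - ι u₀))
  exact ⟨u₀, (sub_eq_zero.mp this).symm⟩

variable [CompleteSpace W] {Z : Type u} [TopologicalSpace Z]

/-- A family `D + i σ C` with symmetric `D` and positive `C` that consists of perturbations of
invertible operators has an index bundle if `D` is invertible at the points of `Y` where `σ`
vanishes. -/
theorem exists_hasIndexBundle_of_symmetric (T : C(Z, W →L[ℂ] H)) (D C : Z → W →L[ℂ] H) (σ : Z → ℝ)
    (hT : ∀ z, T z = D z + (Complex.I * (σ z : ℂ)) • C z)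
    (hD : ∀ z u v, inner ℂ (D z u) (ι v) = inner ℂ (ι u) (D z v))
    (hC : ∀ z u, (inner ℂ (ι u) (C z u)).re = 0 → u = 0)
    (hdec : ∀ z, ∃ B K, T z = B + K ∧ B.IsInvertible ∧ K ∈ approximableOperators W H)
    (hσ : IsCompact {z | σ z = 0}) (Y : Set Z) (hY : ∀ z ∈ Y, σ z = 0 → (D z).IsInvertible) :
    ∃ κ, HasIndexBundle T Y κ := by
  have hfred : ∀ z, (T z).IsFredholm ∧
      Module.finrank ℂ (T z).ker = Module.finrank ℂ (H ⧸ (T z).range) := fun z => by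
    obtain ⟨B, K, h, hB, hK⟩ := hdec z
    exact isFredholm_of_invertible_add h hB hK
  have hinv : ∀ z, σ z ≠ 0 → (T z).IsInvertible := fun z hz => by
    refine isInvertible_of_injective_of_finrank_eq (hfred z).1 (hfred z).2 ?_
    rw [hT]
    exact injective_suspension ι (D z) (hD z) hz (C z) (hC z)
  refine exists_hasIndexBundle T Y (fun z => (hfred z).1) (fun z => (hfred z).2) ⟨_, hσ, hinv⟩
    fun z hz => ?_
  by_cases h : σ z = 0
  · rw [hT, h, Complex.ofReal_zero, mul_zero, zero_smul, add_zero]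
    exact hY z hz h
  · exact hinv z h

/-- The suspension can fail to be invertible only on the slice s = 0, which is compact because X is.
The decompositions are asked for at all s, so that they yield Fredholm operators of index 0 also off
the slice. -/
theorem exists_hasSelfAdjointIndexBundle {X : Type u} [TopologicalSpace X] [CompactSpace X]
    (hι : Function.Injective ι) (D : C(X, W →L[ℂ] H))
    (hD : ∀ x u v, inner ℂ (D x u) (ι v) = inner ℂ (ι u) (D x v))
    (hdec : ∀ x (s : ℝ), ∃ B K, D x + (Complex.I * (s : ℂ)) • ι = B + K ∧ B.IsInvertible ∧
      K ∈ approximableOperators W H)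
    (Y : Set X) (hY : ∀ x ∈ Y, (D x).IsInvertible) :
    ∃ κ, HasSelfAdjointIndexBundle ι hι D Y κ := by
  have hpos : ∀ u, (inner ℂ (ι u) (ι u)).re = 0 → u = 0 := fun u hu => by
    have h := inner_self_eq_norm_sq (𝕜 := ℂ) (ι u)
    rw [RCLike.re_eq_complex_re, hu] at h
    exact hι ((norm_eq_zero.mp (pow_eq_zero_iff two_ne_zero |>.mp h.symm)).trans (map_zero ι).symm)
  have hσ : IsCompact {z : X × ℝ | z.2 = 0} := by
    have : {z : X × ℝ | z.2 = 0} = Set.univ ×ˢ {0} := by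
      ext z
      simp
    rw [this]
    exact isCompact_univ.prod isCompact_singleton
  obtain ⟨κ, hκ⟩ := exists_hasIndexBundle_of_symmetric ι (suspension ι D) (fun z => D z.1)
    (fun _ => ι) (fun z => z.2) (fun _ => rfl) (fun z => hD z.1) (fun _ => hpos)
    (fun z => hdec z.1 z.2) hσ (Y ×ˢ Set.univ) (fun z hz _ => hY z.1 hz.1)
  have hfred : ∀ x (s : ℝ), (D x + (Complex.I * (s : ℂ)) • ι).IsFredholm := fun x s =>
    hκ.isFredholm (x, s)
  refine ⟨κ, fun x => isSelfAdjoint_toLinearPMap ι (D x) hι (hD x) fun s hs => ?_, fun x => ?_, hY,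
    hκ⟩
  · exact (isInvertible_of_injective_of_finrank_eq (hκ.isFredholm (x, s)) (hκ.index_eq_zero (x, s))
      (injective_suspension ι (D x) (hD x) hs ι hpos)).surjective
  · have := hfred x 0
    rwa [Complex.ofReal_zero, mul_zero, zero_smul, add_zero] at this

end SelfAdjoint

/-! ### Matrices acting on 𝕜^{2n} and the complex structure. -/

section MatVec

variable {𝕜 : Type} [RCLike 𝕜] {n : ℕ}

/-- The matrix-vector product, as a linear map into the continuous linear maps. -/
def matVecL : Matrix (Fin n ⊕ Fin n) (Fin n ⊕ Fin n) 𝕜 →ₗ[𝕜] (Vec 𝕜 n →L[𝕜] Vec 𝕜 n) where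
  toFun M := LinearMap.toContinuousLinearMap ⟨⟨matVec M, matVec_add M⟩, matVec_smul M⟩
  map_add' M N := by
    ext v i
    simp [matVec, Matrix.add_mulVec]
  map_smul' a M := by
    ext v i
    simp [matVec, Matrix.smul_mulVec]

theorem matVecL_apply (M : Matrix (Fin n ⊕ Fin n) (Fin n ⊕ Fin n) 𝕜) (v : Vec 𝕜 n) :
    matVecL M v = matVec M v := rfl

theorem continuous_matVecL : Continuous (matVecL (𝕜 := 𝕜) (n := n)) :=
  LinearMap.continuous_of_finiteDimensional _

theorem matVec_matVec (M N : Matrix (Fin n ⊕ Fin n) (Fin n ⊕ Fin n) 𝕜) (v : Vec 𝕜 n) :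
    matVec M (matVec N v) = matVec (M * N) v := by
  simp [matVec, Matrix.mulVec_mulVec]

theorem inner_matVec (M : Matrix (Fin n ⊕ Fin n) (Fin n ⊕ Fin n) 𝕜) (v w : Vec 𝕜 n) :
    inner 𝕜 (matVec M v) w = inner 𝕜 v (matVec Mᴴ w) := by
  simp only [EuclideanSpace.inner_eq_star_dotProduct, matVec]
  rw [Matrix.star_mulVec, dotProduct_comm, ← Matrix.dotProduct_mulVec, dotProduct_comm]

/-- The standard complex structure `J` on `𝕜^{2n}`. -/
def Jop : Vec 𝕜 n →L[𝕜] Vec 𝕜 n := matVecL (Matrix.J (Fin n) 𝕜)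

theorem Jop_apply (v : Vec 𝕜 n) : Jop v = matVec (Matrix.J (Fin n) 𝕜) v := rfl

@[simp] theorem Jop_Jop (v : Vec 𝕜 n) : Jop (Jop v) = -v := by
  rw [Jop_apply, Jop_apply, matVec_matVec, Matrix.J_squared]
  simp [matVec, Matrix.neg_mulVec]

theorem inner_Jop (v w : Vec 𝕜 n) : inner 𝕜 (Jop v) w = -inner 𝕜 v (Jop w) := by
  have h : (Matrix.J (Fin n) 𝕜)ᴴ = -Matrix.J (Fin n) 𝕜 := by
    ext i j
    rcases i with i | i <;> rcases j with j | j <;> simp [Matrix.J, Matrix.one_apply, eq_comm, apply_ite]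
  rw [Jop_apply, inner_matVec, h, Jop_apply, ← inner_neg_right]
  simp [matVec, Matrix.neg_mulVec]

@[simp] theorem norm_Jop (v : Vec 𝕜 n) : ‖Jop v‖ = ‖v‖ := by
  rw [@norm_eq_sqrt_re_inner 𝕜, inner_Jop, Jop_Jop, inner_neg_right, neg_neg,
    ← @norm_eq_sqrt_re_inner 𝕜]

end MatVec

theorem weight_neg (m : ℕ) (k : ℤ) : weight m (-k) = weight m k := by
  simp [weight]

/-! ### Fourier multipliers between Sobolev spaces. -/

namespace Sobolev

variable {𝕜 : Type} [RCLike 𝕜] {n m m' : ℕ}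

theorem norm_sq_eq_tsum (u : Sobolev 𝕜 n m) :
    ‖u‖ ^ 2 = ∑' k, weight m k * ‖u.coeff k‖ ^ 2 := by
  rw [← norm_toLp, ← Real.rpow_natCast]
  have h := lp.norm_rpow_eq_tsum (p := 2) (by norm_num) (toLp m le_rfl u)
  simp only [ENNReal.toReal_ofNat] at h
  rw [Nat.cast_ofNat, h]
  refine tsum_congr fun k => ?_
  rw [toLp_apply, Real.rpow_ofNat, norm_sqrt_smul_sq (weight_pos m k).le]

/-- The operator between Sobolev spaces that acts on Fourier coefficients by
`(u_k) ↦ (A_k u_{σ k})`. -/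
def mapCoeff (σ : ℤ ≃ ℤ) (A : ℤ → Vec 𝕜 n →L[𝕜] Vec 𝕜 n) (C : ℝ) (hC : 0 ≤ C)
    (h : ∀ k v, weight m' k * ‖A k v‖ ^ 2 ≤ C ^ 2 * (weight m (σ k) * ‖v‖ ^ 2)) :
    Sobolev 𝕜 n m →L[𝕜] Sobolev 𝕜 n m' :=
  LinearMap.mkContinuous
    { toFun := fun u => ⟨fun k => A k (u.coeff (σ k)), by
        refine Summable.of_nonneg_of_le (fun k => ?_) (fun k => h k _)
          ((σ.summable_iff.mpr u.summable_coeff).mul_left _)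
        have := (weight_pos m' k).le
        positivity⟩
      map_add' := fun u v => ext fun k => map_add (A k) _ _
      map_smul' := fun a u => ext fun k => map_smul (A k) _ _ } C fun u => by
    refine abs_le_of_sq_le_sq' ?_ (by positivity) |>.2
    rw [mul_pow, norm_sq_eq_tsum, norm_sq_eq_tsum, ← tsum_mul_left,
      ← σ.tsum_eq (fun k => C ^ 2 * (weight m k * ‖u.coeff k‖ ^ 2))]
    have hs : Summable fun k => C ^ 2 * (weight m (σ k) * ‖u.coeff (σ k)‖ ^ 2) :=
      (σ.summable_iff.mpr u.summable_coeff).mul_left _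
    refine Summable.tsum_le_tsum (fun k => h k _) (Summable.of_nonneg_of_le (fun k => ?_)
      (fun k => h k _) hs) hs
    have := (weight_pos m' k).le
    positivity

@[simp] theorem coeff_mapCoeff (σ : ℤ ≃ ℤ) (A : ℤ → Vec 𝕜 n →L[𝕜] Vec 𝕜 n) (C : ℝ) (hC : 0 ≤ C)
    (h : ∀ k v, weight m' k * ‖A k v‖ ^ 2 ≤ C ^ 2 * (weight m (σ k) * ‖v‖ ^ 2))
    (u : Sobolev 𝕜 n m) (k : ℤ) : (mapCoeff σ A C hC h u).coeff k = A k (u.coeff (σ k)) := rfl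

theorem norm_mapCoeff_le (σ : ℤ ≃ ℤ) (A : ℤ → Vec 𝕜 n →L[𝕜] Vec 𝕜 n) (C : ℝ) (hC : 0 ≤ C)
    (h : ∀ k v, weight m' k * ‖A k v‖ ^ 2 ≤ C ^ 2 * (weight m (σ k) * ‖v‖ ^ 2)) :
    ‖mapCoeff (𝕜 := 𝕜) (n := n) σ A C hC h‖ ≤ C :=
  LinearMap.mkContinuous_norm_le _ hC _

@[simp] theorem coeff_zero (k : ℤ) : (0 : Sobolev 𝕜 n m).coeff k = 0 := rfl

@[simp] theorem coeff_sub (u v : Sobolev 𝕜 n m) (k : ℤ) :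
    (u - v).coeff k = u.coeff k - v.coeff k := rfl

/-- The Fourier coefficient, as a continuous linear map. -/
def coeffL (k : ℤ) : Sobolev 𝕜 n m →L[𝕜] Vec 𝕜 n where
  toFun u := u.coeff k
  map_add' _ _ := rfl
  map_smul' _ _ := rfl
  cont := continuous_coeff k

@[simp] theorem coeffL_apply (k : ℤ) (u : Sobolev 𝕜 n m) : coeffL k u = u.coeff k := rfl

/-- The element with a single Fourier coefficient. -/
def singleL (k : ℤ) : Vec 𝕜 n →L[𝕜] Sobolev 𝕜 n m :=
  LinearMap.toContinuousLinearMap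
    { toFun := fun v => ⟨fun j => if j = k then v else 0, by
        refine summable_of_ne_finset_zero (s := {k}) fun j hj => ?_
        have : j ≠ k := by simpa using hj
        simp [this]⟩
      map_add' := fun v w => ext fun j => by
        change (if j = k then v + w else 0) = (if j = k then v else 0) + (if j = k then w else 0)
        split_ifs <;> simp
      map_smul' := fun a v => ext fun j => by
        change (if j = k then a • v else 0) = a • (if j = k then v else 0)
        split_ifs <;> simp }

theorem coeff_singleL (k j : ℤ) (v : Vec 𝕜 n) :
    (singleL k v : Sobolev 𝕜 n m).coeff j = if j = k then v else 0 := rfl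

/-- Identities between continuous operators may thus be checked on single modes. -/
theorem hasSum_singleL (u : Sobolev 𝕜 n m) : HasSum (fun k => singleL k (u.coeff k)) u := by
  have h := (lp.hasSum_single (p := 2) (by norm_num) (toLpEquiv u)).mapL
    (toLpEquiv (𝕜 := 𝕜) (n := n) (m := m)).symm.toContinuousLinearEquiv.toContinuousLinearMap
  convert h using 1
  · funext k
    change _ = toLpEquiv.symm _
    rw [LinearIsometryEquiv.eq_symm_apply]
    ext j : 2
    change ((√(weight m j) : ℝ) : 𝕜) • (singleL k (u.coeff k) : Sobolev 𝕜 n m).coeff j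
      = (Pi.single k ((toLpEquiv u) k) : ∀ _ : ℤ, Vec 𝕜 n) j
    rw [coeff_singleL, Pi.single_apply]
    split_ifs with h
    · subst h
      rfl
    · exact smul_zero _
  · exact (toLpEquiv.symm_apply_apply u).symm

theorem inner_singleL (k : ℤ) (v : Vec 𝕜 n) (u : Sobolev 𝕜 n m) :
    inner 𝕜 (singleL k v) u = (weight m k : 𝕜) * inner 𝕜 v (u.coeff k) := by
  rw [inner_def, tsum_eq_single k]
  · rw [coeff_singleL, if_pos rfl]
  · intro j hj
    rw [coeff_singleL, if_neg hj, inner_zero_left, mul_zero]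

/-- The inclusion `H^{m/2} → H^{m'/2}`. -/
def inclL (h : m' ≤ m) : Sobolev 𝕜 n m →L[𝕜] Sobolev 𝕜 n m' :=
  mapCoeff (Equiv.refl ℤ) (fun _ => ContinuousLinearMap.id 𝕜 _) 1 zero_le_one fun k v => by
    rw [one_pow, one_mul]
    exact mul_le_mul_of_nonneg_right (weight_mono h k) (by positivity)

@[simp] theorem coeff_inclL (h : m' ≤ m) (u : Sobolev 𝕜 n m) (k : ℤ) :
    (inclL h u).coeff k = u.coeff k := by
  rw [inclL, coeff_mapCoeff, Equiv.refl_apply, ContinuousLinearMap.id_apply]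

theorem inclL_injective (h : m' ≤ m) : Function.Injective (inclL (𝕜 := 𝕜) (n := n) h) :=
  fun _ _ huv => ext fun k => by
    simpa only [coeff_inclL] using congrArg (fun w : Sobolev 𝕜 n m' => w.coeff k) huv

/-- The projection to the constant functions. -/
def meanL : Sobolev 𝕜 n m →L[𝕜] Sobolev 𝕜 n m' := singleL 0 ∘L coeffL 0

theorem coeff_meanL (u : Sobolev 𝕜 n m) (k : ℤ) :
    (meanL u : Sobolev 𝕜 n m').coeff k = if k = 0 then u.coeff 0 else 0 :=
  coeff_singleL 0 k _

end Sobolev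

/-! ### Fourier series in L² and their completeness. -/

section ToL2

open Sobolev

variable {𝕜 : Type} [RCLike 𝕜] {n m m' : ℕ}

theorem toL2_singleL (k : ℤ) (v : Vec 𝕜 n) :
    toL2 (singleL k v : Sobolev 𝕜 n m) = trigL2 k v := by
  refine (hasSum_toL2 _).unique ?_
  convert hasSum_single k (fun j hj => ?_) using 1
  · rw [coeff_singleL, if_pos rfl]
  · rw [coeff_singleL, if_neg hj, map_zero]

theorem inner_toL2 (u : Sobolev 𝕜 n m) (v : Sobolev 𝕜 n m') :
    inner 𝕜 (toL2 u) (toL2 v) = ∑' k, (weight 0 k : 𝕜) * inner 𝕜 (u.coeff k) (v.coeff k) := by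
  change inner 𝕜 (orthogonalFamily_trigIsometry.linearIsometry (toLp 0 (Nat.zero_le m) u))
    (orthogonalFamily_trigIsometry.linearIsometry (toLp 0 (Nat.zero_le m') v)) = _
  rw [LinearIsometry.inner_map_map, lp.inner_eq_tsum]
  refine tsum_congr fun k => ?_
  rw [toLp_apply, toLp_apply, inner_smul_left, inner_smul_right, RCLike.conj_ofReal, ← mul_assoc,
    ← RCLike.ofReal_mul, Real.mul_self_sqrt (weight_pos 0 k).le]

theorem norm_toL2_eq (u : Sobolev 𝕜 n m) : ‖toL2 u‖ = ‖inclL (Nat.zero_le m) u‖ := by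
  rw [@norm_eq_sqrt_re_inner 𝕜, @norm_eq_sqrt_re_inner 𝕜 (Sobolev 𝕜 n 0), inner_toL2, inner_def]
  simp only [coeff_inclL]

theorem toL2_inclL (h : m' ≤ m) (u : Sobolev 𝕜 n m) : toL2 (inclL h u) = toL2 u := by
  have h1 := hasSum_toL2 (inclL h u)
  simp only [coeff_inclL] at h1
  exact h1.unique (hasSum_toL2 u)

theorem inner_trigL2_toL2 (k : ℤ) (v : Vec 𝕜 n) (u : Sobolev 𝕜 n m) :
    inner 𝕜 (trigL2 k v) (toL2 u) = (weight 0 k : 𝕜) * inner 𝕜 v (u.coeff k) := by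
  rw [← toL2_singleL (m := 0), inner_toL2, tsum_eq_single k]
  · rw [coeff_singleL, if_pos rfl]
  · intro j hj
    rw [coeff_singleL, if_neg hj, inner_zero_left, mul_zero]

theorem coeFn_trigL2 (k : ℤ) (v : Vec 𝕜 n) :
    (trigL2 k v : L2 𝕜 n) =ᵐ[circleMeasure] fun t => ((trig k t : ℝ) : 𝕜) • v :=
  (memLp_trig_smul k v).coeFn_toLp

theorem inner_trigL2_single (k : ℤ) (i : Fin n ⊕ Fin n) (f : L2 𝕜 n) :
    inner 𝕜 (trigL2 k (EuclideanSpace.single i 1)) f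
      = ∫ t in (0 : ℝ)..(2 * Real.pi), ((trig k t : ℝ) : 𝕜) * f t i := by
  rw [L2.inner_def, intervalIntegral.integral_of_le (by positivity)]
  refine integral_congr_ae ?_
  filter_upwards [coeFn_trigL2 (𝕜 := 𝕜) (n := n) k (EuclideanSpace.single i 1)] with t ht
  rw [ht, inner_smul_left, RCLike.conj_ofReal, EuclideanSpace.inner_single_left, map_one, one_mul]

theorem memLp_coord (f : L2 𝕜 n) (i : Fin n ⊕ Fin n) :
    MemLp (fun t => f t i) 2 circleMeasure :=
  (ContinuousLinearMap.comp_memLp' (EuclideanSpace.proj i : Vec 𝕜 n →L[𝕜] 𝕜) (Lp.memLp f) :)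

/-- The trigonometric system is complete in `L²`. -/
theorem eq_zero_of_inner_trigL2_eq_zero (f : L2 ℂ n)
    (h : ∀ k v, inner ℂ (trigL2 k v) f = 0) : f = 0 := by
  have hpi : (0 : ℝ) < 2 * Real.pi := by positivity
  have hint : ∀ i, IntervalIntegrable (fun t => f t i) volume 0 (2 * Real.pi) := fun i =>
    (intervalIntegrable_iff_integrableOn_Ioc_of_le hpi.le).mpr
      ((memLp_coord f i).integrable (by norm_num))
  have h0 : ∀ i (k : ℤ), ∫ t in (0 : ℝ)..(2 * Real.pi), ((trig k t : ℝ) : ℂ) * f t i = 0 :=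
    fun i k => (inner_trigL2_single k i f).symm.trans (h _ _)
  have hcs : ∀ i (k : ℤ),
      ∫ t in (0 : ℝ)..(2 * Real.pi), Complex.exp (Complex.I * (k * t)) * f t i = 0 := by
    intro i k
    have hi : ∀ j : ℤ, IntervalIntegrable (fun t => ((trig j t : ℝ) : ℂ) * f t i) volume 0
        (2 * Real.pi) := fun j =>
      (hint i).continuousOn_mul (by
        have := continuous_trig j
        fun_prop)
    -- The exponential is a cosine plus ± i times a sine. For k = 0 both indices denote the constant
    -- mode, and the second coefficient has to be 0.
    have e : ∃ σ : ℂ, ∀ t : ℝ, Complex.exp (Complex.I * (k * t))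
        = ((trig |k| t : ℝ) : ℂ) + σ * ((trig (-|k|) t : ℝ) : ℂ) := by
      rcases eq_or_ne k 0 with rfl | hk
      · exact ⟨0, fun t => by simp [trig]⟩
      have hneg : ¬ (0 : ℤ) ≤ -|k| := by simpa using hk
      have hc : ∀ t, trig |k| t = Real.cos (k * t) := fun t => by
        simp only [trig, abs_nonneg, if_true]
        rcases abs_cases k with ⟨h, -⟩ | ⟨h, -⟩ <;> rw [h]
        push_cast
        rw [neg_mul, Real.cos_neg]
      have hs : ∀ t, trig (-|k|) t = Real.sin ((|k| : ℤ) * t) := fun t => by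
        simp only [trig, hneg, if_false]
        push_cast
        rw [neg_neg]
      rcases abs_cases k with ⟨h, -⟩ | ⟨h, -⟩
      · refine ⟨Complex.I, fun t => ?_⟩
        rw [hc, hs, h, mul_comm, Complex.exp_mul_I]
        push_cast
        ring
      · refine ⟨-Complex.I, fun t => ?_⟩
        rw [hc, hs, h, mul_comm, Complex.exp_mul_I]
        push_cast
        rw [neg_mul (k : ℂ), Complex.sin_neg]
        ring
    obtain ⟨σ, hσ⟩ := e
    simp_rw [hσ, add_mul, mul_assoc σ]
    rw [intervalIntegral.integral_add (hi _) ((hi _).const_mul _),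
      intervalIntegral.integral_const_mul, h0, h0, mul_zero, add_zero]
  have hi0 : ∀ i, ∀ᵐ t ∂circleMeasure, f t i = 0 := by
    intro i
    -- All exponential coefficients of the coordinate vanish, so by Parseval its L² norm is 0.
    have hp := hasSum_sq_fourierCoeffOn hpi (memLp_coord f i)
    have hz : ∀ k, fourierCoeffOn hpi (fun t => f t i) k = 0 := fun k => by
      rw [fourierCoeffOn_eq_integral]
      have : ∀ t : ℝ, (fourier (-k) (t : AddCircle (2 * Real.pi - 0)) : ℂ)
          = Complex.exp (Complex.I * ((-k : ℤ) * t)) := fun t => by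
        rw [fourier_coe_apply]
        congr 1
        push_cast
        have : (Real.pi : ℂ) ≠ 0 := by exact_mod_cast Real.pi_ne_zero
        field_simp
        ring
      simp_rw [this, smul_eq_mul]
      rw [hcs, smul_zero]
    simp only [hz, norm_zero, ne_eq, OfNat.ofNat_ne_zero, not_false_eq_true, zero_pow] at hp
    have h1 := hp.unique hasSum_zero
    rw [smul_eq_zero, intervalIntegral.integral_of_le hpi.le] at h1
    have h2 := h1.resolve_left (by positivity)
    rw [integral_eq_zero_iff_of_nonneg (fun t => by positivity)
      ((memLp_coord f i).integrable_norm_pow (by norm_num))] at h2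
    filter_upwards [h2] with t ht
    simpa using ht
  refine (Lp.eq_zero_iff_ae_eq_zero).mpr ?_
  filter_upwards [ae_all_iff.mpr hi0] with t ht
  ext i
  exact ht i

/-- The functions in `L²` are given by their Fourier coefficients. -/
def sobolevZeroEquiv : Sobolev ℂ n 0 ≃L[ℂ] L2 ℂ n :=
  ContinuousLinearEquiv.ofBijective toL2 (LinearMap.ker_eq_bot.mpr toL2_injective) (by
    -- At m = 0 the inclusion is isometric, so its range is closed; completeness of the
    -- trigonometric system makes it dense.
    have hiso : Isometry (toL2 (𝕜 := ℂ) (n := n) (m := 0)) :=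
      AddMonoidHomClass.isometry_of_norm _ fun u => by rw [norm_toL2_eq]; rfl
    have hclosed : IsClosed ((toL2 (𝕜 := ℂ) (n := n) (m := 0)).range : Set (L2 ℂ n)) :=
      hiso.isClosedEmbedding.isClosed_range
    have := hclosed.submodule_topologicalClosure_eq
    rw [← this, Submodule.topologicalClosure_eq_top_iff, Submodule.eq_bot_iff]
    refine fun f hf => eq_zero_of_inner_trigL2_eq_zero f fun k v => ?_
    rw [← toL2_singleL (m := 0)]
    exact hf _ ⟨_, rfl⟩)

end ToL2

/-! ### Multiplication by loops of matrices on L². -/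

section Multiplication

open Sobolev

variable {𝕜 : Type} [RCLike 𝕜] {n m m' : ℕ}

/-- The continuous families of operators on `𝕜^{2n}` over a period. -/
abbrev LoopOp (𝕜 : Type) [RCLike 𝕜] (n : ℕ) : Type :=
  C(Set.Icc (0 : ℝ) (2 * Real.pi), Vec 𝕜 n →L[𝕜] Vec 𝕜 n)

/-- The value of a family of operators over a period at a time, constant outside the period. -/
def LoopOp.extend (Φ : LoopOp 𝕜 n) (t : ℝ) : Vec 𝕜 n →L[𝕜] Vec 𝕜 n :=
  Φ (Set.projIcc 0 (2 * Real.pi) Real.two_pi_pos.le t)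

theorem LoopOp.continuous_extend (Φ : LoopOp 𝕜 n) : Continuous Φ.extend :=
  Φ.continuous.comp continuous_projIcc

theorem LoopOp.norm_extend_le (Φ : LoopOp 𝕜 n) (t : ℝ) : ‖Φ.extend t‖ ≤ ‖Φ‖ :=
  Φ.norm_coe_le_norm _

theorem LoopOp.extend_of_mem (Φ : LoopOp 𝕜 n) {t : ℝ} (ht : t ∈ Set.Icc 0 (2 * Real.pi)) :
    Φ.extend t = Φ ⟨t, ht⟩ := by
  rw [LoopOp.extend, Set.projIcc_of_mem]

theorem memLp_extend_apply (Φ : LoopOp 𝕜 n) (f : L2 𝕜 n) :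
    MemLp (fun t => Φ.extend t (f t)) 2 circleMeasure := by
  refine MemLp.of_le_mul (c := ‖Φ‖) (Lp.memLp f) ?_ (Filter.Eventually.of_forall fun t => ?_)
  · exact isBoundedBilinearMap_apply.continuous.comp_aestronglyMeasurable
      (Φ.continuous_extend.aestronglyMeasurable.prodMk (Lp.aestronglyMeasurable f))
  · exact (Φ.extend t).le_of_opNorm_le (Φ.norm_extend_le t) _

/-- The multiplication operators on `L²`, as a bilinear map. -/
def mulBilin : LoopOp 𝕜 n →ₗ[𝕜] L2 𝕜 n →ₗ[𝕜] L2 𝕜 n :=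
  LinearMap.mk₂ 𝕜 (fun (Φ : LoopOp 𝕜 n) (f : L2 𝕜 n) =>
      ((memLp_extend_apply Φ f).toLp (fun t => Φ.extend t (f t)) : L2 𝕜 n))
    (fun Φ Ψ f => by
      rw [← MemLp.toLp_add]
      rfl)
    (fun c Φ f => by
      rw [← MemLp.toLp_const_smul]
      rfl)
    (fun Φ f g => by
      rw [← MemLp.toLp_add, MemLp.toLp_eq_toLp_iff]
      filter_upwards [Lp.coeFn_add f g] with t ht
      rw [ht, Pi.add_apply, map_add, Pi.add_apply])
    (fun c Φ f => by
      rw [← MemLp.toLp_const_smul, MemLp.toLp_eq_toLp_iff]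
      filter_upwards [Lp.coeFn_smul c f] with t ht
      rw [ht, Pi.smul_apply, map_smul, Pi.smul_apply])

theorem coeFn_mulBilin (Φ : LoopOp 𝕜 n) (f : L2 𝕜 n) :
    (mulBilin Φ f : L2 𝕜 n) =ᵐ[circleMeasure] fun t => Φ.extend t (f t) :=
  (memLp_extend_apply Φ f).coeFn_toLp

theorem norm_mulBilin_le (Φ : LoopOp 𝕜 n) (f : L2 𝕜 n) : ‖mulBilin Φ f‖ ≤ ‖Φ‖ * ‖f‖ := by
  refine Lp.norm_le_mul_norm_of_ae_le_mul ?_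
  filter_upwards [coeFn_mulBilin Φ f] with t ht
  rw [ht]
  exact (Φ.extend t).le_of_opNorm_le (Φ.norm_extend_le t) _

/-- The multiplication operators on `L²`, as a linear function of the multiplier. -/
def mulLin : LoopOp 𝕜 n →ₗ[𝕜] (L2 𝕜 n →L[𝕜] L2 𝕜 n) where
  toFun Φ := (mulBilin Φ).mkContinuous ‖Φ‖ (norm_mulBilin_le Φ)
  map_add' Φ Ψ := ContinuousLinearMap.ext fun f => by
    simp only [LinearMap.mkContinuous_apply, _root_.add_apply, map_add, LinearMap.add_apply]
  map_smul' c Φ := ContinuousLinearMap.ext fun f => by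
    simp only [LinearMap.mkContinuous_apply, _root_.smul_apply, map_smul, RingHom.id_apply,
      LinearMap.smul_apply]

/-- The multiplication operators on `L²`, as a continuous function of the multiplier. -/
def mulL2 : LoopOp 𝕜 n →L[𝕜] L2 𝕜 n →L[𝕜] L2 𝕜 n :=
  LinearMap.mkContinuous (mulLin (𝕜 := 𝕜) (n := n)) (1 : ℝ) fun (Φ : LoopOp 𝕜 n) => by
    rw [one_mul]
    exact LinearMap.mkContinuous_norm_le (mulBilin Φ) (norm_nonneg Φ) (norm_mulBilin_le Φ)

theorem coeFn_mulL2 (Φ : LoopOp 𝕜 n) (f : L2 𝕜 n) :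
    (mulL2 Φ f : L2 𝕜 n) =ᵐ[circleMeasure] fun t => Φ.extend t (f t) :=
  coeFn_mulBilin Φ f

theorem inner_mulL2 (Φ : LoopOp 𝕜 n) (hΦ : ∀ t v w, inner 𝕜 (Φ t v) w = inner 𝕜 v (Φ t w))
    (f g : L2 𝕜 n) : inner 𝕜 (mulL2 Φ f) g = inner 𝕜 f (mulL2 Φ g) := by
  rw [L2.inner_def, L2.inner_def]
  refine integral_congr_ae ?_
  filter_upwards [coeFn_mulL2 Φ f, coeFn_mulL2 Φ g] with t hf hg
  rw [hf, hg]
  exact hΦ _ _ _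

theorem compLpL_toL2 (A : Vec 𝕜 n →L[𝕜] Vec 𝕜 n) (u v : Sobolev 𝕜 n m)
    (h : ∀ k, v.coeff k = A (u.coeff k)) : A.compLpL 2 circleMeasure (toL2 u) = toL2 v := by
  refine ((hasSum_toL2 u).mapL (A.compLpL 2 circleMeasure)).unique ?_
  convert hasSum_toL2 v using 1
  funext k
  refine Lp.ext ?_
  filter_upwards [A.coeFn_compLpL (trigL2 k (u.coeff k)), coeFn_trigL2 k (u.coeff k),
    coeFn_trigL2 k (v.coeff k)] with t h1 h2 h3
  rw [h1, h2, h3, h, map_smul]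

end Multiplication

/-! ### The sign operator, the Dirac operator J d/dt and the adjoint of the inclusion. -/

namespace Sobolev

variable {𝕜 : Type} [RCLike 𝕜] {n m m' : ℕ}

/-- The operator that preserves the constants and acts on the other Fourier coefficients by
`(u_k) ↦ (a_k J u_{-k})`. -/
def modeOp (a : ℤ → ℝ) (h : ∀ k ≠ 0, weight m' k * a k ^ 2 ≤ weight m k) :
    Sobolev 𝕜 n m →L[𝕜] Sobolev 𝕜 n m' :=
  mapCoeff (Equiv.neg ℤ)
    (fun k => if k = 0 then ContinuousLinearMap.id 𝕜 _ else ((a k : ℝ) : 𝕜) • Jop) 1 zero_le_one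
    fun k v => by
      rw [Equiv.neg_apply, weight_neg, one_pow, one_mul]
      split_ifs with hk
      · simp [hk, weight]
      · simp only [_root_.smul_apply, norm_smul, norm_Jop, RCLike.norm_ofReal, mul_pow,
          sq_abs, ← mul_assoc]
        exact mul_le_mul_of_nonneg_right (h k hk) (by positivity)

theorem coeff_modeOp (a : ℤ → ℝ) (h : ∀ k ≠ 0, weight m' k * a k ^ 2 ≤ weight m k)
    (u : Sobolev 𝕜 n m) (k : ℤ) : (modeOp a h u).coeff k
      = if k = 0 then u.coeff 0 else ((a k : ℝ) : 𝕜) • Jop (u.coeff (-k)) := by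
  rw [modeOp, coeff_mapCoeff]
  split_ifs with hk
  · simp [hk]
  · rfl

/-- The product of the multipliers has to be -1 and not 1, because J² = -1. -/
theorem modeOp_modeOp (a b : ℤ → ℝ) (h : ∀ k ≠ 0, weight m' k * a k ^ 2 ≤ weight m k)
    (h' : ∀ k ≠ 0, weight m k * b k ^ 2 ≤ weight m' k) (hab : ∀ k ≠ 0, a k * b (-k) = -1)
    (u : Sobolev 𝕜 n m') : modeOp a h (modeOp b h' u) = u := by
  refine ext fun k => ?_
  by_cases hk : k = 0
  · simp [coeff_modeOp, hk]
  · have : ((a k : ℝ) : 𝕜) * ((b (-k) : ℝ) : 𝕜) = -1 := by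
      rw [← RCLike.ofReal_mul, hab k hk]
      simp
    simp only [coeff_modeOp, hk, neg_eq_zero, if_false, map_smul, Jop_Jop, smul_neg, smul_smul, this,
      neg_neg, neg_smul, one_smul]

/-- Reflecting k gives one sign from the oddness of `a` and one from the antisymmetry of J. The
weight exponent `p` is free, so that symmetry holds for H^{1/2} and for L² alike. -/
theorem tsum_inner_modeOp (a : ℤ → ℝ) (h : ∀ k ≠ 0, weight m' k * a k ^ 2 ≤ weight m k)
    (ha : ∀ k, a (-k) = -a k) (p : ℕ) (u v : Sobolev 𝕜 n m) :
    ∑' k, (weight p k : 𝕜) * inner 𝕜 ((modeOp a h u).coeff k) (v.coeff k)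
      = ∑' k, (weight p k : 𝕜) * inner 𝕜 (u.coeff k) ((modeOp a h v).coeff k) := by
  rw [← (Equiv.neg ℤ).tsum_eq]
  refine tsum_congr fun k => ?_
  rw [Equiv.neg_apply, weight_neg, coeff_modeOp, coeff_modeOp]
  by_cases hk : k = 0
  · simp [hk]
  · simp only [hk, neg_eq_zero, if_false, ha, neg_neg, inner_smul_left, inner_smul_right, inner_Jop,
      RCLike.conj_ofReal, map_neg]
    ring

theorem weight_add_two (m : ℕ) {k : ℤ} (hk : k ≠ 0) :
    weight (m + 2) k = weight m k * (k : ℝ) ^ 2 := by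
  simp only [weight, hk, if_false, pow_add, Int.cast_abs, sq_abs]
  ring

/-- The involution `u ↦ P₊ u - P₋ u + P₀ u`, where `P₀` is the projection to the constants. -/
def signOp : Sobolev 𝕜 n m →L[𝕜] Sobolev 𝕜 n m :=
  modeOp (fun k => ((SignType.sign k : ℤ) : ℝ)) fun k hk => by
    rcases lt_or_gt_of_ne hk with h | h
    · simp [sign_neg h]
    · simp [sign_pos h]

theorem coeff_signOp (u : Sobolev 𝕜 n m) (k : ℤ) : (signOp u).coeff k
    = if k = 0 then u.coeff 0 else (((SignType.sign k : ℤ) : ℝ) : 𝕜) • Jop (u.coeff (-k)) :=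
  coeff_modeOp ..

theorem signOp_signOp (u : Sobolev 𝕜 n m) : signOp (signOp u) = u := by
  refine modeOp_modeOp _ _ _ _ (fun k hk => ?_) u
  rcases lt_or_gt_of_ne hk with h | h
  · simp [sign_neg h, sign_pos (neg_pos.mpr h)]
  · simp [sign_pos h, sign_neg (neg_neg_of_pos h)]

theorem sign_neg_cast (k : ℤ) :
    ((SignType.sign (-k) : ℤ) : ℝ) = -((SignType.sign k : ℤ) : ℝ) := by
  rw [Left.sign_neg]
  simp

/-- The operator `u ↦ J u' + P₀ u`, where `P₀` is the projection to the constants. -/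
def diracOp : Sobolev 𝕜 n (m + 2) →L[𝕜] Sobolev 𝕜 n m :=
  modeOp (fun k => k) fun _ hk => (weight_add_two m hk).ge

theorem coeff_diracOp (u : Sobolev 𝕜 n (m + 2)) (k : ℤ) : (diracOp u).coeff k
    = if k = 0 then u.coeff 0 else ((k : ℝ) : 𝕜) • Jop (u.coeff (-k)) :=
  coeff_modeOp ..

/-- `diracOp` is invertible. -/
def diracEquiv : Sobolev 𝕜 n (m + 2) ≃L[𝕜] Sobolev 𝕜 n m :=
  ContinuousLinearEquiv.equivOfInverse diracOp
    (modeOp (fun k => (k : ℝ)⁻¹) fun k hk => by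
      have : (k : ℝ) ≠ 0 := by exact_mod_cast hk
      rw [weight_add_two m hk]
      field_simp
      exact le_rfl)
    (fun u => modeOp_modeOp _ _ _ _ (fun k hk => by
      have : (k : ℝ) ≠ 0 := by exact_mod_cast hk
      push_cast
      field_simp) u)
    (fun u => modeOp_modeOp _ _ _ _ (fun k hk => by
      have : (k : ℝ) ≠ 0 := by exact_mod_cast hk
      push_cast
      field_simp) u)

theorem tsum_inner_meanL (p : ℕ) (u : Sobolev 𝕜 n m) (v : Sobolev 𝕜 n m) :
    ∑' k, (weight p k : 𝕜) * inner 𝕜 ((meanL u : Sobolev 𝕜 n m').coeff k) (v.coeff k)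
      = ∑' k, (weight p k : 𝕜) * inner 𝕜 (u.coeff k) ((meanL v : Sobolev 𝕜 n m').coeff k) := by
  refine tsum_congr fun k => ?_
  rw [coeff_meanL, coeff_meanL]
  split_ifs with hk
  · rw [hk]
  · rw [inner_zero_left, inner_zero_right]

theorem inner_signOp (u v : Sobolev 𝕜 n m) : inner 𝕜 (signOp u) v = inner 𝕜 u (signOp v) := by
  rw [inner_def, inner_def]
  exact tsum_inner_modeOp _ _ sign_neg_cast _ u v

theorem inner_meanL (u v : Sobolev 𝕜 n m) : inner 𝕜 (meanL u) v = inner 𝕜 u (meanL v) := by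
  rw [inner_def, inner_def]
  exact tsum_inner_meanL _ u v

theorem inner_toL2_diracOp (u v : Sobolev 𝕜 n (m + 2)) :
    inner 𝕜 (toL2 (diracOp u)) (toL2 v) = inner 𝕜 (toL2 u) (toL2 (diracOp v)) := by
  rw [inner_toL2, inner_toL2]
  exact tsum_inner_modeOp _ _ (fun k => by push_cast; rfl) _ u v

theorem inner_toL2_meanL (u v : Sobolev 𝕜 n m) :
    inner 𝕜 (toL2 (meanL u : Sobolev 𝕜 n m')) (toL2 v)
      = inner 𝕜 (toL2 u) (toL2 (meanL v : Sobolev 𝕜 n m')) := by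
  rw [inner_toL2, inner_toL2]
  exact tsum_inner_meanL _ u v

/-- The adjoint of the inclusion `H^{m/2} → L²`. -/
def fromL2 : L2 𝕜 n →L[𝕜] Sobolev 𝕜 n m := ContinuousLinearMap.adjoint toL2

theorem inner_fromL2 (u : Sobolev 𝕜 n m) (f : L2 𝕜 n) :
    inner 𝕜 u (fromL2 f) = inner 𝕜 (toL2 u) f :=
  ContinuousLinearMap.adjoint_inner_right _ _ _

theorem weight_mul_inner_coeff_fromL2 (f : L2 𝕜 n) (k : ℤ) (v : Vec 𝕜 n) :
    (weight m k : 𝕜) * inner 𝕜 v ((fromL2 f : Sobolev 𝕜 n m).coeff k)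
      = inner 𝕜 (trigL2 k v) f := by
  rw [← inner_singleL, inner_fromL2, toL2_singleL]

/-- The adjoint of the inclusion divides the coefficient of a mode k ≠ 0 by |k|^m. On the constants
both weights are 2π and nothing changes. -/
theorem weight_smul_coeff_fromL2_toL2 (v : Sobolev 𝕜 n m') (k : ℤ) :
    (weight m k : 𝕜) • (fromL2 (toL2 v) : Sobolev 𝕜 n m).coeff k
      = (weight 0 k : 𝕜) • v.coeff k := by
  refine ext_inner_left 𝕜 fun w => ?_
  rw [inner_smul_right, weight_mul_inner_coeff_fromL2, inner_trigL2_toL2, inner_smul_right]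

/-- This is sign k = k / |k|, mode by mode: the sign of the Dirac operator is the Dirac operator
followed by the adjoint of the inclusion. It links H^{1/2} to L². -/
theorem signOp_inclL (u : Sobolev 𝕜 n 2) :
    signOp (inclL one_le_two u) = fromL2 (m := 1) (toL2 (diracOp (m := 0) u)) := by
  refine ext fun k => ?_
  have h1 : ((weight 1 k : ℝ) : 𝕜) ≠ 0 := by exact_mod_cast (weight_pos 1 k).ne'
  refine smul_right_injective _ h1 ?_
  simp only
  rw [weight_smul_coeff_fromL2_toL2, coeff_signOp, coeff_diracOp]
  split_ifs with hk
  · simp [hk, weight]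
  · rw [coeff_inclL, smul_smul, smul_smul, ← RCLike.ofReal_mul, ← RCLike.ofReal_mul]
    congr 2
    have : (|k| : ℤ) * ((SignType.sign k : ℤ)) = k := abs_mul_sign k
    have h2 : ((|k| : ℤ) : ℝ) * ((SignType.sign k : ℤ) : ℝ) = k := by exact_mod_cast this
    simp only [weight, hk, if_false, pow_one, pow_zero, mul_one]
    rw [mul_assoc, h2]

theorem fromL2_toL2_meanL (u : Sobolev 𝕜 n m) :
    fromL2 (toL2 (meanL u : Sobolev 𝕜 n 0)) = meanL (m' := m') u := by
  refine ext fun k => ?_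
  have h1 : ((weight m' k : ℝ) : 𝕜) ≠ 0 := by exact_mod_cast (weight_pos m' k).ne'
  refine smul_right_injective _ h1 ?_
  simp only
  rw [weight_smul_coeff_fromL2_toL2, coeff_meanL, coeff_meanL]
  split_ifs with hk
  · simp [hk, weight]
  · simp

end Sobolev

/-! ### The inclusions of Sobolev spaces are limits of finite-rank operators. -/

section Compactness

open Sobolev

variable {n m : ℕ}

theorem finiteDimensional_range_comp {G H : Type*} [NormedAddCommGroup G] [NormedSpace ℂ G]
    [NormedAddCommGroup H] [NormedSpace ℂ H] (A : Vec ℂ n →L[ℂ] H) (B : G →L[ℂ] Vec ℂ n) :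
    A ∘L B ∈ finiteRankOperators G H :=
  Submodule.finiteDimensional_of_le (S₂ := A.range) (by
    rintro _ ⟨w, rfl⟩
    exact ⟨B w, rfl⟩)

theorem inclL_mem_approximableOperators :
    (inclL (Nat.zero_le (m + 1)) : Sobolev ℂ n (m + 1) →L[ℂ] Sobolev ℂ n 0)
      ∈ approximableOperators _ _ := by
  refine Metric.mem_closure_iff.mpr fun ε hε => ?_
  -- Cutting off the modes with |k| > N costs at most (N + 1)^{-1/2} in operator norm, since the
  -- remaining weights gain at least a factor N + 1.
  obtain ⟨N, hN⟩ := exists_nat_one_div_lt (sq_pos_of_pos hε)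
  refine ⟨∑ k ∈ Finset.Icc (-(N : ℤ)) N, singleL k ∘L coeffL k,
    Submodule.sum_mem _ fun k _ => finiteDimensional_range_comp _ _, ?_⟩
  have hN0 : (0 : ℝ) < N + 1 := by positivity
  have hb : ∀ (k : ℤ) (v : Vec ℂ n),
      weight 0 k * ‖(if |k| ≤ N then (0 : Vec ℂ n →L[ℂ] Vec ℂ n)
        else ContinuousLinearMap.id ℂ _) v‖ ^ 2
        ≤ √(1 / (N + 1)) ^ 2 * (weight (m + 1) (Equiv.refl ℤ k) * ‖v‖ ^ 2) := fun k v => by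
    rw [Real.sq_sqrt (by positivity), Equiv.refl_apply]
    split_ifs with hk
    · have := (weight_pos (m + 1) k).le
      simp only [_root_.zero_apply, norm_zero]
      refine le_trans (by simp) (mul_nonneg (by positivity) (mul_nonneg this (sq_nonneg ‖v‖)))
    · rw [ContinuousLinearMap.id_apply, ← mul_assoc]
      refine mul_le_mul_of_nonneg_right ?_ (by positivity)
      have h1 : (N : ℤ) + 1 ≤ |k| := by omega
      have h2 : (N : ℝ) + 1 ≤ ((|k| : ℤ) : ℝ) := by exact_mod_cast h1
      have hk0 : k ≠ 0 := by
        rintro rfl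
        simp at hk
      have h3 : weight 0 k * (N + 1) ≤ weight 1 k := by
        simp only [weight, hk0, if_false, pow_zero, mul_one, pow_one]
        exact mul_le_mul_of_nonneg_left h2 Real.pi_pos.le
      have h4 := h3.trans (weight_mono (Nat.le_add_left 1 m) k)
      rw [one_div, ← div_eq_inv_mul, le_div_iff₀ hN0]
      exact h4
  have he : (inclL (Nat.zero_le (m + 1)) : Sobolev ℂ n (m + 1) →L[ℂ] Sobolev ℂ n 0)
      - ∑ k ∈ Finset.Icc (-(N : ℤ)) N, singleL k ∘L coeffL k
        = mapCoeff (Equiv.refl ℤ) _ _ (Real.sqrt_nonneg _) hb := by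
    refine ContinuousLinearMap.ext fun u => Sobolev.ext fun k => ?_
    have hs : ((∑ j ∈ Finset.Icc (-(N : ℤ)) N, singleL j ∘L coeffL j :
        Sobolev ℂ n (m + 1) →L[ℂ] Sobolev ℂ n 0) u).coeff k
          = ∑ j ∈ Finset.Icc (-(N : ℤ)) N, if k = j then u.coeff j else 0 := by
      rw [← coeffL_apply, _root_.sum_apply, map_sum]
      exact Finset.sum_congr rfl fun j _ => coeff_singleL (m := 0) j k _
    rw [_root_.sub_apply, coeff_sub, coeff_inclL, hs, coeff_mapCoeff,
      Finset.sum_ite_eq, Equiv.refl_apply]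
    simp only [Finset.mem_Icc, ← abs_le]
    split_ifs <;> simp
  rw [dist_eq_norm, he]
  refine (norm_mapCoeff_le _ _ _ _ _).trans_lt ?_
  rw [Real.sqrt_lt' hε]
  exact hN

theorem toL2_mem_approximableOperators :
    (toL2 : Sobolev ℂ n (m + 1) →L[ℂ] L2 ℂ n) ∈ approximableOperators _ _ := by
  have h : (toL2 : Sobolev ℂ n (m + 1) →L[ℂ] L2 ℂ n)
      = toL2 ∘L inclL (Nat.zero_le (m + 1)) :=
    ContinuousLinearMap.ext fun u => (toL2_inclL (Nat.zero_le (m + 1)) u).symm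
  rw [h]
  exact comp_left_mem_approximableOperators _ inclL_mem_approximableOperators

theorem meanL_mem_approximableOperators {m' : ℕ} :
    (meanL : Sobolev ℂ n m →L[ℂ] Sobolev ℂ n m') ∈ approximableOperators _ _ :=
  subset_closure (finiteDimensional_range_comp _ _)

end Compactness

/-! ### The Hessian operator in H^{1/2} and the first order operator in L². -/

section Families

open Sobolev

variable {𝕜 : Type} [RCLike 𝕜] {n : ℕ}

/-- The operator `u ↦ P₊ u - P₋ u + ι^* Φ ι u` in `H^{1/2}`, where `ι` is the inclusion into `L²`. -/
def hessianOp (Φ : LoopOp 𝕜 n) : Sobolev 𝕜 n 1 →L[𝕜] Sobolev 𝕜 n 1 :=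
  signOp - meanL + fromL2 ∘L mulL2 Φ ∘L toL2

/-- The operator `u ↦ J u' + Φ u` from `H¹` to `L²`. -/
def firstOrderOp (Φ : LoopOp 𝕜 n) : Sobolev 𝕜 n 2 →L[𝕜] L2 𝕜 n :=
  toL2 ∘L (diracOp (m := 0) - meanL) + mulL2 Φ ∘L toL2

theorem hessianOp_apply (Φ : LoopOp 𝕜 n) (u : Sobolev 𝕜 n 1) :
    hessianOp Φ u = signOp u - meanL u + fromL2 (mulL2 Φ (toL2 u)) := rfl

theorem firstOrderOp_apply (Φ : LoopOp 𝕜 n) (u : Sobolev 𝕜 n 2) :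
    firstOrderOp Φ u = toL2 (diracOp (m := 0) u) - toL2 (meanL (m' := 0) u)
      + mulL2 Φ (toL2 u) := by
  rw [← map_sub]
  rfl

theorem coeFn_firstOrderOp (Φ : LoopOp 𝕜 n) (u : Sobolev 𝕜 n 2) :
    ∀ᵐ t ∂circleMeasure, firstOrderOp Φ u t
      = Jop ((toL2 (coeffDeriv u) : L2 𝕜 n) t) + Φ.extend t ((toL2 u : L2 𝕜 n) t) := by
  have h : (Jop (𝕜 := 𝕜)).compLpL 2 circleMeasure (toL2 (coeffDeriv u))
      = toL2 (diracOp (m := 0) u - meanL u) := by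
    refine compLpL_toL2 _ _ _ fun k => ?_
    rw [coeff_sub, coeff_diracOp, coeff_meanL]
    change _ = Jop (((k : ℝ) : 𝕜) • u.coeff (-k))
    by_cases hk : k = 0
    · simp [hk]
    · simp [hk]
  have e : firstOrderOp Φ u = (Jop (𝕜 := 𝕜)).compLpL 2 circleMeasure (toL2 (coeffDeriv u))
      + mulL2 Φ (toL2 u) := by
    rw [h]
    rfl
  rw [e]
  filter_upwards [Lp.coeFn_add ((Jop (𝕜 := 𝕜)).compLpL 2 circleMeasure (toL2 (coeffDeriv u)))
    (mulL2 Φ (toL2 u)), (Jop (𝕜 := 𝕜)).coeFn_compLpL (toL2 (coeffDeriv u) : L2 𝕜 n),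
    coeFn_mulL2 Φ (toL2 u)] with t h1 h2 h3
  rw [h1, Pi.add_apply, h2, h3]

/-- The intertwining relation between the Morse and the spectral operator: on H¹ each summand of the
Hessian is the adjoint of the inclusion applied to the corresponding summand of J u' + Φ u. -/
theorem hessianOp_inclL (Φ : LoopOp 𝕜 n) (u : Sobolev 𝕜 n 2) :
    hessianOp Φ (inclL one_le_two u) = fromL2 (firstOrderOp Φ u) := by
  have h : (meanL (inclL one_le_two u) : Sobolev 𝕜 n 1) = meanL u := by
    refine Sobolev.ext fun k => ?_
    rw [coeff_meanL, coeff_meanL, coeff_inclL]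
  rw [hessianOp_apply, firstOrderOp_apply, signOp_inclL, toL2_inclL, map_add, map_sub,
    fromL2_toL2_meanL, h]

theorem inner_hessianOp {Φ : LoopOp 𝕜 n} (hΦ : ∀ t v w, inner 𝕜 (Φ t v) w = inner 𝕜 v (Φ t w))
    (u v : Sobolev 𝕜 n 1) : inner 𝕜 (hessianOp Φ u) v = inner 𝕜 u (hessianOp Φ v) := by
  have h1 : inner 𝕜 (fromL2 (mulL2 Φ (toL2 u))) v = inner 𝕜 (mulL2 Φ (toL2 u)) (toL2 v) := by
    rw [← inner_conj_symm, inner_fromL2, inner_conj_symm]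
  simp only [hessianOp_apply, inner_add_left, inner_add_right, inner_sub_left, inner_sub_right,
    inner_signOp, inner_meanL, inner_fromL2, h1, inner_mulL2 Φ hΦ]

theorem inner_firstOrderOp {Φ : LoopOp 𝕜 n}
    (hΦ : ∀ t v w, inner 𝕜 (Φ t v) w = inner 𝕜 v (Φ t w)) (u v : Sobolev 𝕜 n 2) :
    inner 𝕜 (firstOrderOp Φ u) (toL2 v) = inner 𝕜 (toL2 u) (firstOrderOp Φ v) := by
  simp only [firstOrderOp_apply, inner_add_left, inner_add_right, inner_sub_left, inner_sub_right,
    inner_toL2_diracOp, inner_toL2_meanL, inner_mulL2 Φ hΦ]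

theorem continuous_hessianOp : Continuous (hessianOp (𝕜 := 𝕜) (n := n)) := by
  unfold hessianOp
  have := (mulL2 (𝕜 := 𝕜) (n := n)).continuous
  fun_prop

theorem continuous_firstOrderOp : Continuous (firstOrderOp (𝕜 := 𝕜) (n := n)) := by
  unfold firstOrderOp
  have := (mulL2 (𝕜 := 𝕜) (n := n)).continuous
  fun_prop

end Families

/-! ### Equality of the Morse and the spectral index bundle. -/

section Index

open Sobolev

variable {n : ℕ}

/-- The operator `u ↦ J u' + P₀ u`, as an isomorphism of `H¹` with `L²`. -/
def diracL2Equiv : Sobolev ℂ n 2 ≃L[ℂ] L2 ℂ n :=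
  (diracEquiv (m := 0)).trans sobolevZeroEquiv

theorem diracL2Equiv_apply (u : Sobolev ℂ n 2) :
    diracL2Equiv u = toL2 (diracOp (m := 0) u) := rfl

/-- Everything but J d/dt + P₀ factors through the inclusion of H¹ into L² or through the constants,
so it is approximable; the term i s belongs to the perturbation. -/
theorem exists_firstOrderOp_add_eq (Φ : LoopOp ℂ n) (s : ℝ) :
    ∃ B K, firstOrderOp Φ + (Complex.I * (s : ℂ)) • toL2 = B + K ∧ B.IsInvertible ∧
      K ∈ approximableOperators (Sobolev ℂ n 2) (L2 ℂ n) := by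
  refine ⟨diracL2Equiv (n := n), -(toL2 ∘L meanL (m' := 0)) + mulL2 Φ ∘L toL2
    + (Complex.I * (s : ℂ)) • toL2, ?_, ⟨_, rfl⟩, ?_⟩
  · refine ContinuousLinearMap.ext fun u => ?_
    simp only [_root_.add_apply, firstOrderOp_apply, _root_.neg_apply,
      ContinuousLinearMap.comp_apply, ContinuousLinearEquiv.coe_coe, diracL2Equiv_apply]
    abel
  · refine add_mem (add_mem (neg_mem ?_) ?_) (Submodule.smul_mem _ _ ?_)
    · exact comp_left_mem_approximableOperators _ meanL_mem_approximableOperators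
    · exact comp_left_mem_approximableOperators _ toL2_mem_approximableOperators
    · exact toL2_mem_approximableOperators

/-- For an involution σ one has (σ + ir)(σ - ir) = 1 + r². -/
theorem isInvertible_signOp_add (r : ℝ) :
    (signOp + (Complex.I * (r : ℂ)) • ContinuousLinearMap.id ℂ (Sobolev ℂ n 1)).IsInvertible := by
  have h0 : (1 + (r : ℂ) ^ 2) ≠ 0 := by
    have : (0 : ℝ) < 1 + r ^ 2 := by positivity
    exact_mod_cast this.ne'
  have key : ∀ (c : ℂ) (hc : c ^ 2 = -(r : ℂ) ^ 2) (u : Sobolev ℂ n 1),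
      (1 + (r : ℂ) ^ 2)⁻¹ • (signOp (signOp u + c • u) - c • (signOp u + c • u)) = u := by
    intro c hc u
    have : signOp (signOp u + c • u) - c • (signOp u + c • u) = (1 + (r : ℂ) ^ 2) • u := by
      rw [map_add, map_smul, signOp_signOp, smul_add, smul_smul, ← pow_two, hc, add_smul, one_smul,
        neg_smul]
      abel
    rw [this, inv_smul_smul₀ h0]
  have hI : (Complex.I * (r : ℂ)) ^ 2 = -(r : ℂ) ^ 2 := by
    rw [mul_pow, Complex.I_sq, neg_one_mul]
  refine ⟨ContinuousLinearEquiv.equivOfInverse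
    (signOp + (Complex.I * (r : ℂ)) • ContinuousLinearMap.id ℂ (Sobolev ℂ n 1))
    ((1 + (r : ℂ) ^ 2)⁻¹ • (signOp - (Complex.I * (r : ℂ)) • ContinuousLinearMap.id ℂ _))
    (fun u => key _ hI u) (fun u => ?_), rfl⟩
  have h := key (-(Complex.I * (r : ℂ))) (by rw [neg_sq, hI]) u
  simp only [neg_smul, ← sub_eq_add_neg, sub_neg_eq_add] at h
  rw [_root_.smul_apply, map_smul]
  exact h

theorem fromL2_comp_toL2_mem_approximableOperators :
    (fromL2 ∘L toL2 : Sobolev ℂ n 1 →L[ℂ] Sobolev ℂ n 1) ∈ approximableOperators _ _ :=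
  comp_left_mem_approximableOperators _ toL2_mem_approximableOperators

/-- Here τ is the parameter of the deformation of the identity into ι*ι. In H^{1/2} the identity is
not approximable, so its share of i s stays in the invertible part, whereas the share of ι*ι goes to
the perturbation. -/
theorem exists_hessianOp_add_eq (Φ : LoopOp ℂ n) (s τ : ℝ) :
    ∃ B K, hessianOp Φ + (Complex.I * (s : ℂ)) •
        (((1 - τ : ℝ) : ℂ) • ContinuousLinearMap.id ℂ _ + (τ : ℂ) • fromL2 ∘L toL2) = B + K ∧
      B.IsInvertible ∧ K ∈ approximableOperators (Sobolev ℂ n 1) (Sobolev ℂ n 1) := by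
  refine ⟨_, -meanL + fromL2 ∘L mulL2 Φ ∘L toL2
    + (Complex.I * (s : ℂ) * (τ : ℂ)) • fromL2 ∘L toL2, ?_, isInvertible_signOp_add (s * (1 - τ)),
    ?_⟩
  · refine ContinuousLinearMap.ext fun u => ?_
    simp only [hessianOp, _root_.add_apply, _root_.smul_apply, _root_.sub_apply, _root_.neg_apply,
      ContinuousLinearMap.id_apply, smul_add, smul_smul, Complex.ofReal_mul, ← mul_assoc]
    abel
  · refine add_mem (add_mem (neg_mem meanL_mem_approximableOperators) ?_)
      (Submodule.smul_mem _ _ fromL2_comp_toL2_mem_approximableOperators)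
    exact comp_left_mem_approximableOperators _
      (comp_left_mem_approximableOperators _ toL2_mem_approximableOperators)

theorem suspension_apply {X : Type u} [TopologicalSpace X] {W H : Type} [NormedAddCommGroup W]
    [InnerProductSpace ℂ W] [NormedAddCommGroup H] [InnerProductSpace ℂ H] (ι : W →L[ℂ] H)
    (D : C(X, W →L[ℂ] H)) (z : X × ℝ) :
    suspension ι D z = D z.1 + (Complex.I * (z.2 : ℂ)) • ι := rfl

/-- Dual to the injectivity of the inclusion into L². -/
theorem denseRange_fromL2 {m : ℕ} : DenseRange (fromL2 : L2 ℂ n →L[ℂ] Sobolev ℂ n m) := by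
  rw [← LinearMap.coe_coe, DenseRange, ← LinearMap.coe_range,
    Submodule.dense_iff_topologicalClosure_eq_top, Submodule.topologicalClosure_eq_top_iff,
    Submodule.eq_bot_iff]
  intro u hu
  have h : ∀ f, inner ℂ f (toL2 u) = 0 := fun f => by
    rw [← inner_conj_symm, ← inner_fromL2, inner_conj_symm]
    exact hu _ ⟨f, rfl⟩
  exact toL2_injective ((inner_self_eq_zero.mp (h _)).trans (map_zero _).symm)

/-- Dual to the density of trigonometric polynomials in L². -/
theorem fromL2_injective {m : ℕ} :
    Function.Injective (fromL2 : L2 ℂ n →L[ℂ] Sobolev ℂ n m) := by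
  refine (injective_iff_map_eq_zero _).mpr fun f hf => eq_zero_of_inner_trigL2_eq_zero f fun k v => ?_
  rw [← weight_mul_inner_coeff_fromL2 (m := m), hf, coeff_zero, inner_zero_right, mul_zero]

variable {X : Type u} [TopologicalSpace X] [CompactSpace X]

set_option maxHeartbeats 1000000 in
/-- The selfadjoint families `P₊ - P₋ + ι^* Φ ι` in `H^{1/2}` and `J u' + Φ u` in `L²` have the same
index bundle. -/
theorem exists_hasSelfAdjointIndexBundle_hessianOp (Φ : C(X, LoopOp ℂ n))
    (hΦ : ∀ x t v w, inner ℂ (Φ x t v) w = inner ℂ v (Φ x t w)) (Y : Set X)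
    (L : C(X, Sobolev ℂ n 1 →L[ℂ] Sobolev ℂ n 1)) (hL : ∀ x, L x = hessianOp (Φ x))
    (A : C(X, Sobolev ℂ n 2 →L[ℂ] L2 ℂ n)) (hA : ∀ x, A x = firstOrderOp (Φ x))
    (hY : ∀ x ∈ Y, (L x).IsInvertible) :
    ∃ κ, HasSelfAdjointIndexBundle (ContinuousLinearMap.id ℂ (Sobolev ℂ n 1))
        Function.injective_id L Y κ ∧
      HasSelfAdjointIndexBundle toL2 toL2_injective A Y κ := by
  have hdecA : ∀ x (s : ℝ), ∃ B K, A x + (Complex.I * (s : ℂ)) • toL2 = B + K ∧ B.IsInvertible ∧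
      K ∈ approximableOperators _ _ := fun x s => by
    rw [hA]
    exact exists_firstOrderOp_add_eq (Φ x) s
  -- The inclusion maps the kernel of A into the kernel of L, which is trivial on `Y`; index 0 does
  -- the rest.
  have hAY : ∀ x ∈ Y, (A x).IsInvertible := fun x hx => by
    obtain ⟨B, K, h, hB, hK⟩ := hdecA x 0
    rw [Complex.ofReal_zero, mul_zero, zero_smul, add_zero] at h
    have hF := isFredholm_of_invertible_add h hB hK
    refine isInvertible_of_injective_of_finrank_eq hF.1 hF.2
      ((injective_iff_map_eq_zero _).mpr fun u hu => ?_)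
    have h0 : L x (inclL one_le_two u) = 0 := by
      rw [hL, hessianOp_inclL, ← hA, hu, map_zero]
    obtain ⟨e, he⟩ := hY x hx
    rw [← he] at h0
    exact inclL_injective one_le_two
      ((e.injective (h0.trans (map_zero e).symm)).trans (map_zero _).symm)
  obtain ⟨κ, hκ⟩ := exists_hasSelfAdjointIndexBundle toL2 toL2_injective A
    (fun x u v => by rw [hA]; exact inner_firstOrderOp (hΦ x) u v) hdecA Y hAY
  obtain ⟨κ', hκ'⟩ := exists_hasSelfAdjointIndexBundle (ContinuousLinearMap.id ℂ _)
    Function.injective_id L (fun x u v => by rw [hL]; exact inner_hessianOp (hΦ x) u v)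
    (fun x s => by
      obtain ⟨B, K, h, hBK⟩ := exists_hessianOp_add_eq (Φ x) s 0
      refine ⟨B, K, ?_, hBK⟩
      rw [← h, hL]
      refine ContinuousLinearMap.ext fun u => ?_
      simp only [_root_.add_apply, _root_.smul_apply, sub_zero, Complex.ofReal_one, one_smul,
        Complex.ofReal_zero, zero_smul, add_zero]) Y hY
  -- The homotopy from L + is to L + is ι*ι. The latter, unlike the former, is intertwined with A +
  -- is ι.
  let T : C((X × ℝ) × unitInterval, Sobolev ℂ n 1 →L[ℂ] Sobolev ℂ n 1) :=
    ⟨fun z => L z.1.1 + (Complex.I * (z.1.2 : ℂ)) •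
      (((1 - (z.2 : ℝ) : ℝ) : ℂ) • ContinuousLinearMap.id ℂ _ + ((z.2 : ℝ) : ℂ) • fromL2 ∘L toL2),
      by fun_prop⟩
  have hT : ∀ z, T z = L z.1.1 + (Complex.I * (z.1.2 : ℂ)) •
      (((1 - (z.2 : ℝ) : ℝ) : ℂ) • ContinuousLinearMap.id ℂ _ + ((z.2 : ℝ) : ℂ) • fromL2 ∘L toL2) :=
    fun z => rfl
  have hσ : IsCompact {z : (X × ℝ) × unitInterval | z.1.2 = 0} := by
    have : {z : (X × ℝ) × unitInterval | z.1.2 = 0} = (Set.univ ×ˢ {0}) ×ˢ Set.univ := by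
      ext z
      simp
    rw [this]
    exact (isCompact_univ.prod isCompact_singleton).prod isCompact_univ
  obtain ⟨κ'', hκ''⟩ := exists_hasIndexBundle_of_symmetric (ContinuousLinearMap.id ℂ _) T
    (fun z => L z.1.1) (fun z => ((1 - (z.2 : ℝ) : ℝ) : ℂ) • ContinuousLinearMap.id ℂ _
      + ((z.2 : ℝ) : ℂ) • fromL2 ∘L toL2) (fun z => z.1.2) hT
    (fun z u v => by rw [hL]; exact inner_hessianOp (hΦ z.1.1) u v)
    (fun z u hu => by
      -- The form (1 - τ)|u|² + τ|ιu|² is positive definite for every τ in [0,1]: at τ = 0 by the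
      -- first term, otherwise by the second, as ι is injective.
      have h1 : (inner ℂ u ((((1 - (z.2 : ℝ) : ℝ) : ℂ) • ContinuousLinearMap.id ℂ _
          + ((z.2 : ℝ) : ℂ) • fromL2 ∘L toL2 : Sobolev ℂ n 1 →L[ℂ] Sobolev ℂ n 1) u)).re
          = (1 - (z.2 : ℝ)) * ‖u‖ ^ 2 + (z.2 : ℝ) * ‖toL2 u‖ ^ 2 := by
        have e1 := inner_self_eq_norm_sq (𝕜 := ℂ) u
        have e2 := inner_self_eq_norm_sq (𝕜 := ℂ) (toL2 u)
        rw [RCLike.re_eq_complex_re] at e1 e2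
        simp only [_root_.add_apply, _root_.smul_apply, ContinuousLinearMap.id_apply,
          ContinuousLinearMap.comp_apply, inner_add_right, inner_smul_right, inner_fromL2,
          Complex.add_re, Complex.re_ofReal_mul, e1, e2]
      have hu' := h1.symm.trans hu
      have hz0 := z.2.2.1
      have hz1 := z.2.2.2
      have p1 := mul_nonneg (sub_nonneg.mpr hz1) (sq_nonneg ‖u‖)
      have p2 := mul_nonneg hz0 (sq_nonneg ‖toL2 u‖)
      rcases eq_or_ne (z.2 : ℝ) 0 with h | h
      · rw [h] at hu'
        simpa using hu'
      · have h3 : (z.2 : ℝ) * ‖toL2 u‖ ^ 2 = 0 := by linarith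
        have h4 : ‖toL2 u‖ = 0 := by simpa [h] using h3
        exact toL2_injective ((norm_eq_zero.mp h4).trans (map_zero _).symm))
    (fun z => by
      rw [hT, hL]
      exact exists_hessianOp_add_eq (Φ z.1.1) z.1.2 z.2) hσ
    ((Y ×ˢ Set.univ) ×ˢ Set.univ) (fun z hz _ => hY z.1.1 hz.1.1)
  let S₁ : C(X × ℝ, Sobolev ℂ n 1 →L[ℂ] Sobolev ℂ n 1) :=
    ⟨fun z => T (z, 1), by fun_prop⟩
  have hS₁ : ∀ z, S₁ z = L z.1 + (Complex.I * (z.2 : ℂ)) • fromL2 ∘L toL2 := fun z => by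
    change T (z, 1) = _
    rw [hT]
    refine ContinuousLinearMap.ext fun u => ?_
    simp only [_root_.add_apply, _root_.smul_apply, Set.Icc.coe_one, sub_self, Complex.ofReal_one,
      one_smul, Complex.ofReal_zero, zero_smul, zero_add]
  have hz : ∀ z : X × ℝ, T (z, 0) = suspension (ContinuousLinearMap.id ℂ _) L z := fun z => by
    change _ = L z.1 + (Complex.I * (z.2 : ℂ)) • ContinuousLinearMap.id ℂ (Sobolev ℂ n 1)
    rw [hT]
    refine ContinuousLinearMap.ext fun u => ?_
    simp only [_root_.add_apply, _root_.smul_apply, Set.Icc.coe_zero, sub_zero, Complex.ofReal_one,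
      one_smul, Complex.ofReal_zero, zero_smul, add_zero]
  have hσ' : IsCompact {z : X × ℝ | z.2 = 0} := by
    have : {z : X × ℝ | z.2 = 0} = Set.univ ×ˢ {0} := by
      ext z
      simp
    rw [this]
    exact isCompact_univ.prod isCompact_singleton
  obtain ⟨κ₁, hκ₁⟩ := exists_hasIndexBundle_of_symmetric (ContinuousLinearMap.id ℂ _) S₁
    (fun z => L z.1) (fun _ => fromL2 ∘L toL2) (fun z => z.2) hS₁
    (fun z u v => by rw [hL]; exact inner_hessianOp (hΦ z.1) u v)
    (fun z u hu => by
      have e2 := inner_self_eq_norm_sq (𝕜 := ℂ) (toL2 u)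
      rw [RCLike.re_eq_complex_re] at e2
      rw [ContinuousLinearMap.id_apply, ContinuousLinearMap.comp_apply, inner_fromL2, e2,
        pow_eq_zero_iff two_ne_zero, norm_eq_zero] at hu
      exact toL2_injective (hu.trans (map_zero _).symm))
    (fun z => by
      obtain ⟨B, K, h, hBK⟩ := exists_hessianOp_add_eq (Φ z.1) z.2 1
      refine ⟨B, K, ?_, hBK⟩
      rw [← h, hS₁, hL]
      refine ContinuousLinearMap.ext fun u => ?_
      simp only [_root_.add_apply, _root_.smul_apply, sub_self, Complex.ofReal_one,
        one_smul, Complex.ofReal_zero, zero_smul, zero_add]) hσ'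
    (Y ×ˢ Set.univ) (fun z hz _ => hY z.1 hz.1)
  have e1 : κ' = κ₁ := hκ''.eq_of_homotopy (fun z => (hz z).symm) (fun z => rfl)
    hκ'.hasIndexBundle hκ₁
  -- The parametrix inverts the Dirac part only. The equation for w becomes `signOp` w = ι*f with f
  -- in L² depending continuously on w and h, and then w is the inverse Dirac operator applied to f.
  let G : C(X × ℝ, Sobolev ℂ n 1 →L[ℂ] Sobolev ℂ n 2) :=
    ⟨fun z => ((diracL2Equiv (n := n)).symm : L2 ℂ n →L[ℂ] Sobolev ℂ n 2) ∘L
      (toL2 ∘L meanL (m' := 0) - mulL2 (Φ z.1) ∘L toL2 - (Complex.I * (z.2 : ℂ)) • toL2), by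
      have := (mulL2 (𝕜 := ℂ) (n := n)).continuous
      fun_prop⟩
  have e2 : κ = κ₁ := by
    refine hκ.hasIndexBundle.eq_of_intertwining hκ₁ (inclL one_le_two) fromL2
      (inclL_injective one_le_two) fromL2_injective denseRange_fromL2 (fun z u => ?_) G
      ((diracL2Equiv (n := n)).symm : L2 ℂ n →L[ℂ] Sobolev ℂ n 2) (fun z w h hw => ?_)
    · rw [suspension_apply, hS₁, hL, _root_.add_apply, _root_.add_apply, _root_.smul_apply, _root_.smul_apply,
        hessianOp_inclL, ContinuousLinearMap.comp_apply, toL2_inclL, ← hA, map_add, map_smul]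
    · have hw' : signOp w = fromL2 (toL2 (meanL (m' := 0) w : Sobolev ℂ n 0) - mulL2 (Φ z.1) (toL2 w)
          - (Complex.I * (z.2 : ℂ)) • toL2 w + h) := by
        rw [map_add, ← hw, hS₁, hL, _root_.add_apply, _root_.smul_apply, hessianOp_apply, map_sub,
          map_sub, map_smul, fromL2_toL2_meanL (m' := 1), ContinuousLinearMap.comp_apply]
        abel
      have hc : ∀ f, signOp (inclL one_le_two (diracL2Equiv.symm f)) = fromL2 (m := 1) f :=
        fun f => by
          rw [signOp_inclL, ← diracL2Equiv_apply (n := n), ContinuousLinearEquiv.apply_symm_apply]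
      have hinj : Function.Injective (signOp (𝕜 := ℂ) (n := n) (m := 1)) :=
        Function.LeftInverse.injective signOp_signOp
      refine hinj (hw'.trans ?_)
      rw [← hc, map_add diracL2Equiv.symm]
      rfl
  exact ⟨κ, by rw [e2, ← e1]; exact hκ', hκ⟩

end Index

/-! ### The embedding of H^{1/2} into L^p by dyadic blocks. -/

section Embedding

open Sobolev

variable {𝕜 : Type} [RCLike 𝕜] {n : ℕ}

/-- The part of the Fourier series with indices in a finite set. -/
def Sobolev.partialSum {m : ℕ} (u : Sobolev 𝕜 n m) (s : Finset ℤ) (t : ℝ) : Vec 𝕜 n :=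
  ∑ k ∈ s, ((trig k t : ℝ) : 𝕜) • u.coeff k

theorem Sobolev.continuous_partialSum {m : ℕ} (u : Sobolev 𝕜 n m) (s : Finset ℤ) :
    Continuous (u.partialSum s) := by
  refine continuous_finsetSum _ fun k _ => ?_
  exact Continuous.smul (f := fun t => ((trig k t : ℝ) : 𝕜)) (g := fun _ => u.coeff k)
    (RCLike.continuous_ofReal.comp (continuous_trig k)) continuous_const

theorem coeFn_sum_trigL2 {m : ℕ} (u : Sobolev 𝕜 n m) (s : Finset ℤ) :
    ((∑ k ∈ s, trigL2 k (u.coeff k) : L2 𝕜 n) : ℝ → Vec 𝕜 n) =ᵐ[circleMeasure]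
      u.partialSum s := by
  have h : ∀ᵐ t ∂circleMeasure, ∀ k, (trigL2 k (u.coeff k) : L2 𝕜 n) t
      = ((trig k t : ℝ) : 𝕜) • u.coeff k := ae_all_iff.mpr fun k => coeFn_trigL2 k _
  filter_upwards [Lp.coeFn_fun_finsetSum s fun k => (trigL2 k (u.coeff k) : L2 𝕜 n), h]
    with t h1 h2
  rw [h1]
  exact Finset.sum_congr rfl fun k _ => h2 k

theorem norm_partialSum_le {m : ℕ} (u : Sobolev 𝕜 n m) (s : Finset ℤ) (t : ℝ) :
    ‖u.partialSum s t‖ ≤ ∑ k ∈ s, ‖u.coeff k‖ := by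
  refine norm_sum_le_of_le _ fun k _ => ?_
  rw [norm_smul, RCLike.norm_ofReal]
  exact mul_le_of_le_one_left (norm_nonneg _) (abs_trig_le_one k t)

theorem norm_sum_trigL2_sq {m : ℕ} (u : Sobolev 𝕜 n m) (s : Finset ℤ) :
    ‖(∑ k ∈ s, trigL2 k (u.coeff k) : L2 𝕜 n)‖ ^ 2 = ∑ k ∈ s, weight 0 k * ‖u.coeff k‖ ^ 2 := by
  rw [← @inner_self_eq_norm_sq 𝕜, sum_inner, map_sum]
  refine Finset.sum_congr rfl fun k hk => ?_
  simp_rw [inner_sum, inner_trigL2]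
  rw [Finset.sum_ite_eq, if_pos hk, inner_self_eq_norm_sq_to_K]
  norm_cast

theorem lintegral_partialSum_sq {m : ℕ} (u : Sobolev 𝕜 n m) (s : Finset ℤ) :
    ∫⁻ t, ‖u.partialSum s t‖ₑ ^ 2 ∂circleMeasure
      = ENNReal.ofReal (∑ k ∈ s, weight 0 k * ‖u.coeff k‖ ^ 2) := by
  rw [← norm_sum_trigL2_sq, Lp.norm_def, ← ENNReal.toReal_pow,
    ENNReal.ofReal_toReal (ENNReal.pow_ne_top (Lp.eLpNorm_ne_top _)),
    eLpNorm_congr_ae (coeFn_sum_trigL2 u s), eLpNorm_eq_lintegral_rpow_enorm_toReal two_ne_zero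
    ENNReal.ofNat_ne_top, ← ENNReal.rpow_natCast, ← ENNReal.rpow_mul]
  simp

theorem sum_weight_le {m : ℕ} (u : Sobolev 𝕜 n m) (s : Finset ℤ) :
    ∑ k ∈ s, weight m k * ‖u.coeff k‖ ^ 2 ≤ ‖u‖ ^ 2 := by
  rw [norm_sq_eq_tsum]
  refine u.summable_coeff.sum_le_tsum s fun k _ => ?_
  have := (weight_pos m k).le
  positivity

variable {u : Sobolev 𝕜 n 1} {s : Finset ℤ} {M : ℝ}

theorem sum_norm_coeff_sq_le (hM : 0 < M) (hs : ∀ k ∈ s, M ≤ ((|k| : ℤ) : ℝ)) :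
    Real.pi * M * ∑ k ∈ s, ‖u.coeff k‖ ^ 2 ≤ ‖u‖ ^ 2 := by
  refine le_trans ?_ (sum_weight_le u s)
  rw [Finset.mul_sum]
  refine Finset.sum_le_sum fun k hk => mul_le_mul_of_nonneg_right ?_ (by positivity)
  have hk0 : k ≠ 0 := by
    rintro rfl
    have := hs 0 hk
    simp at this
    linarith
  simp only [weight, hk0, if_false, pow_one]
  exact mul_le_mul_of_nonneg_left (hs k hk) Real.pi_pos.le

/-- Cauchy-Schwarz: there are at most 2M modes, each of weight at least πM, and 2 ≤ π. So every
dyadic block is bounded in the sup norm by the H^{1/2} norm, although the full series need not be.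
-/
theorem norm_partialSum_le_norm (hM : 0 < M) (hs : ∀ k ∈ s, M ≤ ((|k| : ℤ) : ℝ))
    (hc : (s.card : ℝ) ≤ 2 * M) (t : ℝ) : ‖u.partialSum s t‖ ≤ ‖u‖ := by
  refine (norm_partialSum_le u s t).trans (abs_le_of_sq_le_sq' ?_ (norm_nonneg u)).2
  have h1 := sq_sum_le_card_mul_sum_sq (s := s) (f := fun k => ‖u.coeff k‖)
  have h2 := sum_norm_coeff_sq_le (u := u) hM hs
  have h3 : 0 ≤ ∑ k ∈ s, ‖u.coeff k‖ ^ 2 := Finset.sum_nonneg fun k _ => by positivity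
  have h4 := Real.pi_gt_three
  have h5 := mul_le_mul_of_nonneg_right hc h3
  have h6 : 2 * M * ∑ k ∈ s, ‖u.coeff k‖ ^ 2 ≤ Real.pi * M * ∑ k ∈ s, ‖u.coeff k‖ ^ 2 :=
    mul_le_mul_of_nonneg_right (mul_le_mul_of_nonneg_right (by linarith) hM.le) h3
  linarith

/-- With sup norm at most 1, the p-th power is at most the square, and the square of the L² norm of
the block is at most 1/M because of the weights. -/
theorem eLpNorm_partialSum_le (hM : 0 < M) (hs : ∀ k ∈ s, M ≤ ((|k| : ℤ) : ℝ))
    (hc : (s.card : ℝ) ≤ 2 * M) (hu : ‖u‖ ≤ 1) {p : ℕ} (hp : 2 ≤ p) :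
    eLpNorm (u.partialSum s) p circleMeasure ≤ ENNReal.ofReal (M⁻¹ ^ (p : ℝ)⁻¹) := by
  have hp0 : p ≠ 0 := by omega
  rw [eLpNorm_eq_lintegral_rpow_enorm_toReal (by exact_mod_cast hp0) (ENNReal.natCast_ne_top p),
    ENNReal.toReal_natCast, one_div, ← ENNReal.ofReal_rpow_of_nonneg (by positivity) (by positivity)]
  refine ENNReal.rpow_le_rpow ?_ (by positivity)
  have h1 : ∫⁻ t, ‖u.partialSum s t‖ₑ ^ (p : ℝ) ∂circleMeasure
      ≤ ∫⁻ t, ‖u.partialSum s t‖ₑ ^ 2 ∂circleMeasure := by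
    refine lintegral_mono fun t => ?_
    rw [ENNReal.rpow_natCast]
    refine pow_le_pow_right_of_le_one' ?_ hp
    rw [← ofReal_norm, ENNReal.ofReal_le_one]
    exact (norm_partialSum_le_norm hM hs hc t).trans hu
  refine h1.trans ?_
  rw [lintegral_partialSum_sq]
  refine ENNReal.ofReal_le_ofReal ?_
  have h2 := sum_norm_coeff_sq_le (u := u) hM hs
  have h3 : ∑ k ∈ s, weight 0 k * ‖u.coeff k‖ ^ 2 = Real.pi * ∑ k ∈ s, ‖u.coeff k‖ ^ 2 := by
    rw [Finset.mul_sum]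
    refine Finset.sum_congr rfl fun k hk => ?_
    have hk0 : k ≠ 0 := by
      rintro rfl
      have := hs 0 hk
      simp at this
      linarith
    simp [weight, hk0]
  rw [h3, ← one_div, le_div_iff₀ hM]
  nlinarith [norm_nonneg u]

/-- The indices `k` with `2^j ≤ |k| < 2^(j+1)`. -/
def dyadicBlock (j : ℕ) : Finset ℤ :=
  Finset.Ico (2 ^ j) (2 ^ (j + 1)) ∪ Finset.Ioc (-2 ^ (j + 1)) (-2 ^ j)

theorem le_abs_of_mem_dyadicBlock {j : ℕ} {k : ℤ} (hk : k ∈ dyadicBlock j) :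
    (2 : ℝ) ^ j ≤ ((|k| : ℤ) : ℝ) := by
  have h : (2 : ℤ) ^ j ≤ |k| := by
    simp only [dyadicBlock, Finset.mem_union, Finset.mem_Ico, Finset.mem_Ioc] at hk
    rw [le_abs]
    omega
  exact_mod_cast h

theorem card_dyadicBlock_le (j : ℕ) : ((dyadicBlock j).card : ℝ) ≤ 2 * 2 ^ j := by
  have h : (dyadicBlock j).card ≤ 2 * 2 ^ j := by
    refine (Finset.card_union_le _ _).trans ?_
    rw [Int.card_Ico, Int.card_Ioc]
    have : (2 : ℤ) ^ (j + 1) = 2 * 2 ^ j := by ring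
    have h2 : (0 : ℤ) < 2 ^ j := by positivity
    have h3 : ((2 ^ j : ℕ) : ℤ) = 2 ^ j := by push_cast; rfl
    omega
  exact_mod_cast h

/-- The indices `k` with `|k| < 2^N`. -/
def dyadicBall (N : ℕ) : Finset ℤ := Finset.Ioo (-2 ^ N) (2 ^ N)

theorem partialSum_dyadicBall_succ (u : Sobolev 𝕜 n 1) (N : ℕ) :
    u.partialSum (dyadicBall (N + 1))
      = u.partialSum (dyadicBall N) + u.partialSum (dyadicBlock N) := by
  have h2 : (0 : ℤ) < 2 ^ N := by positivity
  have h1 : (2 : ℤ) ^ (N + 1) = 2 * 2 ^ N := by ring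
  have h : dyadicBall (N + 1) = dyadicBall N ∪ dyadicBlock N := by
    ext k
    simp only [dyadicBall, dyadicBlock, Finset.mem_union, Finset.mem_Ico, Finset.mem_Ioc,
      Finset.mem_Ioo]
    omega
  have hd : Disjoint (dyadicBall N) (dyadicBlock N) := by
    rw [Finset.disjoint_left]
    intro k
    simp only [dyadicBall, dyadicBlock, Finset.mem_union, Finset.mem_Ico, Finset.mem_Ioc,
      Finset.mem_Ioo]
    omega
  funext t
  rw [h]
  exact Finset.sum_union hd

theorem tendsto_dyadicBall : Filter.Tendsto dyadicBall Filter.atTop Filter.atTop := by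
  refine Filter.tendsto_atTop_finset_of_monotone (fun M N h => ?_) fun k => ⟨k.natAbs, ?_⟩
  · have : (2 : ℤ) ^ M ≤ 2 ^ N := pow_le_pow_right₀ (by norm_num) h
    exact Finset.Ioo_subset_Ioo (by omega) this
  · have h : (k.natAbs : ℤ) < 2 ^ k.natAbs := by exact_mod_cast Nat.lt_two_pow_self
    rw [dyadicBall, Finset.mem_Ioo]
    omega

/-- The block number j contributes at most 2^{-j/p}, so the triangle inequality leaves a geometric
series of ratio `q` = 2^{-1/p} < 1. -/
theorem exists_eLpNorm_partialSum_dyadicBall_le (𝕜 : Type) [RCLike 𝕜] (n : ℕ) {p : ℕ}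
    (hp : 2 ≤ p) : ∃ C : ENNReal, C ≠ ⊤ ∧ ∀ (u : Sobolev 𝕜 n 1), ‖u‖ ≤ 1 → ∀ N,
      eLpNorm (u.partialSum (dyadicBall N)) p circleMeasure ≤ C := by
  set q : ℝ := (2 : ℝ)⁻¹ ^ (p : ℝ)⁻¹ with hq
  have hp0 : (0 : ℝ) < p := by
    have : 0 < p := by omega
    exact_mod_cast this
  have hq0 : 0 ≤ q := by positivity
  have hq1 : q < 1 := Real.rpow_lt_one (by norm_num) (by norm_num) (by positivity)
  have hsum := summable_geometric_of_lt_one hq0 hq1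
  refine ⟨circleMeasure Set.univ ^ ((p : ENNReal).toReal)⁻¹ * ENNReal.ofReal 1
    + ENNReal.ofReal (∑' j, q ^ j), ?_, fun u hu N => ?_⟩
  · refine ENNReal.add_ne_top.mpr ⟨ENNReal.mul_ne_top (ENNReal.rpow_ne_top_of_nonneg
      (by positivity) (measure_ne_top _ _)) ENNReal.ofReal_ne_top, ENNReal.ofReal_ne_top⟩
  have h : eLpNorm (u.partialSum (dyadicBall N)) p circleMeasure
      ≤ circleMeasure Set.univ ^ ((p : ENNReal).toReal)⁻¹ * ENNReal.ofReal 1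
        + ENNReal.ofReal (∑ j ∈ Finset.range N, q ^ j) := by
    induction N with
    | zero =>
      -- `dyadicBall 0` consists of the constant mode alone, and 2π|c₀|² ≤ 1 bounds it.
      refine le_add_right (eLpNorm_le_of_ae_bound (Filter.Eventually.of_forall fun t => ?_))
      have h1 := norm_partialSum_le u {0} t
      rw [Finset.sum_singleton] at h1
      refine h1.trans (abs_le_of_sq_le_sq' ?_ zero_le_one).2
      have h2 := sum_weight_le u {0}
      rw [Finset.sum_singleton] at h2
      simp only [weight, if_true] at h2
      have h3 := Real.pi_gt_three
      nlinarith [sq_nonneg ‖u.coeff 0‖, norm_nonneg u]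
    | succ N ih =>
      rw [partialSum_dyadicBall_succ, Finset.sum_range_succ,
        ENNReal.ofReal_add (Finset.sum_nonneg fun j _ => by positivity) (by positivity), ← add_assoc]
      refine (eLpNorm_add_le (u.continuous_partialSum _).aestronglyMeasurable
        (u.continuous_partialSum _).aestronglyMeasurable
        (by exact_mod_cast (show 1 ≤ p by omega))).trans (add_le_add ih ?_)
      refine (eLpNorm_partialSum_le (M := 2 ^ N) (by positivity)
        (fun k hk => le_abs_of_mem_dyadicBlock hk) (card_dyadicBlock_le N) hu hp).trans (le_of_eq ?_)
      rw [hq, ← inv_pow, Real.rpow_pow_comm (by norm_num)]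
  refine h.trans (add_le_add le_rfl (ENNReal.ofReal_le_ofReal ?_))
  exact hsum.sum_le_tsum _ fun j _ => by positivity

/-- The embedding of `H^{1/2}` into `L^p` for finite `p`. -/
theorem exists_eLpNorm_toL2_le (𝕜 : Type) [RCLike 𝕜] (n : ℕ) {p : ℕ} (hp : 2 ≤ p) :
    ∃ C : ENNReal, C ≠ ⊤ ∧ ∀ u : Sobolev 𝕜 n 1,
      eLpNorm (toL2 u : L2 𝕜 n) p circleMeasure ≤ C * ‖u‖ₑ := by
  obtain ⟨C, hC, h⟩ := exists_eLpNorm_partialSum_dyadicBall_le 𝕜 n hp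
  have h1 : ∀ u : Sobolev 𝕜 n 1, ‖u‖ ≤ 1 → eLpNorm (toL2 u : L2 𝕜 n) p circleMeasure ≤ C := by
    intro u hu
    -- The partial sums converge in L², so a subsequence converges almost everywhere, and Fatou's
    -- lemma carries the uniform L^p bound to the limit.
    obtain ⟨ns, -, hns⟩ := (tendstoInMeasure_of_tendsto_Lp
      ((hasSum_toL2 u).comp tendsto_dyadicBall)).exists_seq_tendsto_ae
    have hlim : ∀ᵐ t ∂circleMeasure, Filter.Tendsto
        (fun i => u.partialSum (dyadicBall (ns i)) t) Filter.atTop (nhds ((toL2 u : L2 𝕜 n) t)) := by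
      have hall : ∀ᵐ t ∂circleMeasure, ∀ i,
          ((∑ k ∈ dyadicBall (ns i), trigL2 k (u.coeff k) : L2 𝕜 n) : ℝ → Vec 𝕜 n) t
            = u.partialSum (dyadicBall (ns i)) t :=
        ae_all_iff.mpr fun i => coeFn_sum_trigL2 u _
      filter_upwards [hns, hall] with t h1 h2
      exact h1.congr fun i => h2 i
    refine (Lp.eLpNorm_lim_le_liminf_eLpNorm
      (fun i => (u.continuous_partialSum (dyadicBall (ns i))).aestronglyMeasurable) _ hlim).trans ?_
    exact Filter.liminf_le_of_frequently_le' (Filter.Frequently.of_forall fun i => h u hu _)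
  refine ⟨C, hC, fun u => ?_⟩
  rcases eq_or_ne u 0 with rfl | hu
  · rw [map_zero, eLpNorm_congr_ae (Lp.coeFn_zero _ _ _)]
    simp
  have hu' : ‖u‖ ≠ 0 := norm_ne_zero_iff.mpr hu
  set v : Sobolev 𝕜 n 1 := ((‖u‖⁻¹ : ℝ) : 𝕜) • u with hv
  have hvu : u = ((‖u‖ : ℝ) : 𝕜) • v := by
    rw [hv, smul_smul, ← RCLike.ofReal_mul, mul_inv_cancel₀ hu', RCLike.ofReal_one, one_smul]
  have hv1 : ‖v‖ ≤ 1 := by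
    rw [hv, norm_smul, RCLike.norm_ofReal, abs_inv, abs_norm, inv_mul_cancel₀ hu']
  have e : eLpNorm (toL2 u : L2 𝕜 n) p circleMeasure
      = ‖u‖ₑ * eLpNorm (toL2 v : L2 𝕜 n) p circleMeasure := by
    conv_lhs => rw [hvu, map_smul, eLpNorm_congr_ae (Lp.coeFn_smul _ _), eLpNorm_const_smul]
    congr 1
    rw [← ofReal_norm, RCLike.norm_ofReal, abs_norm, ofReal_norm]
  rw [e, mul_comm]
  exact mul_le_mul_left (h1 v hv1) _

theorem exists_integral_norm_pow_toL2_le (𝕜 : Type) [RCLike 𝕜] (n : ℕ) {p : ℕ} (hp : 2 ≤ p) :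
    ∃ K : ℝ, 0 ≤ K ∧ ∀ u : Sobolev 𝕜 n 1,
      Integrable (fun t => ‖(toL2 u : L2 𝕜 n) t‖ ^ p) circleMeasure ∧
      ∫ t, ‖(toL2 u : L2 𝕜 n) t‖ ^ p ∂circleMeasure ≤ (K * ‖u‖) ^ p := by
  obtain ⟨C, hC, h⟩ := exists_eLpNorm_toL2_le 𝕜 n hp
  have hp0 : p ≠ 0 := by omega
  refine ⟨C.toReal, ENNReal.toReal_nonneg, fun u => ?_⟩
  have hmem : MemLp (toL2 u : L2 𝕜 n) p circleMeasure :=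
    ⟨Lp.aestronglyMeasurable _, (h u).trans_lt (ENNReal.mul_lt_top hC.lt_top (by simp))⟩
  refine ⟨hmem.integrable_norm_pow hp0, ?_⟩
  have h1 := h u
  have hI : 0 ≤ ∫ t, ‖(toL2 u : L2 𝕜 n) t‖ ^ p ∂circleMeasure :=
    integral_nonneg fun t => by positivity
  rw [hmem.eLpNorm_eq_integral_rpow_norm (by exact_mod_cast hp0) (ENNReal.natCast_ne_top p),
    ENNReal.toReal_natCast, ← ENNReal.ofReal_toReal hC, ← ofReal_norm,
    ← ENNReal.ofReal_mul ENNReal.toReal_nonneg, ENNReal.ofReal_le_ofReal_iff (by positivity)] at h1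
  simp only [Real.rpow_natCast] at h1
  rw [Real.rpow_inv_le_iff_of_pos hI (by positivity) (by positivity), Real.rpow_natCast] at h1
  exact h1

end Embedding

/-! ### Pointwise Taylor estimates for Hamiltonians of polynomial growth. -/

section Growth

variable {n : ℕ}

/-- A `C²` Hamiltonian for which `0` is an equilibrium and the Hessian in the space variable has
polynomial growth. -/
structure HasGrowth (h : ℝ → Vec ℝ n → ℝ) (a b : ℝ) (R : ℕ) : Prop where
  contDiff : ContDiff ℝ 2 fun p : ℝ × Vec ℝ n => h p.1 p.2
  gradient_zero : ∀ t, gradient (h t) 0 = 0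
  nonneg_left : 0 ≤ a
  nonneg_right : 0 ≤ b
  one_le : 1 ≤ R
  norm_le : ∀ t v, ‖fderiv ℝ (gradient (h t)) v‖ ≤ a + b * ‖v‖ ^ R

variable {h : ℝ → Vec ℝ n → ℝ} {a b : ℝ} {R : ℕ}

namespace HasGrowth

theorem hasFDerivAt (hh : HasGrowth h a b R) (t : ℝ) (v : Vec ℝ n) : HasFDerivAt (h t)
    ((fderiv ℝ (fun p : ℝ × Vec ℝ n => h p.1 p.2) (t, v)).comp
      (ContinuousLinearMap.inr ℝ ℝ (Vec ℝ n))) v :=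
  (hh.contDiff.differentiable two_ne_zero (t, v)).hasFDerivAt.comp v
    (hasFDerivAt_prodMk_right t v)

theorem contDiff_gradient (hh : HasGrowth h a b R) :
    ContDiff ℝ 1 fun p : ℝ × Vec ℝ n => gradient (h p.1) p.2 := by
  have e : (fun p : ℝ × Vec ℝ n => gradient (h p.1) p.2) = fun p =>
      (InnerProductSpace.toDual ℝ (Vec ℝ n)).symm
        ((fderiv ℝ (fun p : ℝ × Vec ℝ n => h p.1 p.2) p).comp
          (ContinuousLinearMap.inr ℝ ℝ (Vec ℝ n))) := by
    funext p
    rw [gradient, (hh.hasFDerivAt p.1 p.2).fderiv]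
  rw [e]
  have h1 : ContDiff ℝ 1 (fderiv ℝ fun p : ℝ × Vec ℝ n => h p.1 p.2) :=
    hh.contDiff.fderiv_right (by norm_num)
  exact (InnerProductSpace.toDual ℝ (Vec ℝ n)).symm.contDiff.comp
    (h1.clm_comp contDiff_const)

theorem continuous_gradient (hh : HasGrowth h a b R) :
    Continuous fun p : ℝ × Vec ℝ n => gradient (h p.1) p.2 :=
  hh.contDiff_gradient.continuous

theorem hasFDerivAt_gradient' (hh : HasGrowth h a b R) (t : ℝ) (v : Vec ℝ n) :
    HasFDerivAt (gradient (h t))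
      ((fderiv ℝ (fun p : ℝ × Vec ℝ n => gradient (h p.1) p.2) (t, v)).comp
        (ContinuousLinearMap.inr ℝ ℝ (Vec ℝ n))) v :=
  (hh.contDiff_gradient.differentiable one_ne_zero (t, v)).hasFDerivAt.comp v
    (hasFDerivAt_prodMk_right t v)

theorem hasFDerivAt_gradient (hh : HasGrowth h a b R) (t : ℝ) (v : Vec ℝ n) :
    HasFDerivAt (gradient (h t)) (fderiv ℝ (gradient (h t)) v) v :=
  (hh.hasFDerivAt_gradient' t v).differentiableAt.hasFDerivAt

theorem continuous_fderiv_gradient (hh : HasGrowth h a b R) :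
    Continuous fun p : ℝ × Vec ℝ n => fderiv ℝ (gradient (h p.1)) p.2 := by
  have e : (fun p : ℝ × Vec ℝ n => fderiv ℝ (gradient (h p.1)) p.2) = fun p =>
      (fderiv ℝ (fun p : ℝ × Vec ℝ n => gradient (h p.1) p.2) p).comp
        (ContinuousLinearMap.inr ℝ ℝ (Vec ℝ n)) := by
    funext p
    rw [(hh.hasFDerivAt_gradient' p.1 p.2).fderiv]
  rw [e]
  exact (hh.contDiff_gradient.continuous_fderiv one_ne_zero).clm_comp continuous_const

theorem hasGradientAt (hh : HasGrowth h a b R) (t : ℝ) (v : Vec ℝ n) :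
    HasGradientAt (h t) (gradient (h t) v) v :=
  (hh.hasFDerivAt t v).differentiableAt.hasGradientAt

/-- Mean value inequality on the ball of radius ρ about `v`, where the Hessian is bounded by its
growth at |v| + ρ. -/
theorem norm_gradient_sub_le (hh : HasGrowth h a b R) (t : ℝ) (v : Vec ℝ n) {ρ : ℝ}
    {y : Vec ℝ n} (hy : ‖y - v‖ ≤ ρ) :
    ‖gradient (h t) y - gradient (h t) v‖ ≤ (a + b * (‖v‖ + ρ) ^ R) * ‖y - v‖ := by
  refine (convex_closedBall v ρ).norm_image_sub_le_of_norm_hasFDerivWithin_le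
    (fun z _ => (hh.hasFDerivAt_gradient t z).hasFDerivWithinAt) (fun z hz => ?_)
    (Metric.mem_closedBall_self ((norm_nonneg _).trans hy)) (mem_closedBall_iff_norm.mpr hy)
  refine (hh.norm_le t z).trans ?_
  have hz' : ‖z‖ ≤ ‖v‖ + ρ := by
    have h1 := mem_closedBall_iff_norm.mp hz
    have h2 := norm_add_le v (z - v)
    rw [add_sub_cancel] at h2
    linarith
  have := hh.nonneg_right
  gcongr

theorem norm_gradient_le (hh : HasGrowth h a b R) (t : ℝ) (v : Vec ℝ n) :
    ‖gradient (h t) v‖ ≤ (a + b * ‖v‖ ^ R) * ‖v‖ := by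
  have := hh.norm_gradient_sub_le t 0 (ρ := ‖v‖) (y := v) (by rw [sub_zero])
  simpa [hh.gradient_zero] using this

/-- Mean value inequality for y ↦ h(y) - ⟨∇h(v), y⟩, whose gradient is already controlled by
`norm_gradient_sub_le`. -/
theorem abs_remainder_le (hh : HasGrowth h a b R) (t : ℝ) (v w : Vec ℝ n) :
    |h t (v + w) - h t v - inner ℝ (gradient (h t) v) w|
      ≤ (a + b * (‖v‖ + ‖w‖) ^ R) * ‖w‖ ^ 2 := by
  have hab : 0 ≤ a + b * (‖v‖ + ‖w‖) ^ R := by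
    have := hh.nonneg_right
    have := hh.nonneg_left
    positivity
  have h1 : ∀ y, HasFDerivAt (fun y => h t y - inner ℝ (gradient (h t) v) y)
      (innerSL ℝ (gradient (h t) y - gradient (h t) v)) y := fun y => by
    rw [map_sub]
    exact (hh.hasGradientAt t y).hasFDerivAt.sub (innerSL ℝ (gradient (h t) v)).hasFDerivAt
  have h2 := (convex_closedBall v ‖w‖).norm_image_sub_le_of_norm_hasFDerivWithin_le
    (C := (a + b * (‖v‖ + ‖w‖) ^ R) * ‖w‖)
    (fun y _ => (h1 y).hasFDerivWithinAt) (fun y hy => ?_)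
    (Metric.mem_closedBall_self (norm_nonneg w))
    (mem_closedBall_iff_norm.mpr (by rw [add_sub_cancel_left] : ‖v + w - v‖ ≤ ‖w‖))
  · rw [Real.norm_eq_abs, inner_add_right, add_sub_cancel_left, mul_assoc, ← pow_two] at h2
    convert h2 using 2
    ring
  · rw [innerSL_apply_norm]
    have hy' := mem_closedBall_iff_norm.mp hy
    exact (hh.norm_gradient_sub_le t v hy').trans (mul_le_mul_of_nonneg_left hy' hab)

theorem abs_apply_le (hh : HasGrowth h a b R) (t : ℝ) (v : Vec ℝ n) :
    |h t v| ≤ |h t 0| + (a * ‖v‖ ^ 2 + b * ‖v‖ ^ (R + 2)) := by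
  have h1 := hh.abs_remainder_le t 0 v
  rw [zero_add, hh.gradient_zero, inner_zero_left, sub_zero, norm_zero, zero_add] at h1
  have h2 := abs_sub_abs_le_abs_sub (h t v) (h t 0)
  have h3 : (a + b * ‖v‖ ^ R) * ‖v‖ ^ 2 = a * ‖v‖ ^ 2 + b * ‖v‖ ^ (R + 2) := by ring
  linarith

/-- The gradient is differentiable at `0`, uniformly in time. -/
theorem exists_norm_gradient_sub_le (hh : HasGrowth h a b R) {ε : ℝ} (hε : 0 < ε) :
    ∃ c, 0 ≤ c ∧ ∀ t ∈ Set.Icc 0 (2 * Real.pi), ∀ v,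
      ‖gradient (h t) v - fderiv ℝ (gradient (h t)) 0 v‖
        ≤ ε * ‖v‖ + c * ‖v‖ ^ 2 + b * ‖v‖ ^ (R + 1) := by
  have hopen : IsOpen {p : ℝ × Vec ℝ n |
      ‖fderiv ℝ (gradient (h p.1)) p.2 - fderiv ℝ (gradient (h p.1)) 0‖ < ε} := by
    have h1 := hh.continuous_fderiv_gradient
    have h2 : Continuous fun p : ℝ × Vec ℝ n => fderiv ℝ (gradient (h p.1)) 0 :=
      h1.comp (continuous_fst.prodMk continuous_const)
    exact isOpen_lt (h1.sub h2).norm continuous_const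
  -- The tube lemma over the compact period yields one δ such that the Hessian moves by less than ε
  -- on |v| < δ at all times.
  obtain ⟨U, V, -, hV, hU0, hV0, hUV⟩ := generalized_tube_lemma
    (isCompact_Icc (a := (0 : ℝ)) (b := 2 * Real.pi)) (isCompact_singleton (x := (0 : Vec ℝ n)))
    hopen (by
      rintro ⟨t, v⟩ ⟨-, rfl : v = 0⟩
      simpa using hε)
  obtain ⟨δ, hδ, hδV⟩ := Metric.isOpen_iff.mp hV 0 (hV0 rfl)
  have ha := hh.nonneg_left
  have hb := hh.nonneg_right
  -- For |v| ≥ δ the linear bounds on gradient and Hessian add up to 2a|v| ≤ (2a/δ)|v|²; this is the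
  -- origin of the quadratic term.
  refine ⟨2 * a / δ, by positivity, fun t ht v => ?_⟩
  rcases lt_or_ge ‖v‖ δ with hv | hv
  · have h1 := (convex_ball (0 : Vec ℝ n) δ).norm_image_sub_le_of_norm_hasFDerivWithin_le (C := ε)
      (f := fun y => gradient (h t) y - fderiv ℝ (gradient (h t)) 0 y)
      (fun y _ => ((hh.hasFDerivAt_gradient t y).sub
        (fderiv ℝ (gradient (h t)) 0).hasFDerivAt).hasFDerivWithinAt)
      (fun y hy => (hUV (Set.mk_mem_prod (hU0 ht) (hδV hy))).le)
      (Metric.mem_ball_self hδ) (mem_ball_zero_iff.mpr hv)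
    simp only [map_zero, hh.gradient_zero, sub_zero] at h1
    refine h1.trans ?_
    rw [add_assoc]
    exact le_add_of_nonneg_right (by positivity)
  · have h1 := hh.norm_gradient_le t v
    have h2 : ‖fderiv ℝ (gradient (h t)) 0 v‖ ≤ a * ‖v‖ := by
      refine ContinuousLinearMap.le_of_opNorm_le _ ((hh.norm_le t 0).trans ?_) v
      have : R ≠ 0 := by have := hh.one_le; omega
      simp [this]
    have h3 := norm_sub_le (gradient (h t) v) (fderiv ℝ (gradient (h t)) 0 v)
    have h4 : 2 * a * ‖v‖ ≤ 2 * a / δ * ‖v‖ ^ 2 := by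
      rw [div_mul_eq_mul_div, le_div_iff₀ hδ]
      have : ‖v‖ * δ ≤ ‖v‖ ^ 2 := by
        rw [pow_two]
        exact mul_le_mul_of_nonneg_left hv (norm_nonneg v)
      nlinarith
    have h5 : (a + b * ‖v‖ ^ R) * ‖v‖ = a * ‖v‖ + b * ‖v‖ ^ (R + 1) := by ring
    have h6 : 0 ≤ ε * ‖v‖ := by positivity
    linarith

end HasGrowth

end Growth

/-! ### Differentiability of the action on H^{1/2}. -/

section Action

open Sobolev

variable {n : ℕ} {h : ℝ → Vec ℝ n → ℝ} {a b : ℝ} {R : ℕ}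

theorem HasGrowth.aestronglyMeasurable (hh : HasGrowth h a b R) (f : L2 ℝ n) :
    AEStronglyMeasurable (fun t => h t (f t)) circleMeasure :=
  hh.contDiff.continuous.comp_aestronglyMeasurable
    (continuous_id.aestronglyMeasurable.prodMk (Lp.aestronglyMeasurable f))

theorem HasGrowth.aestronglyMeasurable_gradient (hh : HasGrowth h a b R) (f : L2 ℝ n) :
    AEStronglyMeasurable (fun t => gradient (h t) (f t)) circleMeasure :=
  hh.continuous_gradient.comp_aestronglyMeasurable
    (continuous_id.aestronglyMeasurable.prodMk (Lp.aestronglyMeasurable f))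

theorem integrable_norm_pow_toL2 {p : ℕ} (hp : 2 ≤ p) (u : Sobolev ℝ n 1) :
    Integrable (fun t => ‖(toL2 u : L2 ℝ n) t‖ ^ p) circleMeasure := by
  obtain ⟨K, -, hK⟩ := exists_integral_norm_pow_toL2_le ℝ n hp
  exact (hK u).1

theorem HasGrowth.integrable (hh : HasGrowth h a b R) (u : Sobolev ℝ n 1) :
    Integrable (fun t => h t ((toL2 u : L2 ℝ n) t)) circleMeasure := by
  have h0 : Continuous fun t => |h t 0| :=
    (hh.contDiff.continuous.comp (continuous_id.prodMk continuous_const)).abs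
  have h1 : Integrable (fun t => |h t 0|) circleMeasure :=
    (h0.integrableOn_Icc (a := 0) (b := 2 * Real.pi)).mono_set Set.Ioc_subset_Icc_self
  have h2 := integrable_norm_pow_toL2 le_rfl u
  have h3 := integrable_norm_pow_toL2 (Nat.le_add_left 2 R) u
  refine Integrable.mono' (h1.add ((h2.const_mul a).add (h3.const_mul b)))
    (hh.aestronglyMeasurable _) (Filter.Eventually.of_forall fun t => hh.abs_apply_le t _)

/-- The gradient grows like |v|^{R+1}, so u in L^{2(R+1)} suffices; H^{1/2} embeds there. -/
theorem HasGrowth.memLp_gradient (hh : HasGrowth h a b R) (u : Sobolev ℝ n 1) :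
    MemLp (fun t => gradient (h t) ((toL2 u : L2 ℝ n) t)) 2 circleMeasure := by
  have h2 := integrable_norm_pow_toL2 le_rfl u
  have h3 := integrable_norm_pow_toL2 (p := 2 * (R + 1)) (by omega) u
  refine (memLp_two_iff_integrable_sq_norm (hh.aestronglyMeasurable_gradient _)).mpr ?_
  refine Integrable.mono' ((h2.const_mul (2 * a ^ 2)).add (h3.const_mul (2 * b ^ 2)))
    ((hh.aestronglyMeasurable_gradient _).norm.pow 2) (Filter.Eventually.of_forall fun t => ?_)
  rw [Real.norm_eq_abs, abs_of_nonneg (by positivity)]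
  set x := (toL2 u : L2 ℝ n) t
  refine (pow_le_pow_left₀ (norm_nonneg _) (hh.norm_gradient_le t x) 2).trans ?_
  have e : ((a + b * ‖x‖ ^ R) * ‖x‖) ^ 2 = (a * ‖x‖ + b * ‖x‖ ^ (R + 1)) ^ 2 := by ring
  have e2 : ‖x‖ ^ (2 * (R + 1)) = (‖x‖ ^ (R + 1)) ^ 2 := by rw [mul_comm, pow_mul]
  rw [e, Pi.add_apply, e2]
  nlinarith [sq_nonneg (a * ‖x‖ - b * ‖x‖ ^ (R + 1))]

/-- The superposition operator `u ↦ ∇h(t, u(t))` from `H^{1/2}` to `L²`. -/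
def HasGrowth.superposition (hh : HasGrowth h a b R) (u : Sobolev ℝ n 1) : L2 ℝ n :=
  (hh.memLp_gradient u).toLp _

theorem HasGrowth.coeFn_superposition (hh : HasGrowth h a b R) (u : Sobolev ℝ n 1) :
    hh.superposition u =ᵐ[circleMeasure] fun t => gradient (h t) ((toL2 u : L2 ℝ n) t) :=
  (hh.memLp_gradient u).coeFn_toLp

/-- The pointwise second order Taylor bound, integrated with the L^p embeddings; a quadratic
remainder proves differentiability at every u. -/
theorem HasGrowth.exists_remainder_le (hh : HasGrowth h a b R) (u : Sobolev ℝ n 1) :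
    ∃ C, ∀ v : Sobolev ℝ n 1, ‖v‖ ≤ 1 →
      |∫ t, h t ((toL2 (u + v) : L2 ℝ n) t) ∂circleMeasure
        - ∫ t, h t ((toL2 u : L2 ℝ n) t) ∂circleMeasure
        - inner ℝ (fromL2 (hh.superposition u)) v| ≤ C * ‖v‖ ^ 2 := by
  have hR := hh.one_le
  have ha := hh.nonneg_left
  have hb := hh.nonneg_right
  obtain ⟨K₂, hK₂0, hK₂⟩ := exists_integral_norm_pow_toL2_le ℝ n (le_refl 2)
  obtain ⟨K₄, hK₄0, hK₄⟩ := exists_integral_norm_pow_toL2_le ℝ n (p := 4) (by norm_num)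
  obtain ⟨K, hK0, hK⟩ := exists_integral_norm_pow_toL2_le ℝ n (p := R + 2) (by omega)
  have hu := integrable_norm_pow_toL2 (p := 2 * R) (by omega) u
  set A := ∫ t, ‖(toL2 u : L2 ℝ n) t‖ ^ (2 * R) ∂circleMeasure with hA
  have hA0 : 0 ≤ A := integral_nonneg fun t => by positivity
  refine ⟨a * K₂ ^ 2 + b * 2 ^ R * (A + K₄ ^ 4 + K ^ (R + 2)), fun v hv => ?_⟩
  rcases eq_or_ne v 0 with rfl | hv0
  · simp
  have hδ : 0 < ‖v‖ := norm_pos_iff.mpr hv0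
  have hin : inner ℝ (fromL2 (hh.superposition u)) v
      = ∫ t, inner ℝ (gradient (h t) ((toL2 u : L2 ℝ n) t)) ((toL2 v : L2 ℝ n) t)
        ∂circleMeasure := by
    rw [real_inner_comm, inner_fromL2, real_inner_comm, L2.inner_def]
    refine integral_congr_ae ?_
    filter_upwards [hh.coeFn_superposition u] with t ht
    rw [ht]
  have hint : Integrable (fun t => inner ℝ (gradient (h t) ((toL2 u : L2 ℝ n) t))
      ((toL2 v : L2 ℝ n) t)) circleMeasure := by
    refine (L2.integrable_inner (𝕜 := ℝ) (hh.superposition u) (toL2 v)).congr ?_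
    filter_upwards [hh.coeFn_superposition u] with t ht
    rw [ht]
  have hsub : Integrable (fun t => h t ((toL2 (u + v) : L2 ℝ n) t) - h t ((toL2 u : L2 ℝ n) t))
      circleMeasure := (hh.integrable _).sub (hh.integrable _)
  rw [hin, ← integral_sub (hh.integrable _) (hh.integrable _), ← integral_sub hsub hint]
  refine (abs_integral_le_integral_abs).trans ?_
  let g : ℝ → ℝ := fun t => a * ‖(toL2 v : L2 ℝ n) t‖ ^ 2 + b * 2 ^ R *
    (‖v‖ ^ 2 * ‖(toL2 u : L2 ℝ n) t‖ ^ (2 * R) + (‖v‖ ^ 2)⁻¹ * ‖(toL2 v : L2 ℝ n) t‖ ^ 4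
      + ‖(toL2 v : L2 ℝ n) t‖ ^ (R + 2))
  have hg2 := ((hK₂ v).1.const_mul a)
  have hg3 : Integrable (fun t => ‖v‖ ^ 2 * ‖(toL2 u : L2 ℝ n) t‖ ^ (2 * R)
      + (‖v‖ ^ 2)⁻¹ * ‖(toL2 v : L2 ℝ n) t‖ ^ 4) circleMeasure :=
    (hu.const_mul (‖v‖ ^ 2)).add ((hK₄ v).1.const_mul (‖v‖ ^ 2)⁻¹)
  have hg4 : Integrable (fun t => b * 2 ^ R * (‖v‖ ^ 2 * ‖(toL2 u : L2 ℝ n) t‖ ^ (2 * R)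
      + (‖v‖ ^ 2)⁻¹ * ‖(toL2 v : L2 ℝ n) t‖ ^ 4 + ‖(toL2 v : L2 ℝ n) t‖ ^ (R + 2)))
      circleMeasure := (hg3.add (hK v).1).const_mul (b * 2 ^ R)
  have hle : ∫ t, |h t ((toL2 (u + v) : L2 ℝ n) t) - h t ((toL2 u : L2 ℝ n) t)
      - inner ℝ (gradient (h t) ((toL2 u : L2 ℝ n) t)) ((toL2 v : L2 ℝ n) t)| ∂circleMeasure
      ≤ ∫ t, g t ∂circleMeasure := by
    refine integral_mono_ae (hsub.sub hint).abs
      (hg2.add hg4) ?_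
    filter_upwards [Lp.coeFn_add (toL2 u : L2 ℝ n) (toL2 v)] with t ht
    rw [map_add, ht, Pi.add_apply]
    refine (hh.abs_remainder_le t _ _).trans ?_
    set x := ‖(toL2 u : L2 ℝ n) t‖
    set y := ‖(toL2 v : L2 ℝ n) t‖
    have hx : 0 ≤ x := norm_nonneg _
    have hy : 0 ≤ y := norm_nonneg _
    have h1 : (x + y) ^ R ≤ 2 ^ R * (x ^ R + y ^ R) := by
      refine (add_pow_le hx hy R).trans (mul_le_mul_of_nonneg_right
        (pow_le_pow_right₀ one_le_two (Nat.sub_le R 1)) (by positivity))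
    -- The factors ‖v‖² and ‖v‖⁻² balance the mixed term in place of Hölder's inequality: the
    -- integral of y⁴ is of order ‖v‖⁴, so both summands become of order ‖v‖².
    have h2 : x ^ R * y ^ 2 ≤ ‖v‖ ^ 2 * x ^ (2 * R) + (‖v‖ ^ 2)⁻¹ * y ^ 4 := by
      have e1 : x ^ (2 * R) = (x ^ R) ^ 2 := by rw [mul_comm, pow_mul]
      have e2 : ‖v‖ ^ 2 * x ^ (2 * R) + (‖v‖ ^ 2)⁻¹ * y ^ 4
          = (‖v‖ * x ^ R) ^ 2 + (‖v‖⁻¹ * y ^ 2) ^ 2 := by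
        rw [e1]
        ring
      have e3 : (‖v‖ * x ^ R) * (‖v‖⁻¹ * y ^ 2) = x ^ R * y ^ 2 := by
        field_simp
      rw [e2, ← e3]
      nlinarith [sq_nonneg (‖v‖ * x ^ R - ‖v‖⁻¹ * y ^ 2), sq_nonneg (‖v‖ * x ^ R),
        sq_nonneg (‖v‖⁻¹ * y ^ 2)]
    calc (a + b * (x + y) ^ R) * y ^ 2 ≤ (a + b * (2 ^ R * (x ^ R + y ^ R))) * y ^ 2 := by gcongr
      _ = a * y ^ 2 + b * 2 ^ R * (x ^ R * y ^ 2 + y ^ (R + 2)) := by ring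
      _ ≤ a * y ^ 2 + b * 2 ^ R * (‖v‖ ^ 2 * x ^ (2 * R) + (‖v‖ ^ 2)⁻¹ * y ^ 4 + y ^ (R + 2)) := by
        gcongr
  refine hle.trans ?_
  have hgi : ∫ t, g t ∂circleMeasure = a * ∫ t, ‖(toL2 v : L2 ℝ n) t‖ ^ 2 ∂circleMeasure
      + b * 2 ^ R * (‖v‖ ^ 2 * A + (‖v‖ ^ 2)⁻¹ * ∫ t, ‖(toL2 v : L2 ℝ n) t‖ ^ 4 ∂circleMeasure
        + ∫ t, ‖(toL2 v : L2 ℝ n) t‖ ^ (R + 2) ∂circleMeasure) := by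
    rw [← integral_const_mul, hA, ← integral_const_mul, ← integral_const_mul,
      ← integral_add (hu.const_mul _) ((hK₄ v).1.const_mul _),
      ← integral_add hg3 (hK v).1, ← integral_const_mul, ← integral_add hg2 hg4]
  rw [hgi]
  have f2 := (hK₂ v).2
  have f4 : (‖v‖ ^ 2)⁻¹ * ∫ t, ‖(toL2 v : L2 ℝ n) t‖ ^ 4 ∂circleMeasure ≤ K₄ ^ 4 * ‖v‖ ^ 2 := by
    rw [inv_mul_le_iff₀ (by positivity)]
    refine (hK₄ v).2.trans (le_of_eq (by ring))
  have fR : ∫ t, ‖(toL2 v : L2 ℝ n) t‖ ^ (R + 2) ∂circleMeasure ≤ K ^ (R + 2) * ‖v‖ ^ 2 := by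
    refine (hK v).2.trans ?_
    rw [mul_pow]
    exact mul_le_mul_of_nonneg_left (pow_le_pow_of_le_one hδ.le hv (by omega)) (by positivity)
  calc _ ≤ a * (K₂ * ‖v‖) ^ 2 + b * 2 ^ R * (‖v‖ ^ 2 * A + K₄ ^ 4 * ‖v‖ ^ 2
        + K ^ (R + 2) * ‖v‖ ^ 2) := by gcongr
    _ = _ := by ring

theorem HasGrowth.hasGradientAt_integral (hh : HasGrowth h a b R) (u : Sobolev ℝ n 1) :
    HasGradientAt (fun u : Sobolev ℝ n 1 => ∫ t, h t ((toL2 u : L2 ℝ n) t) ∂circleMeasure)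
      (fromL2 (hh.superposition u)) u := by
  obtain ⟨C, hC⟩ := hh.exists_remainder_le u
  rw [hasGradientAt_iff_hasFDerivAt, hasFDerivAt_iff_isLittleO_nhds_zero]
  refine Asymptotics.IsBigO.trans_isLittleO (g := fun v : Sobolev ℝ n 1 => ‖v‖ ^ 2) ?_
    (Asymptotics.isLittleO_norm_pow_id one_lt_two)
  refine Asymptotics.IsBigO.of_bound C ?_
  filter_upwards [Metric.closedBall_mem_nhds (0 : Sobolev ℝ n 1) one_pos] with v hv
  rw [mem_closedBall_zero_iff] at hv
  rw [Real.norm_eq_abs, norm_pow, norm_norm, InnerProductSpace.toDual_apply_apply]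
  exact hC v hv

theorem norm_sq_eq_integral (f : L2 ℝ n) : ‖f‖ ^ 2 = ∫ t, ‖f t‖ ^ 2 ∂circleMeasure := by
  rw [← real_inner_self_eq_norm_sq, L2.inner_def]
  simp only [real_inner_self_eq_norm_sq]

/-- The uniform estimate of the gradient near 0 is squared and integrated. Its higher order terms
become o(‖v‖²) by the embeddings into L⁴ and L^{2(R+1)}, so no continuity of the superposition
operator is needed. -/
theorem HasGrowth.hasFDerivAt_superposition (hh : HasGrowth h a b R) (Φ : LoopOp ℝ n)
    (hΦ : ∀ t ∈ Set.Icc 0 (2 * Real.pi), Φ.extend t = fderiv ℝ (gradient (h t)) 0) :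
    HasFDerivAt hh.superposition (mulL2 Φ ∘L toL2) 0 := by
  have h0 : hh.superposition 0 = 0 := by
    refine (Lp.eq_zero_iff_ae_eq_zero).mpr ?_
    filter_upwards [hh.coeFn_superposition 0,
      Lp.coeFn_zero (Vec ℝ n) 2 circleMeasure] with t ht ht0
    rw [ht, map_zero, ht0, Pi.zero_apply, hh.gradient_zero]
  rw [hasFDerivAt_iff_isLittleO_nhds_zero, Asymptotics.isLittleO_iff]
  intro ε hε
  obtain ⟨K₂, hK₂0, hK₂⟩ := exists_integral_norm_pow_toL2_le ℝ n (le_refl 2)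
  obtain ⟨K₄, hK₄0, hK₄⟩ := exists_integral_norm_pow_toL2_le ℝ n (p := 4) (by norm_num)
  obtain ⟨K, hK0, hK⟩ := exists_integral_norm_pow_toL2_le ℝ n (p := 2 * (R + 1)) (by omega)
  have hη : 0 < ε / (3 * (K₂ + 1)) := by positivity
  obtain ⟨c, hc0, hc⟩ := hh.exists_norm_gradient_sub_le hη
  set η := ε / (3 * (K₂ + 1)) with hηdef
  -- The factor 3 comes from (x + y + z)² ≤ 3(x² + y² + z²). The denominator of η has `K₂ + 1`
  -- because `K₂` may be 0.
  have hηK : 3 * (η * K₂) ^ 2 ≤ ε ^ 2 / 3 := by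
    have h1 : η * K₂ ≤ ε / 3 := by
      rw [hηdef, div_mul_eq_mul_div, div_le_div_iff₀ (by positivity) (by norm_num)]
      nlinarith
    have h2 : 0 ≤ η * K₂ := by positivity
    nlinarith
  set C := 3 * (c ^ 2 * K₄ ^ 4 + b ^ 2 * K ^ (2 * (R + 1))) with hC
  have hC0 : 0 ≤ C := by positivity
  have hsmall : ∀ᶠ v : Sobolev ℝ n 1 in nhds 0, ‖v‖ ≤ 1 ∧ C * ‖v‖ ^ 2 < ε ^ 2 / 3 := by
    have h1 : ∀ᶠ v : Sobolev ℝ n 1 in nhds 0, ‖v‖ ≤ 1 := by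
      filter_upwards [Metric.closedBall_mem_nhds (0 : Sobolev ℝ n 1) one_pos] with v hv
      rwa [mem_closedBall_zero_iff] at hv
    refine h1.and ?_
    have h2 : Continuous fun v : Sobolev ℝ n 1 => C * ‖v‖ ^ 2 := by fun_prop
    refine (h2.tendsto 0).eventually_lt_const ?_
    simp only [norm_zero, ne_eq, OfNat.ofNat_ne_zero, not_false_eq_true, zero_pow, mul_zero]
    positivity
  filter_upwards [hsmall] with v hv
  rw [zero_add, h0, sub_zero, ContinuousLinearMap.comp_apply]
  refine (abs_le_of_sq_le_sq' ?_ (by positivity)).2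
  rw [norm_sq_eq_integral]
  have i2 := (hK₂ v).1.const_mul (3 * η ^ 2)
  have i4 := (hK₄ v).1.const_mul (3 * c ^ 2)
  have iR := (hK v).1.const_mul (3 * b ^ 2)
  have hle : ∫ t, ‖(hh.superposition v - mulL2 Φ (toL2 v) : L2 ℝ n) t‖ ^ 2 ∂circleMeasure
      ≤ ∫ t, (3 * η ^ 2 * ‖(toL2 v : L2 ℝ n) t‖ ^ 2 + 3 * c ^ 2 * ‖(toL2 v : L2 ℝ n) t‖ ^ 4
        + 3 * b ^ 2 * ‖(toL2 v : L2 ℝ n) t‖ ^ (2 * (R + 1))) ∂circleMeasure := by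
    refine integral_mono_ae ?_ ((i2.add i4).add iR :) ?_
    · exact (Lp.memLp (hh.superposition v - mulL2 Φ (toL2 v))).integrable_norm_pow (by norm_num)
    filter_upwards [Lp.coeFn_sub (hh.superposition v) (mulL2 Φ (toL2 v)),
      hh.coeFn_superposition v, coeFn_mulL2 Φ (toL2 v),
      ae_restrict_mem measurableSet_Ioc] with t h1 h2 h3 ht
    have ht' := Set.Ioc_subset_Icc_self ht
    rw [h1, Pi.sub_apply, h2, h3, hΦ t ht']
    refine (pow_le_pow_left₀ (norm_nonneg _) (hc t ht' _) 2).trans ?_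
    set x := ‖(toL2 v : L2 ℝ n) t‖
    have e1 : x ^ 4 = (x ^ 2) ^ 2 := by ring
    have e2 : x ^ (2 * (R + 1)) = (x ^ (R + 1)) ^ 2 := by rw [mul_comm, pow_mul]
    rw [e1, e2]
    nlinarith [sq_nonneg (η * x - c * x ^ 2), sq_nonneg (η * x - b * x ^ (R + 1)),
      sq_nonneg (c * x ^ 2 - b * x ^ (R + 1))]
  refine hle.trans ?_
  have i24 : Integrable (fun t => 3 * η ^ 2 * ‖(toL2 v : L2 ℝ n) t‖ ^ 2
      + 3 * c ^ 2 * ‖(toL2 v : L2 ℝ n) t‖ ^ 4) circleMeasure := i2.add i4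
  rw [integral_add i24 iR, integral_add i2 i4, integral_const_mul, integral_const_mul,
    integral_const_mul]
  have f2 := (hK₂ v).2
  have f4 : ∫ t, ‖(toL2 v : L2 ℝ n) t‖ ^ 4 ∂circleMeasure ≤ K₄ ^ 4 * ‖v‖ ^ 4 :=
    (hK₄ v).2.trans (le_of_eq (by ring))
  have fR : ∫ t, ‖(toL2 v : L2 ℝ n) t‖ ^ (2 * (R + 1)) ∂circleMeasure
      ≤ K ^ (2 * (R + 1)) * ‖v‖ ^ 4 := by
    refine (hK v).2.trans ?_
    rw [mul_pow]
    have hR := hh.one_le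
    exact mul_le_mul_of_nonneg_left (pow_le_pow_of_le_one (norm_nonneg v) hv.1 (by omega))
      (by positivity)
  calc _ ≤ 3 * η ^ 2 * (K₂ * ‖v‖) ^ 2 + 3 * c ^ 2 * (K₄ ^ 4 * ‖v‖ ^ 4)
        + 3 * b ^ 2 * (K ^ (2 * (R + 1)) * ‖v‖ ^ 4) := by gcongr
    _ = (3 * (η * K₂) ^ 2 + C * ‖v‖ ^ 2) * ‖v‖ ^ 2 := by rw [hC]; ring
    _ ≤ (ε ^ 2 / 3 + ε ^ 2 / 3) * ‖v‖ ^ 2 := by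
      refine mul_le_mul_of_nonneg_right (add_le_add hηK hv.2.le) (by positivity)
    _ ≤ (ε * ‖v‖) ^ 2 := by nlinarith [sq_nonneg (ε * ‖v‖)]

end Action

/-! ### The orthogonal projections onto E₊ and E₋. -/

section Projections

open Sobolev

variable {n : ℕ}

/-- The operator `P₊ - P₋`. -/
def projDiff : Sobolev ℝ n 1 →L[ℝ] Sobolev ℝ n 1 := signOp - meanL

theorem coeff_projDiff (u : Sobolev ℝ n 1) (k : ℤ) : (projDiff u).coeff k
    = ((SignType.sign k : ℤ) : ℝ) • Jop (u.coeff (-k)) := by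
  rw [projDiff, _root_.sub_apply, coeff_sub, coeff_signOp, coeff_meanL]
  split_ifs with hk
  · simp [hk]
  · simp

theorem inner_projDiff (u v : Sobolev ℝ n 1) :
    inner ℝ (projDiff u) v = inner ℝ u (projDiff v) := by
  simp only [projDiff, _root_.sub_apply, inner_sub_left, inner_sub_right, inner_signOp, inner_meanL]

theorem projDiff_projDiff (u : Sobolev ℝ n 1) : projDiff (projDiff u) = u - meanL u := by
  refine Sobolev.ext fun k => ?_
  rw [coeff_projDiff, coeff_projDiff, coeff_sub, coeff_meanL, sign_neg_cast, neg_neg, map_smul,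
    Jop_Jop, smul_smul]
  rcases lt_trichotomy k 0 with hk | rfl | hk
  · simp [sign_neg hk, hk.ne]
  · simp
  · simp [sign_pos hk, hk.ne']

/-- E₊ and E₋ are the eigenspaces of `projDiff` for 1 and -1; the coefficient conditions for k and
-k say the same since J² = -1. -/
theorem mem_halfSpace_iff {σ : ℝ} (hσ : σ * σ = 1) (u : Sobolev ℝ n 1) :
    u ∈ halfSpace n σ ↔ meanL (m' := 1) u = 0 ∧ projDiff u = σ • u := by
  constructor
  · rintro ⟨h0, h1⟩
    refine ⟨Sobolev.ext fun k => by simp [coeff_meanL, h0], Sobolev.ext fun k => ?_⟩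
    rw [coeff_projDiff, coeff_smul]
    rcases lt_trichotomy k 0 with hk | rfl | hk
    · have h2 := h1 (-k) (by omega)
      rw [neg_neg, ← Jop_apply] at h2
      rw [h2, sign_neg hk, smul_smul, mul_neg, hσ]
      simp
    · simp [h0]
    · rw [h1 k hk, ← Jop_apply, sign_pos hk]
      simp
  · rintro ⟨h0, h1⟩
    refine ⟨by simpa [coeff_meanL] using congrArg (fun v : Sobolev ℝ n 1 => v.coeff 0) h0,
      fun k hk => ?_⟩
    have h2 := congrArg (fun v : Sobolev ℝ n 1 => v.coeff (-k)) h1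
    simp only [coeff_projDiff, coeff_smul, neg_neg, sign_neg (neg_neg_of_pos hk)] at h2
    have h3 := congrArg (fun v => σ • v) h2
    simp only [smul_smul, hσ, one_smul] at h3
    rw [← h3, ← Jop_apply]
    simp

/-- `projDiff` is symmetric with square 1 - P₀, so its spectral projections on the complement of the
constants are (1 - P₀ ± `projDiff`)/2. -/
theorem starProjection_halfSpace {σ : ℝ} (hσ : σ * σ = 1) (u : Sobolev ℝ n 1) :
    (halfSpace n σ).starProjection u = (2⁻¹ : ℝ) • (u - meanL u + σ • projDiff u) := by
  have hmean : ∀ w : Sobolev ℝ n 1, projDiff (meanL (m' := 1) w) = 0 := fun w =>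
    Sobolev.ext fun k => by
      rw [coeff_projDiff, coeff_meanL]
      by_cases hk : k = 0
      · simp [hk]
      · simp [hk]
  have hmean' : ∀ w : Sobolev ℝ n 1, meanL (m' := 1) (projDiff w) = 0 := fun w =>
    Sobolev.ext fun k => by
      rw [coeff_meanL, coeff_projDiff]
      simp
  have hmm : ∀ w : Sobolev ℝ n 1, meanL (m' := 1) (meanL (m' := 1) w) = meanL w := fun w =>
    Sobolev.ext fun k => by
      rw [coeff_meanL, coeff_meanL, coeff_meanL]
      simp
  refine Submodule.eq_starProjection_of_mem_orthogonal ?_ ?_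
  · rw [mem_halfSpace_iff hσ]
    constructor
    · rw [map_smul, map_add, map_sub, map_smul, hmm, hmean', sub_self, smul_zero, add_zero,
        smul_zero]
    · rw [map_smul, map_add, map_sub, map_smul, hmean, projDiff_projDiff, sub_zero,
        smul_comm σ (2⁻¹ : ℝ), smul_add σ, smul_smul σ σ, hσ, one_smul, add_comm]
  · rw [Submodule.mem_orthogonal]
    intro w hw
    rw [mem_halfSpace_iff hσ] at hw
    have e1 : inner ℝ w (meanL u) = (0 : ℝ) := by rw [← inner_meanL, hw.1, inner_zero_left]
    have e2 : inner ℝ w (projDiff u) = σ * inner ℝ w u := by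
      rw [← inner_projDiff, hw.2, real_inner_smul_left]
    rw [inner_sub_right, real_inner_smul_right, inner_add_right, inner_sub_right, e1,
      real_inner_smul_right, e2, ← mul_assoc, hσ]
    ring

theorem Gam_eq (u v : Sobolev ℝ n 1) : Gam u v = inner ℝ (projDiff u) v := by
  rw [Gam, starProjection_halfSpace (by norm_num), starProjection_halfSpace (by norm_num)]
  congr 1
  module

theorem hasGradientAt_Gam (u : Sobolev ℝ n 1) :
    HasGradientAt (fun u : Sobolev ℝ n 1 => Gam u u / 2) (projDiff u) u := by
  rw [hasGradientAt_iff_hasFDerivAt]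
  simp only [Gam_eq, div_eq_mul_inv]
  refine ((((projDiff (n := n)).hasFDerivAt (x := u)).inner ℝ (hasFDerivAt_id u)).mul_const
    (2 : ℝ)⁻¹).congr_fderiv ?_
  ext v
  simp only [_root_.smul_apply, ContinuousLinearMap.comp_apply, ContinuousLinearMap.prod_apply,
    fderivInnerCLM_apply, ContinuousLinearMap.id_apply, id_eq, InnerProductSpace.toDual_apply_apply,
    smul_eq_mul]
  rw [inner_projDiff v, real_inner_comm (projDiff u) v]
  ring

end Projections

/-! ### Gradient and Hessian of the action. -/

section ActionHessian

open Sobolev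

variable {n : ℕ} {h : ℝ → Vec ℝ n → ℝ} {a b : ℝ} {R : ℕ}

theorem hessianOp_eq_projDiff_add (Φ : LoopOp ℝ n) :
    hessianOp Φ = projDiff + fromL2 ∘L (mulL2 Φ ∘L toL2) := rfl

variable {X : Type u} {𝓗 : X → ℝ → Vec ℝ n → ℝ} {x : X}

theorem HasGrowth.hasGradientAt_action (hh : HasGrowth (𝓗 x) a b R) (u : Sobolev ℝ n 1) :
    HasGradientAt (action 𝓗 x) (projDiff u + fromL2 (hh.superposition u)) u := by
  have e : action 𝓗 x = fun u => Gam u u / 2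
      + ∫ t, 𝓗 x t ((toL2 u : L2 ℝ n) t) ∂circleMeasure := by
    funext u
    rw [action, intervalIntegral.integral_of_le (by positivity)]
  rw [e, hasGradientAt_iff_hasFDerivAt, map_add]
  exact (hasGradientAt_Gam u).hasFDerivAt.add (hh.hasGradientAt_integral u).hasFDerivAt

theorem HasGrowth.hasFDerivAt_gradient_action (hh : HasGrowth (𝓗 x) a b R) (Φ : LoopOp ℝ n)
    (hΦ : ∀ t ∈ Set.Icc 0 (2 * Real.pi), Φ.extend t = fderiv ℝ (gradient (𝓗 x t)) 0) :
    HasFDerivAt (gradient (action 𝓗 x)) (hessianOp Φ) 0 := by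
  have e : gradient (action 𝓗 x) = fun u => projDiff u + fromL2 (hh.superposition u) :=
    funext fun u => (hh.hasGradientAt_action u).gradient
  rw [e, hessianOp_eq_projDiff_add]
  exact (projDiff (n := n)).hasFDerivAt.add
    ((fromL2 (𝕜 := ℝ) (n := n) (m := 1)).hasFDerivAt.comp 0 (hh.hasFDerivAt_superposition Φ hΦ))

end ActionHessian

/-! ### Complexification of real functions and operators. -/

section Complexification

open Sobolev

variable {n m : ℕ}

/-- The inclusion `ℝ^{2n} ⊂ ℂ^{2n}`. -/
def vecOfReal : Vec ℝ n →L[ℝ] Vec ℂ n :=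
  LinearMap.toContinuousLinearMap
    { toFun := fun v => WithLp.toLp 2 fun i => ((v i : ℝ) : ℂ)
      map_add' := fun v w => by ext i; simp
      map_smul' := fun c v => by ext i; simp }

theorem vecOfReal_apply (v : Vec ℝ n) (i : Fin n ⊕ Fin n) : vecOfReal v i = ((v i : ℝ) : ℂ) := rfl

theorem coeff_ofReal (u : Sobolev ℝ n m) (k : ℤ) : u.ofReal.coeff k = vecOfReal (u.coeff k) := rfl

theorem matVec_map_vecOfReal (M : Matrix (Fin n ⊕ Fin n) (Fin n ⊕ Fin n) ℝ) (v : Vec ℝ n) :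
    matVec (M.map Complex.ofReal) (vecOfReal v) = vecOfReal (matVec M v) := by
  ext i
  simp [matVec, vecOfReal_apply, Matrix.mulVec, dotProduct]

theorem Jop_vecOfReal (v : Vec ℝ n) : Jop (vecOfReal v) = vecOfReal (Jop v) := by
  have hJ : (Matrix.J (Fin n) ℝ).map Complex.ofReal = Matrix.J (Fin n) ℂ := by
    ext i j
    rcases i with i | i <;> rcases j with j | j <;>
      simp [Matrix.J, Matrix.one_apply, apply_ite]
  rw [Jop_apply, Jop_apply, ← matVec_map_vecOfReal, hJ]

theorem coeFn_toL2_ofReal (u : Sobolev ℝ n m) :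
    (toL2 u.ofReal : L2 ℂ n) =ᵐ[circleMeasure] fun t => vecOfReal ((toL2 u : L2 ℝ n) t) := by
  have h : vecOfReal.compLpL 2 circleMeasure (toL2 u : L2 ℝ n) = toL2 u.ofReal := by
    refine ((hasSum_toL2 u).mapL (vecOfReal.compLpL 2 circleMeasure)).unique ?_
    convert hasSum_toL2 u.ofReal using 1
    funext k
    refine Lp.ext ?_
    filter_upwards [vecOfReal.coeFn_compLpL (trigL2 k (u.coeff k) : L2 ℝ n),
      coeFn_trigL2 k (u.coeff k), coeFn_trigL2 k (u.ofReal.coeff k)] with t h1 h2 h3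
    rw [h1, h2, h3, coeff_ofReal]
    ext i
    simp [vecOfReal_apply]
  rw [← h]
  exact vecOfReal.coeFn_compLpL _

theorem fromL2_ofReal (f : L2 ℝ n) (g : L2 ℂ n)
    (h : g =ᵐ[circleMeasure] fun t => vecOfReal (f t)) :
    (fromL2 g : Sobolev ℂ n m) = (fromL2 f : Sobolev ℝ n m).ofReal := by
  refine Sobolev.ext fun k => ?_
  ext i
  have h1 := weight_mul_inner_coeff_fromL2 (m := m) g k (EuclideanSpace.single i 1)
  have h2 := weight_mul_inner_coeff_fromL2 (m := m) f k (EuclideanSpace.single i 1)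
  rw [inner_trigL2_single, EuclideanSpace.inner_single_left, map_one, one_mul] at h1 h2
  have hw : ((weight m k : ℝ) : ℂ) ≠ 0 := by exact_mod_cast (weight_pos m k).ne'
  refine mul_left_cancel₀ hw (h1.trans ?_)
  rw [coeff_ofReal, vecOfReal_apply, ← Complex.ofReal_mul]
  simp only [RCLike.ofReal_real_eq_id, id_eq] at h2
  rw [h2, ← intervalIntegral.integral_ofReal, intervalIntegral.integral_of_le (by positivity),
    intervalIntegral.integral_of_le (by positivity)]
  refine integral_congr_ae ?_
  filter_upwards [h] with t ht
  rw [ht, vecOfReal_apply]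
  simp

/-- The complexification of a real family of operators. -/
theorem hessianOp_ofReal (Φ : LoopOp ℝ n) (Φ' : LoopOp ℂ n)
    (h : ∀ t v, Φ' t (vecOfReal v) = vecOfReal (Φ t v)) (u : Sobolev ℝ n 1) :
    hessianOp Φ' u.ofReal = (hessianOp Φ u).ofReal := by
  have h1 : fromL2 (m := 1) (mulL2 Φ' (toL2 u.ofReal)) = (fromL2 (mulL2 Φ (toL2 u))).ofReal := by
    refine fromL2_ofReal _ _ ?_
    filter_upwards [coeFn_mulL2 Φ' (toL2 u.ofReal), coeFn_mulL2 Φ (toL2 u),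
      coeFn_toL2_ofReal u] with t h1 h2 h3
    rw [h1, h2, h3]
    exact h _ _
  rw [hessianOp_apply, hessianOp_apply, h1]
  refine Sobolev.ext fun k => ?_
  simp only [coeff_add, coeff_sub, coeff_signOp, coeff_meanL, coeff_ofReal, map_add, map_sub]
  congr 2
  · split_ifs
    · rfl
    · rw [Jop_vecOfReal, map_smul]
      simp
  · split_ifs
    · rfl
    · rw [map_zero]

theorem exists_eq_ofReal_add (w : Sobolev ℂ n m) :
    ∃ u v : Sobolev ℝ n m, w = u.ofReal + Complex.I • v.ofReal := by
  have hre : ∀ f : ℂ →L[ℝ] ℝ, (∀ z, |f z| ≤ ‖z‖) →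
      Summable fun k => weight m k * ‖(WithLp.toLp 2 fun i => f (w.coeff k i) : Vec ℝ n)‖ ^ 2 := by
    intro f hf
    refine Summable.of_nonneg_of_le (fun k => ?_) (fun k => ?_) w.summable_coeff
    · have := (weight_pos m k).le
      positivity
    · refine mul_le_mul_of_nonneg_left ?_ (weight_pos m k).le
      rw [EuclideanSpace.norm_sq_eq, EuclideanSpace.norm_sq_eq]
      exact Finset.sum_le_sum fun i _ => pow_le_pow_left₀ (norm_nonneg _) (hf _) 2
  refine ⟨⟨_, hre Complex.reCLM Complex.abs_re_le_norm⟩,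
    ⟨_, hre Complex.imCLM Complex.abs_im_le_norm⟩, Sobolev.ext fun k => ?_⟩
  ext i
  have h : w.coeff k i = ((w.coeff k i).re : ℂ) + Complex.I * ((w.coeff k i).im : ℂ) := by
    rw [mul_comm]
    exact (Complex.re_add_im _).symm
  exact h

theorem ofReal_add_I_smul_ofReal_eq_zero {u v : Sobolev ℝ n m}
    (h : u.ofReal + Complex.I • v.ofReal = 0) : u = 0 ∧ v = 0 := by
  have h1 : ∀ k i, ((u.coeff k i : ℝ) : ℂ) + Complex.I * ((v.coeff k i : ℝ) : ℂ) = 0 :=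
    fun k i => congrArg (fun w : Sobolev ℂ n m => w.coeff k i) h
  constructor
  · refine Sobolev.ext fun k => ?_
    ext i
    simpa using congrArg Complex.re (h1 k i)
  · refine Sobolev.ext fun k => ?_
    ext i
    simpa using congrArg Complex.im (h1 k i)

/-- Admissibility concerns the real Hessian. The complex operator has index 0, and its kernel
vanishes because real and imaginary parts of a kernel element lie in the real kernel. -/
theorem isInvertible_hessianOp_of_real (Φ : LoopOp ℝ n) (Φ' : LoopOp ℂ n)
    (h : ∀ t v, Φ' t (vecOfReal v) = vecOfReal (Φ t v)) (hΦ : (hessianOp Φ).IsInvertible) :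
    (hessianOp Φ').IsInvertible := by
  obtain ⟨B, K, e, hB, hK⟩ := exists_hessianOp_add_eq Φ' 0 0
  have e' : hessianOp Φ' = B + K := by
    rw [← e]
    refine ContinuousLinearMap.ext fun u => ?_
    simp only [_root_.add_apply, _root_.smul_apply, Complex.ofReal_zero, mul_zero, zero_smul,
      add_zero]
  have hF := isFredholm_of_invertible_add e' hB hK
  refine isInvertible_of_injective_of_finrank_eq hF.1 hF.2
    ((injective_iff_map_eq_zero _).mpr fun w hw => ?_)
  obtain ⟨u, v, rfl⟩ := exists_eq_ofReal_add w
  rw [map_add, map_smul, hessianOp_ofReal Φ Φ' h, hessianOp_ofReal Φ Φ' h] at hw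
  obtain ⟨h1, h2⟩ := ofReal_add_I_smul_ofReal_eq_zero hw
  obtain ⟨e, he⟩ := hΦ
  have hinj : ∀ u, hessianOp Φ u = 0 → u = 0 := fun u hu => by
    rw [← he] at hu
    exact e.injective (hu.trans (map_zero e).symm)
  rw [hinj u h1, hinj v h2]
  refine Sobolev.ext fun k => ?_
  ext i
  simp [coeff_ofReal]

end Complexification

/-! ### The matrices S, their symmetry and continuity, and the Morse index. -/

section HessianMatrix

variable {n : ℕ} {h : ℝ → Vec ℝ n → ℝ} {a b : ℝ} {R : ℕ}

theorem HasGrowth.inner_gradient (hh : HasGrowth h a b R) (t : ℝ) (v w : Vec ℝ n) :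
    inner ℝ (gradient (h t) v) w = fderiv ℝ (fun p : ℝ × Vec ℝ n => h p.1 p.2) (t, v) (0, w) := by
  rw [← InnerProductSpace.toDual_apply_apply, gradient, LinearIsometryEquiv.apply_symm_apply,
    (hh.hasFDerivAt t v).fderiv]
  rfl

/-- Rewrites the derivative of the gradient as a second derivative in (t, u) jointly: symmetry then
is Schwarz's theorem, and continuity in the parameter is the assumption on `iteratedFDeriv`. -/
theorem HasGrowth.inner_fderiv_gradient (hh : HasGrowth h a b R) (t : ℝ) (v w w' : Vec ℝ n) :
    inner ℝ (fderiv ℝ (gradient (h t)) v w) w'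
      = fderiv ℝ (fderiv ℝ fun p : ℝ × Vec ℝ n => h p.1 p.2) (t, v) (0, w) (0, w') := by
  have h1 : HasFDerivAt (fun y => inner ℝ (gradient (h t) y) w')
      ((innerSL ℝ w').comp (fderiv ℝ (gradient (h t)) v)) v := by
    have := (innerSL ℝ w').hasFDerivAt.comp v (hh.hasFDerivAt_gradient t v)
    refine this.congr_of_eventuallyEq (Filter.Eventually.of_forall fun y => ?_)
    exact real_inner_comm _ _
  have hd : ContDiff ℝ 1 (fderiv ℝ fun p : ℝ × Vec ℝ n => h p.1 p.2) :=
    hh.contDiff.fderiv_right (by norm_num)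
  have h2 := (((hd.differentiable one_ne_zero (t, v)).hasFDerivAt.comp v
    (hasFDerivAt_prodMk_right t v)).clm_apply (hasFDerivAt_const ((0 : ℝ), w') v))
  simp only [hh.inner_gradient] at h1
  have h3 := DFunLike.congr_fun (h1.unique h2) w
  simp only [ContinuousLinearMap.comp_apply, innerSL_apply_apply, _root_.add_apply,
    ContinuousLinearMap.flip_apply, ContinuousLinearMap.inr_apply, _root_.zero_apply,
    map_zero, zero_add] at h3
  rw [real_inner_comm, h3]

theorem HasGrowth.inner_fderiv_gradient_comm (hh : HasGrowth h a b R) (t : ℝ) (v w w' : Vec ℝ n) :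
    inner ℝ (fderiv ℝ (gradient (h t)) v w) w' = inner ℝ w (fderiv ℝ (gradient (h t)) v w') := by
  rw [hh.inner_fderiv_gradient, real_inner_comm, hh.inner_fderiv_gradient]
  exact (hh.contDiff.contDiffAt.isSymmSndFDerivAt (by simp)) _ _

theorem matVecL_hessianMatrix {X : Type u} {𝓗 : X → ℝ → Vec ℝ n → ℝ} (x : X) (t : ℝ) :
    matVecL (hessianMatrix 𝓗 x t) = fderiv ℝ (gradient (𝓗 x t)) 0 := by
  refine ContinuousLinearMap.ext fun v => ?_
  have hv : v = ∑ j, v j • EuclideanSpace.single j (1 : ℝ) := by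
    simpa using ((EuclideanSpace.basisFun (Fin n ⊕ Fin n) ℝ).sum_repr v).symm
  conv_rhs => rw [hv, map_sum]
  ext i
  rw [matVecL_apply, WithLp.ofLp_sum, Finset.sum_apply]
  simp [matVec, Matrix.mulVec, dotProduct, hessianMatrix, mul_comm]

variable {X : Type u} [TopologicalSpace X] {𝓗 : X → ℝ → Vec ℝ n → ℝ}

namespace IsHamiltonianFamily

theorem exists_hasGrowth (h𝓗 : IsHamiltonianFamily 𝓗) :
    ∃ (a b : ℝ) (R : ℕ), ∀ x, HasGrowth (𝓗 x) a b R := by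
  obtain ⟨a, b, r, ha, hb, hr, hg⟩ := h𝓗.growth
  -- The real exponent is replaced by an integer through |v|^r ≤ 1 + |v|^⌈r⌉, which moves b into the
  -- constant term.
  refine ⟨a + b, b, ⌈r⌉₊, fun x => ⟨h𝓗.contDiff x, h𝓗.gradient_zero x, by positivity, hb,
    Nat.one_le_ceil_iff.mpr (by linarith), fun t v => (hg x t v).2.trans ?_⟩⟩
  have h1 : ‖v‖ ^ r ≤ 1 + ‖v‖ ^ ⌈r⌉₊ := by
    rcases le_total ‖v‖ 1 with h | h
    · have := Real.rpow_le_one (norm_nonneg v) h (by linarith : 0 ≤ r)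
      have h2 : 0 ≤ ‖v‖ ^ ⌈r⌉₊ := by positivity
      linarith
    · have := Real.rpow_le_rpow_of_exponent_le h (Nat.le_ceil r)
      rw [Real.rpow_natCast] at this
      linarith
  nlinarith

theorem continuous_hessianMatrix (h𝓗 : IsHamiltonianFamily 𝓗) :
    Continuous fun p : X × ℝ => hessianMatrix 𝓗 p.1 p.2 := by
  obtain ⟨a, b, R, hh⟩ := h𝓗.exists_hasGrowth
  refine continuous_matrix fun i j => ?_
  have e : (fun p : X × ℝ => hessianMatrix 𝓗 p.1 p.2 i j) = fun p =>
      iteratedFDeriv ℝ 2 (fun q : ℝ × Vec ℝ n => 𝓗 p.1 q.1 q.2) (p.2, 0)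
        ![(0, EuclideanSpace.single j 1), (0, EuclideanSpace.single i 1)] := by
    funext p
    rw [iteratedFDeriv_two_apply]
    simp only [Matrix.cons_val_zero, Matrix.cons_val_one]
    rw [← (hh p.1).inner_fderiv_gradient, EuclideanSpace.inner_single_right]
    simp [hessianMatrix]
  rw [e]
  have h2 := (h𝓗.continuous_iteratedFDeriv 2 le_rfl).comp
    (continuous_fst.prodMk (continuous_snd.prodMk continuous_const) :
      Continuous fun p : X × ℝ => (p.1, (p.2, (0 : Vec ℝ n))))
  exact (ContinuousMultilinearMap.apply ℝ (fun _ : Fin 2 => ℝ × Vec ℝ n) ℝ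
    ![(0, EuclideanSpace.single j 1), (0, EuclideanSpace.single i 1)]).continuous.comp h2

/-- The Hessians at `0` over a period. -/
def hessianLoop (h𝓗 : IsHamiltonianFamily 𝓗) : C(X, LoopOp ℝ n) :=
  ContinuousMap.curry ⟨fun p => matVecL (hessianMatrix 𝓗 p.1 p.2),
    continuous_matVecL.comp (h𝓗.continuous_hessianMatrix.comp
      (continuous_fst.prodMk (continuous_subtype_val.comp continuous_snd)))⟩

/-- The complexified Hessians at `0` over a period. -/
def complexHessianLoop (h𝓗 : IsHamiltonianFamily 𝓗) : C(X, LoopOp ℂ n) :=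
  ContinuousMap.curry ⟨fun p => matVecL ((hessianMatrix 𝓗 p.1 p.2).map Complex.ofReal),
    continuous_matVecL.comp ((h𝓗.continuous_hessianMatrix.comp
      (continuous_fst.prodMk (continuous_subtype_val.comp continuous_snd))).matrix_map
        Complex.continuous_ofReal)⟩

theorem hessianLoop_apply (h𝓗 : IsHamiltonianFamily 𝓗) (x : X)
    (t : Set.Icc (0 : ℝ) (2 * Real.pi)) :
    h𝓗.hessianLoop x t = matVecL (hessianMatrix 𝓗 x t) := rfl

theorem complexHessianLoop_apply (h𝓗 : IsHamiltonianFamily 𝓗) (x : X)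
    (t : Set.Icc (0 : ℝ) (2 * Real.pi)) : h𝓗.complexHessianLoop x t
      = matVecL ((hessianMatrix 𝓗 x t).map Complex.ofReal) := rfl

theorem hessianLoop_extend (h𝓗 : IsHamiltonianFamily 𝓗) (x : X) {t : ℝ}
    (ht : t ∈ Set.Icc 0 (2 * Real.pi)) :
    (h𝓗.hessianLoop x).extend t = fderiv ℝ (gradient (𝓗 x t)) 0 := by
  rw [LoopOp.extend_of_mem _ ht, hessianLoop_apply, matVecL_hessianMatrix]

theorem hessianMatrix_isSymm (h𝓗 : IsHamiltonianFamily 𝓗) (x : X) (t : ℝ) :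
    (hessianMatrix 𝓗 x t)ᵀ = hessianMatrix 𝓗 x t := by
  obtain ⟨a, b, R, hh⟩ := h𝓗.exists_hasGrowth
  ext i j
  have h1 := (hh x).inner_fderiv_gradient_comm t 0 (EuclideanSpace.single i 1)
    (EuclideanSpace.single j 1)
  rw [EuclideanSpace.inner_single_right, EuclideanSpace.inner_single_left] at h1
  simpa [hessianMatrix] using h1

theorem inner_complexHessianLoop (h𝓗 : IsHamiltonianFamily 𝓗) (x : X)
    (t : Set.Icc (0 : ℝ) (2 * Real.pi)) (v w : Vec ℂ n) :
    inner ℂ (h𝓗.complexHessianLoop x t v) w = inner ℂ v (h𝓗.complexHessianLoop x t w) := by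
  have e : ((hessianMatrix 𝓗 x t).map Complex.ofReal)ᴴ
      = (hessianMatrix 𝓗 x t).map Complex.ofReal := by
    conv_rhs => rw [← h𝓗.hessianMatrix_isSymm]
    ext i j
    simp
  rw [complexHessianLoop_apply, matVecL_apply, inner_matVec, e, matVecL_apply]

/-- The operators `u ↦ J u' + S_x u`. -/
def spectralFamily (h𝓗 : IsHamiltonianFamily 𝓗) : C(X, Sobolev ℂ n 2 →L[ℂ] L2 ℂ n) :=
  ⟨fun x => firstOrderOp (h𝓗.complexHessianLoop x),
    continuous_firstOrderOp.comp h𝓗.complexHessianLoop.continuous⟩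

/-- The Morse index is the index bundle of the operators `u ↦ J u' + S_x u`. -/
theorem exists_hasMorseIndex [CompactSpace X] (h𝓗 : IsHamiltonianFamily 𝓗) (Y : Set X)
    (hadm : IsAdmissible 𝓗 Y) : ∃ κ, HasMorseIndex 𝓗 Y κ ∧
      HasSelfAdjointIndexBundle toL2 toL2_injective h𝓗.spectralFamily Y κ := by
  obtain ⟨a, b, R, hh⟩ := h𝓗.exists_hasGrowth
  have hD : ∀ x, HasFDerivAt (gradient (action 𝓗 x)) (hessianOp (h𝓗.hessianLoop x)) 0 := fun x =>
    (hh x).hasFDerivAt_gradient_action _ fun t ht => h𝓗.hessianLoop_extend x ht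
  have hreal : ∀ x t v, h𝓗.complexHessianLoop x t (vecOfReal v)
      = vecOfReal (h𝓗.hessianLoop x t v) := fun x t v => by
    rw [complexHessianLoop_apply, hessianLoop_apply, matVecL_apply, matVecL_apply,
      matVec_map_vecOfReal]
  let L : C(X, Sobolev ℂ n 1 →L[ℂ] Sobolev ℂ n 1) :=
    ⟨fun x => hessianOp (h𝓗.complexHessianLoop x),
      continuous_hessianOp.comp h𝓗.complexHessianLoop.continuous⟩
  obtain ⟨κ, hκ, hκ'⟩ := exists_hasSelfAdjointIndexBundle_hessianOp h𝓗.complexHessianLoop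
    h𝓗.inner_complexHessianLoop Y L (fun _ => rfl) h𝓗.spectralFamily (fun _ => rfl) fun x hx => by
      refine isInvertible_hessianOp_of_real _ _ (hreal x) ?_
      rw [← (hD x).fderiv]
      exact hadm x hx
  refine ⟨κ, ⟨fun x u => ?_, fun x => (hD x).differentiableAt, L, fun x u => ?_, hκ⟩, hκ'⟩
  · exact ((hh x).hasGradientAt_action u).differentiableAt
  · rw [actionHessian, (hD x).fderiv]
    exact hessianOp_ofReal _ _ (hreal x) u

theorem coeFn_spectralFamily (h𝓗 : IsHamiltonianFamily 𝓗) (x : X) (u : Sobolev ℂ n 2) :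
    ∀ᵐ t ∂circleMeasure, h𝓗.spectralFamily x u t
      = matVec (Matrix.J (Fin n) ℂ) ((toL2 (coeffDeriv u) : L2 ℂ n) t) +
        matVec ((hessianMatrix 𝓗 x t).map Complex.ofReal) ((toL2 u : L2 ℂ n) t) := by
  filter_upwards [coeFn_firstOrderOp (h𝓗.complexHessianLoop x) u,
    ae_restrict_mem measurableSet_Ioc] with t h1 ht
  exact h1.trans (by rw [LoopOp.extend_of_mem _ (Set.Ioc_subset_Icc_self ht)]; rfl)

end IsHamiltonianFamily

end HessianMatrix

/-! ### Primitives in L² and the fundamental theorem of calculus in H¹. -/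

section Primitive

open Sobolev

variable {n : ℕ}

theorem exists_integral_norm_le (n : ℕ) : ∃ C : ℝ, 0 ≤ C ∧ ∀ f : L2 ℂ n,
    ∫ t, ‖f t‖ ∂circleMeasure ≤ C * ‖f‖ := by
  set c : ENNReal := circleMeasure Set.univ ^ (1 / (1 : ENNReal).toReal - 1 / (2 : ENNReal).toReal)
    with hc
  have hc' : c ≠ ⊤ := ENNReal.rpow_ne_top_of_nonneg (by norm_num) (measure_ne_top _ _)
  refine ⟨c.toReal, ENNReal.toReal_nonneg, fun f => ?_⟩
  rw [integral_norm_eq_lintegral_enorm (Lp.aestronglyMeasurable f), ← eLpNorm_one_eq_lintegral_enorm,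
    Lp.norm_def, ← ENNReal.toReal_mul, mul_comm]
  exact ENNReal.toReal_mono (ENNReal.mul_ne_top (Lp.eLpNorm_ne_top f) hc')
    (eLpNorm_le_eLpNorm_mul_rpow_measure_univ one_le_two (Lp.aestronglyMeasurable f))

theorem integrable_L2 (f : L2 ℂ n) : Integrable f circleMeasure :=
  (Lp.memLp f).integrable one_le_two

/-- The primitive `t ↦ ∫₀ᵗ f` of a function on a period. -/
def primitive (f : L2 ℂ n) (t : ℝ) : Vec ℂ n := ∫ τ in (0 : ℝ)..t, f τ ∂circleMeasure

theorem continuous_primitive (f : L2 ℂ n) : Continuous (primitive f) :=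
  intervalIntegral.continuous_primitive (fun _ _ => (integrable_L2 f).intervalIntegrable) 0

theorem norm_primitive_le (f : L2 ℂ n) (t : ℝ) :
    ‖primitive f t‖ ≤ ∫ t, ‖f t‖ ∂circleMeasure := by
  refine (intervalIntegral.norm_integral_le_integral_norm_uIoc).trans ?_
  exact setIntegral_le_integral (integrable_L2 f).norm
    (Filter.Eventually.of_forall fun t => norm_nonneg _)

theorem intervalIntegral_circleMeasure {E : Type*} [NormedAddCommGroup E] [NormedSpace ℝ E]
    (f : ℝ → E) {t : ℝ} (ht : t ∈ Set.Icc 0 (2 * Real.pi)) :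
    ∫ τ in (0 : ℝ)..t, f τ ∂circleMeasure = ∫ τ in (0 : ℝ)..t, f τ := by
  rw [intervalIntegral.integral_of_le ht.1, intervalIntegral.integral_of_le ht.1,
    Measure.restrict_restrict measurableSet_Ioc,
    Set.inter_eq_self_of_subset_left (Set.Ioc_subset_Ioc_right ht.2)]

theorem primitive_eq_of_ae {f : L2 ℂ n} {g : ℝ → Vec ℂ n} (h : f =ᵐ[circleMeasure] g) {t : ℝ}
    (ht : t ∈ Set.Icc 0 (2 * Real.pi)) : primitive f t = ∫ τ in (0 : ℝ)..t, g τ := by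
  rw [primitive, ← intervalIntegral_circleMeasure g ht]
  refine intervalIntegral.integral_congr_ae ?_
  filter_upwards [h] with τ hτ _
  exact hτ

theorem primitive_add (f g : L2 ℂ n) (t : ℝ) :
    primitive (f + g) t = primitive f t + primitive g t := by
  rw [primitive, primitive, primitive, ← intervalIntegral.integral_add
    (integrable_L2 f).intervalIntegrable (integrable_L2 g).intervalIntegrable]
  refine intervalIntegral.integral_congr_ae ?_
  filter_upwards [Lp.coeFn_add f g] with τ hτ _
  exact hτ

theorem primitive_smul (c : ℂ) (f : L2 ℂ n) (t : ℝ) :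
    primitive (c • f) t = c • primitive f t := by
  rw [primitive, primitive, ← intervalIntegral.integral_smul]
  refine intervalIntegral.integral_congr_ae ?_
  filter_upwards [Lp.coeFn_smul c f] with τ hτ _
  exact hτ

theorem memLp_primitive (f : L2 ℂ n) : MemLp (primitive f) 2 circleMeasure :=
  MemLp.of_bound (continuous_primitive f).aestronglyMeasurable _
    (Filter.Eventually.of_forall (norm_primitive_le f))

/-- The operator `f ↦ ∫₀ᵗ f` in `L²`, as a linear map. -/
def primitiveLin : L2 ℂ n →ₗ[ℂ] L2 ℂ n where
  toFun f := (memLp_primitive f).toLp _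
  map_add' f g := by
    rw [← MemLp.toLp_add]
    congr 1
    funext t
    exact primitive_add f g t
  map_smul' c f := by
    rw [RingHom.id_apply, ← MemLp.toLp_const_smul]
    congr 1
    funext t
    exact primitive_smul c f t

theorem coeFn_primitiveLin (f : L2 ℂ n) :
    (primitiveLin f : L2 ℂ n) =ᵐ[circleMeasure] primitive f :=
  (memLp_primitive f).coeFn_toLp

theorem exists_norm_primitiveLin_le (n : ℕ) :
    ∃ C : ℝ, ∀ f : L2 ℂ n, ‖primitiveLin f‖ ≤ C * ‖f‖ := by
  obtain ⟨C, hC, h⟩ := exists_integral_norm_le n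
  refine ⟨measureUnivNNReal circleMeasure ^ ((2 : ENNReal).toReal)⁻¹ * C, fun f => ?_⟩
  rw [mul_assoc]
  refine Lp.norm_le_of_ae_bound (by positivity) ?_
  filter_upwards [coeFn_primitiveLin f] with t ht
  rw [ht]
  exact (norm_primitive_le f t).trans (h f)

/-- The operator `f ↦ ∫₀ᵗ f` in `L²`. -/
def primitiveL : L2 ℂ n →L[ℂ] L2 ℂ n :=
  LinearMap.mkContinuousOfExistsBound primitiveLin (exists_norm_primitiveLin_le n)

theorem coeFn_primitiveL (f : L2 ℂ n) :
    (primitiveL f : L2 ℂ n) =ᵐ[circleMeasure] primitive f :=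
  coeFn_primitiveLin f

/-- The constant functions in `L²`. -/
def constL2 : Vec ℂ n →L[ℂ] L2 ℂ n := LinearMap.toContinuousLinearMap (trigL2 0)

theorem constL2_apply (c : Vec ℂ n) : constL2 c = trigL2 0 c := rfl

theorem coeFn_constL2 (c : Vec ℂ n) : (constL2 c : L2 ℂ n) =ᵐ[circleMeasure] fun _ => c := by
  filter_upwards [coeFn_trigL2 0 c] with t ht
  rw [constL2_apply, ht]
  simp [trig]

/-- The integral over a period. -/
def integralL2 : L2 ℂ n →L[ℂ] Vec ℂ n := ContinuousLinearMap.adjoint constL2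

theorem inner_integralL2 (c : Vec ℂ n) (f : L2 ℂ n) :
    inner ℂ c (integralL2 f) = inner ℂ (constL2 c) f :=
  ContinuousLinearMap.adjoint_inner_right _ _ _

theorem integralL2_eq_integral (f : L2 ℂ n) : integralL2 f = ∫ t, f t ∂circleMeasure := by
  refine ext_inner_left ℂ fun c => ?_
  rw [inner_integralL2, L2.inner_def, ← integral_inner (integrable_L2 f)]
  refine integral_congr_ae ?_
  filter_upwards [coeFn_constL2 c] with t ht
  rw [ht]

theorem primitive_two_pi (f : L2 ℂ n) : primitive f (2 * Real.pi) = integralL2 f := by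
  rw [integralL2_eq_integral, primitive, intervalIntegral_circleMeasure _
    (Set.right_mem_Icc.mpr Real.two_pi_pos.le), intervalIntegral.integral_of_le Real.two_pi_pos.le]

theorem integralL2_toL2 {m : ℕ} (u : Sobolev ℂ n m) :
    integralL2 (toL2 u) = ((2 * Real.pi : ℝ) : ℂ) • u.coeff 0 := by
  refine ext_inner_left ℂ fun c => ?_
  rw [inner_integralL2, constL2_apply, inner_trigL2_toL2, inner_smul_right]
  simp [weight]

theorem integralL2_constL2 (c : Vec ℂ n) :
    integralL2 (constL2 c) = ((2 * Real.pi : ℝ) : ℂ) • c := by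
  rw [constL2_apply, ← toL2_singleL (m := 0), integralL2_toL2, coeff_singleL, if_pos rfl]

/-- The complex structure `J` in `L²`. -/
def JL2 : L2 ℂ n →L[ℂ] L2 ℂ n := (Jop (𝕜 := ℂ) (n := n)).compLpL 2 circleMeasure

theorem coeFn_JL2 (f : L2 ℂ n) : (JL2 f : L2 ℂ n) =ᵐ[circleMeasure] fun t => Jop (f t) :=
  (Jop (𝕜 := ℂ) (n := n)).coeFn_compLpL f

@[simp] theorem JL2_JL2 (f : L2 ℂ n) : JL2 (JL2 f) = -f := by
  refine Lp.ext ?_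
  filter_upwards [coeFn_JL2 (JL2 f), coeFn_JL2 f, Lp.coeFn_neg f] with t h1 h2 h3
  rw [h1, h2, h3, Jop_Jop, Pi.neg_apply]

theorem integralL2_JL2 (f : L2 ℂ n) : integralL2 (JL2 f) = Jop (integralL2 f) := by
  rw [integralL2_eq_integral, integralL2_eq_integral,
    ← ContinuousLinearMap.integral_comp_comm _ (integrable_L2 f)]
  exact integral_congr_ae (coeFn_JL2 f)

/-- The derivative, as an operator from `H¹` to `L²`. -/
def derivL2 : Sobolev ℂ n 2 →L[ℂ] L2 ℂ n := -(JL2 ∘L (toL2 ∘L (diracOp (m := 0) - meanL)))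

theorem derivL2_eq (u : Sobolev ℂ n 2) :
    derivL2 u = -(JL2 (toL2 (diracOp (m := 0) u - meanL u))) := by
  rw [derivL2, _root_.neg_apply, ContinuousLinearMap.comp_apply, ContinuousLinearMap.comp_apply,
    _root_.sub_apply]

theorem derivL2_apply (u : Sobolev ℂ n 2) : derivL2 u = toL2 (coeffDeriv u) := by
  have h : JL2 (toL2 (coeffDeriv u)) = toL2 (diracOp (m := 0) u - meanL u) := by
    refine compLpL_toL2 _ _ _ fun k => ?_
    rw [coeff_sub, coeff_diracOp, coeff_meanL]
    change _ = Jop (((k : ℝ) : ℂ) • u.coeff (-k))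
    by_cases hk : k = 0
    · simp [hk]
    · simp [hk]
  rw [derivL2_eq, ← h, JL2_JL2, neg_neg]

theorem JL2_derivL2 (u : Sobolev ℂ n 2) :
    JL2 (derivL2 u) = toL2 (diracOp (m := 0) u) - toL2 (meanL (m' := 0) u) := by
  rw [← map_sub]
  rw [derivL2_eq, map_neg, JL2_JL2, neg_neg]

/-- Periodicity: the derivative has no constant mode. -/
theorem integralL2_derivL2 (u : Sobolev ℂ n 2) : integralL2 (derivL2 u) = 0 := by
  rw [derivL2_apply, integralL2_toL2]
  change _ • (((0 : ℤ) : ℝ) : ℂ) • _ = _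
  simp

theorem hasDerivAt_trig (k : ℤ) (t : ℝ) : HasDerivAt (trig k) (-k * trig (-k) t) t := by
  rcases lt_trichotomy k 0 with hk | rfl | hk
  · have e1 : trig k = fun t => Real.sin (-k * t) := by
      funext t
      simp [trig, not_le.mpr hk]
    have e2 : trig (-k) t = Real.cos (-k * t) := by
      have : 0 ≤ -k := by omega
      rw [trig, if_pos this]
      push_cast
      rfl
    rw [e1, e2]
    have := ((hasDerivAt_id t).const_mul (-(k : ℝ))).sin
    simp only [id_eq, mul_one] at this
    convert this using 1
    ring
  · have e1 : trig 0 = fun _ => 1 := by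
      funext t
      simp [trig]
    rw [e1]
    simpa using hasDerivAt_const t (1 : ℝ)
  · have e1 : trig k = fun t => Real.cos (k * t) := by
      funext t
      simp [trig, hk.le]
    have e2 : trig (-k) t = Real.sin (k * t) := by
      have : ¬ 0 ≤ -k := by omega
      rw [trig, if_neg this]
      push_cast
      rw [neg_neg]
    rw [e1, e2]
    have := ((hasDerivAt_id t).const_mul (k : ℝ)).cos
    simp only [id_eq, mul_one] at this
    convert this using 1
    ring

theorem derivL2_singleL (k : ℤ) (v : Vec ℂ n) :
    derivL2 (singleL k v) = trigL2 (-k) (((-k : ℝ) : ℂ) • v) := by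
  rw [derivL2_apply, ← toL2_singleL (m := 0)]
  congr 1
  refine Sobolev.ext fun j => ?_
  change ((j : ℝ) : ℂ) • (singleL k v : Sobolev ℂ n 2).coeff (-j) = _
  rw [coeff_singleL, coeff_singleL]
  by_cases h : j = -k
  · subst h
    simp
  · rw [if_neg h, if_neg (by omega), smul_zero]

/-- The fundamental theorem of calculus for one mode, where all functions are smooth. -/
theorem toL2_sub_primitiveL_singleL (k : ℤ) (v : Vec ℂ n) :
    toL2 (singleL k v : Sobolev ℂ n 2) - primitiveL (derivL2 (singleL k v))
      = constL2 (((trig k 0 : ℝ) : ℂ) • v) := by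
  rw [toL2_singleL, derivL2_singleL]
  refine Lp.ext ?_
  filter_upwards [Lp.coeFn_sub (trigL2 k v : L2 ℂ n)
    (primitiveL (trigL2 (-k) (((-k : ℝ) : ℂ) • v))), coeFn_trigL2 k v,
    coeFn_primitiveL (trigL2 (-k) (((-k : ℝ) : ℂ) • v)),
    coeFn_constL2 (((trig k 0 : ℝ) : ℂ) • v), ae_restrict_mem measurableSet_Ioc] with t h1 h2 h3 h4 ht
  rw [h1, Pi.sub_apply, h2, h3, h4,
    primitive_eq_of_ae (coeFn_trigL2 (-k) (((-k : ℝ) : ℂ) • v)) (Set.Ioc_subset_Icc_self ht)]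
  have hd : ∀ τ : ℝ, HasDerivAt (fun τ => ((trig k τ : ℝ) : ℂ) • v)
      (((trig (-k) τ : ℝ) : ℂ) • ((-k : ℝ) : ℂ) • v) τ := fun τ => by
    refine (((hasDerivAt_trig k τ).ofReal_comp).smul_const v).congr_deriv ?_
    rw [smul_smul]
    congr 1
    push_cast
    ring
  have hc : Continuous fun τ => ((trig (-k) τ : ℝ) : ℂ) • ((-k : ℝ) : ℂ) • v := by
    have := continuous_trig (-k)
    fun_prop
  have hI := intervalIntegral.integral_eq_sub_of_hasDerivAt (a := 0) (b := t) (fun τ _ => hd τ)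
    (hc.intervalIntegrable _ _)
  exact (congrArg (fun w => ((trig k t : ℝ) : ℂ) • v - w) hI).trans (sub_sub_cancel _ _)

/-- The value at `0` of a function in `H¹`. -/
def evalZero : Sobolev ℂ n 2 →L[ℂ] Vec ℂ n :=
  ((2 * Real.pi : ℝ) : ℂ)⁻¹ • integralL2 ∘L
    (toL2 - primitiveL ∘L derivL2 : Sobolev ℂ n 2 →L[ℂ] L2 ℂ n)

theorem evalZero_apply (u : Sobolev ℂ n 2) :
    evalZero u = ((2 * Real.pi : ℝ) : ℂ)⁻¹ • integralL2 (toL2 u - primitiveL (derivL2 u)) := by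
  rw [evalZero, _root_.smul_apply, ContinuousLinearMap.comp_apply, _root_.sub_apply,
    ContinuousLinearMap.comp_apply]

theorem two_pi_complex_ne_zero : ((2 * Real.pi : ℝ) : ℂ) ≠ 0 := by
  exact_mod_cast Real.two_pi_pos.ne'

/-- The fundamental theorem of calculus in `H¹`. -/
theorem toL2_eq_constL2_add_primitiveL (u : Sobolev ℂ n 2) :
    toL2 u = constL2 (evalZero u) + primitiveL (derivL2 u) := by
  have hclosed : IsClosed ((constL2 (n := n)).range : Set (L2 ℂ n)) :=
    Submodule.closed_of_finiteDimensional _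
  -- On single modes u minus the primitive of u' is constant. The constants form a closed subspace,
  -- so the Fourier series passes the statement on to u, and `evalZero` is the value of this
  -- constant.
  have hmem : toL2 u - primitiveL (derivL2 u) ∈ (constL2 (n := n)).range := by
    have h := (hasSum_singleL u).mapL
      (toL2 - primitiveL ∘L derivL2 : Sobolev ℂ n 2 →L[ℂ] L2 ℂ n)
    simp only [_root_.sub_apply, ContinuousLinearMap.comp_apply] at h
    refine hclosed.mem_of_tendsto h (Filter.Eventually.of_forall fun s =>
      Submodule.sum_mem _ fun k _ => ?_)
    exact ⟨_, (toL2_sub_primitiveL_singleL k (u.coeff k)).symm⟩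
  obtain ⟨c, hc⟩ := hmem
  have hc' : constL2 c = toL2 u - primitiveL (derivL2 u) := hc
  have he : evalZero u = c := by
    rw [evalZero_apply, ← hc', integralL2_constL2, inv_smul_smul₀ two_pi_complex_ne_zero]
  rw [he, hc', sub_add_cancel]

theorem eq_of_evalZero_of_derivL2 {u v : Sobolev ℂ n 2} (h0 : evalZero u = evalZero v)
    (h1 : derivL2 u = derivL2 v) : u = v :=
  toL2_injective (by
    rw [toL2_eq_constL2_add_primitiveL, h0, h1, ← toL2_eq_constL2_add_primitiveL])

theorem derivL2_singleL_zero (c : Vec ℂ n) : derivL2 (singleL 0 c) = 0 := by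
  rw [derivL2_singleL]
  simp

theorem evalZero_singleL_zero (c : Vec ℂ n) : evalZero (singleL 0 c) = c := by
  have h := toL2_sub_primitiveL_singleL 0 c
  rw [evalZero_apply, h, integralL2_constL2, inv_smul_smul₀ two_pi_complex_ne_zero]
  simp [trig]

/-- The function in `H¹` with a given derivative of mean zero, up to a constant. -/
def antiderivL2 : L2 ℂ n →L[ℂ] Sobolev ℂ n 2 :=
  ((diracL2Equiv (n := n)).symm : L2 ℂ n →L[ℂ] Sobolev ℂ n 2) ∘L JL2

/-- The function v solves J v' + P₀ v = J g. Integrating over a period kills J v' and J g, hence P₀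
v = 0 and v' = g. -/
theorem derivL2_antiderivL2 {g : L2 ℂ n} (hg : integralL2 g = 0) :
    derivL2 (antiderivL2 g) = g := by
  set v := antiderivL2 g with hv
  have h1 : toL2 (diracOp (m := 0) v) = JL2 g := by
    rw [← diracL2Equiv_apply]
    exact (diracL2Equiv (n := n)).apply_symm_apply (JL2 g)
  have h2 := JL2_derivL2 v
  rw [h1] at h2
  have h3 := congrArg integralL2 h2
  rw [map_sub, integralL2_JL2, integralL2_JL2, hg, integralL2_derivL2, map_zero, zero_sub,
    integralL2_toL2, coeff_meanL, if_pos rfl, zero_eq_neg, smul_eq_zero] at h3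
  have h4 : meanL (m' := 0) v = 0 := Sobolev.ext fun k => by
    rw [coeff_meanL, h3.resolve_left two_pi_complex_ne_zero]
    simp
  rw [h4, map_zero, sub_zero] at h2
  have h5 := congrArg JL2 h2
  rwa [JL2_JL2, JL2_JL2, neg_inj] at h5

/-- The function in `H¹` with a given value at `0` and a given derivative of mean zero. -/
def reconstruct : Vec ℂ n × L2 ℂ n →L[ℂ] Sobolev ℂ n 2 :=
  antiderivL2 ∘L ContinuousLinearMap.snd ℂ _ _ + singleL 0 ∘L
    (ContinuousLinearMap.fst ℂ _ _ - evalZero ∘L antiderivL2 ∘L ContinuousLinearMap.snd ℂ _ _)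

theorem reconstruct_apply (c : Vec ℂ n) (g : L2 ℂ n) :
    reconstruct (c, g) = antiderivL2 g + singleL 0 (c - evalZero (antiderivL2 g)) := rfl

theorem evalZero_reconstruct (c : Vec ℂ n) (g : L2 ℂ n) : evalZero (reconstruct (c, g)) = c := by
  rw [reconstruct_apply, map_add, evalZero_singleL_zero, add_sub_cancel]

theorem derivL2_reconstruct (c : Vec ℂ n) {g : L2 ℂ n} (hg : integralL2 g = 0) :
    derivL2 (reconstruct (c, g)) = g := by
  rw [reconstruct_apply, map_add, derivL2_singleL_zero, add_zero, derivL2_antiderivL2 hg]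

theorem reconstruct_evalZero_derivL2 (u : Sobolev ℂ n 2) :
    reconstruct (evalZero u, derivL2 u) = u :=
  eq_of_evalZero_of_derivL2 (evalZero_reconstruct _ _)
    (derivL2_reconstruct _ (integralL2_derivL2 u))

/-- On functions of mean zero the primitive factors through the inclusion of H¹ into L²; what
remains depends only on the mean and has finite rank. -/
theorem primitiveL_mem_approximableOperators :
    (primitiveL : L2 ℂ n →L[ℂ] L2 ℂ n) ∈ approximableOperators _ _ := by
  let Q : L2 ℂ n →L[ℂ] L2 ℂ n := ContinuousLinearMap.id ℂ _
    - constL2 ∘L (((2 * Real.pi : ℝ) : ℂ)⁻¹ • integralL2)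
  have hQ : ∀ g, integralL2 (Q g) = 0 := fun g => by
    change integralL2 (g - constL2 (((2 * Real.pi : ℝ) : ℂ)⁻¹ • integralL2 g)) = 0
    rw [map_sub, integralL2_constL2, smul_inv_smul₀ two_pi_complex_ne_zero, sub_self]
  have e : (primitiveL : L2 ℂ n →L[ℂ] L2 ℂ n)
      = (toL2 ∘L reconstruct ∘L ContinuousLinearMap.inr ℂ _ _ : L2 ℂ n →L[ℂ] L2 ℂ n) ∘L Q
        + (primitiveL ∘L constL2) ∘L (((2 * Real.pi : ℝ) : ℂ)⁻¹ • integralL2) := by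
    refine ContinuousLinearMap.ext fun g => ?_
    change primitiveL g = toL2 (reconstruct (0, Q g))
      + primitiveL (constL2 (((2 * Real.pi : ℝ) : ℂ)⁻¹ • integralL2 g))
    rw [toL2_eq_constL2_add_primitiveL, evalZero_reconstruct, derivL2_reconstruct _ (hQ g), map_zero,
      zero_add, ← map_add]
    congr 1
    exact (sub_add_cancel _ _).symm
  rw [e]
  refine add_mem (comp_right_mem_approximableOperators _
    (comp_right_mem_approximableOperators _ toL2_mem_approximableOperators)) (subset_closure ?_)
  exact finiteDimensional_range_comp _ _

end Primitive

/-! ### The initial value problem as a Volterra equation, and the reduction to the period map. -/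

section Volterra

open Sobolev

variable {n : ℕ}

theorem hasDerivWithinAt_primitive {f : L2 ℂ n} {φ : ℝ → Vec ℂ n} (hφ : Continuous φ)
    (h : f =ᵐ[circleMeasure] φ) {t : ℝ} (ht : t ∈ Set.Icc 0 (2 * Real.pi)) :
    HasDerivWithinAt (primitive f) (φ t) (Set.Icc 0 (2 * Real.pi)) t := by
  have h1 : HasDerivAt (fun t => ∫ τ in (0 : ℝ)..t, φ τ) (φ t) t :=
    intervalIntegral.integral_hasDerivAt_right (hφ.intervalIntegrable _ _)
      hφ.aestronglyMeasurable.stronglyMeasurableAtFilter hφ.continuousAt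
  exact h1.hasDerivWithinAt.congr (fun t ht => primitive_eq_of_ae h ht) (primitive_eq_of_ae h ht)

theorem primitive_zero (f : L2 ℂ n) : primitive f 0 = 0 := intervalIntegral.integral_same

/-- The Volterra operator `f ↦ J B ∫₀ᵗ f`. -/
def volterra (B : LoopOp ℂ n) : L2 ℂ n →L[ℂ] L2 ℂ n := JL2 ∘L mulL2 B ∘L primitiveL

theorem volterra_apply (B : LoopOp ℂ n) (f : L2 ℂ n) :
    volterra B f = JL2 (mulL2 B (primitiveL f)) := rfl

theorem coeFn_JL2_mulL2 (B : LoopOp ℂ n) {f : L2 ℂ n} {φ : ℝ → Vec ℂ n}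
    (hf : f =ᵐ[circleMeasure] φ) :
    (JL2 (mulL2 B f) : L2 ℂ n) =ᵐ[circleMeasure] fun t => Jop (B.extend t (φ t)) := by
  filter_upwards [coeFn_JL2 (mulL2 B f), coeFn_mulL2 B f, hf] with t h1 h2 h3
  rw [h1, h2, h3]

theorem continuous_Jop_extend (B : LoopOp ℂ n) {φ : ℝ → Vec ℂ n} (hφ : Continuous φ) :
    Continuous fun t => Jop (B.extend t (φ t)) :=
  Jop.continuous.comp (B.continuous_extend.clm_apply hφ)

/-- The primitive y of f solves y' = J B y with y(0) = 0, so it vanishes by Gronwall's inequality;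
hence so does f. -/
theorem eq_zero_of_volterra_eq (B : LoopOp ℂ n) {f : L2 ℂ n} (h : volterra B f = f) : f = 0 := by
  have hae := coeFn_JL2_mulL2 B (coeFn_primitiveL f)
  rw [← volterra_apply, h] at hae
  have hd := fun t ht => hasDerivWithinAt_primitive (t := t)
    (continuous_Jop_extend B (continuous_primitive f)) hae ht
  have h0 : ∀ t ∈ Set.Icc 0 (2 * Real.pi), primitive f t = 0 := by
    refine eq_zero_of_abs_deriv_le_mul_abs_self_of_eq_zero_right (K := ‖B‖)
      (continuous_primitive f).continuousOn (fun t ht => (hd t ⟨ht.1, ht.2.le⟩).mono_of_mem_nhdsWithin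
        (Icc_mem_nhdsGE_of_mem ht)) (primitive_zero f) fun t _ => ?_
    rw [norm_Jop]
    exact (B.extend t).le_of_opNorm_le (B.norm_extend_le t) _
  refine Lp.ext (hae.trans ?_)
  filter_upwards [ae_restrict_mem measurableSet_Ioc, Lp.coeFn_zero (Vec ℂ n) 2 circleMeasure]
    with t ht h1
  rw [h0 t (Set.Ioc_subset_Icc_self ht), map_zero, map_zero, h1, Pi.zero_apply]

/-- The operator `1 - J B ∫₀ᵗ`. -/
def volterraEq (B : LoopOp ℂ n) : L2 ℂ n →L[ℂ] L2 ℂ n :=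
  ContinuousLinearMap.id ℂ (L2 ℂ n) - volterra B

theorem volterraEq_apply (B : LoopOp ℂ n) (f : L2 ℂ n) :
    volterraEq B f = f - JL2 (mulL2 B (primitiveL f)) := rfl

/-- Identity plus approximable operator, so injectivity is enough; continuity of the inverse in `B`
then needs no estimate of solutions. -/
theorem isInvertible_volterraEq (B : LoopOp ℂ n) : (volterraEq B).IsInvertible := by
  have hK : -volterra B ∈ approximableOperators (L2 ℂ n) (L2 ℂ n) :=
    neg_mem (comp_left_mem_approximableOperators _
      (comp_left_mem_approximableOperators _ primitiveL_mem_approximableOperators))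
  obtain ⟨h1, h2⟩ := isFredholm_of_invertible_add (sub_eq_add_neg _ _)
    (⟨ContinuousLinearEquiv.refl ℂ (L2 ℂ n), rfl⟩ :
      (ContinuousLinearMap.id ℂ (L2 ℂ n)).IsInvertible) hK
  refine isInvertible_of_injective_of_finrank_eq h1 h2 ?_
  refine (injective_iff_map_eq_zero _).mpr fun f hf => eq_zero_of_volterra_eq B ?_
  exact (sub_eq_zero.mp hf).symm

theorem continuous_volterraEq : Continuous (volterraEq (n := n)) := by
  have h : Continuous fun B : LoopOp ℂ n => (JL2 ∘L mulL2 B ∘L primitiveL : L2 ℂ n →L[ℂ] L2 ℂ n) :=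
    ((mulL2 (𝕜 := ℂ) (n := n)).continuous.clm_comp continuous_const).const_clm_comp _
  exact continuous_const.sub h

/-- The inverse of `1 - J B ∫₀ᵗ`. -/
def resolventL2 (B : LoopOp ℂ n) : L2 ℂ n →L[ℂ] L2 ℂ n :=
  ContinuousLinearMap.inverse (volterraEq B)

theorem volterraEq_resolventL2 (B : LoopOp ℂ n) (f : L2 ℂ n) :
    volterraEq B (resolventL2 B f) = f :=
  (isInvertible_volterraEq B).self_apply_inverse f

theorem resolventL2_volterraEq (B : LoopOp ℂ n) (f : L2 ℂ n) :
    resolventL2 B (volterraEq B f) = f :=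
  (isInvertible_volterraEq B).inverse_apply_self f

theorem continuous_resolventL2 : Continuous (resolventL2 (n := n)) := by
  refine continuous_iff_continuousAt.mpr fun B => ?_
  obtain ⟨e, he⟩ := isInvertible_volterraEq B
  have h := (contDiffAt_map_inverse (n := 0) e).continuousAt
  rw [he] at h
  exact ContinuousAt.comp (g := ContinuousLinearMap.inverse) (f := volterraEq) h
    continuous_volterraEq.continuousAt

/-- The derivative of the solution of `J u' + B u = h` with initial value `c`. -/
def solutionDeriv (B : LoopOp ℂ n) : Vec ℂ n × L2 ℂ n →L[ℂ] L2 ℂ n :=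
  resolventL2 B ∘L (JL2 ∘L mulL2 B ∘L constL2 ∘L ContinuousLinearMap.fst ℂ (Vec ℂ n) (L2 ℂ n)
    - JL2 ∘L ContinuousLinearMap.snd ℂ (Vec ℂ n) (L2 ℂ n))

theorem solutionDeriv_apply (B : LoopOp ℂ n) (c : Vec ℂ n) (h : L2 ℂ n) :
    solutionDeriv B (c, h) = resolventL2 B (JL2 (mulL2 B (constL2 c)) - JL2 h) := rfl

theorem continuous_solutionDeriv : Continuous (solutionDeriv (n := n)) := by
  refine continuous_resolventL2.clm_comp (Continuous.sub ?_ continuous_const)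
  exact ((mulL2 (𝕜 := ℂ) (n := n)).continuous.clm_comp continuous_const).const_clm_comp _

/-- This is J u' + B u = h with u = c + ∫u', solved for u' by J⁻¹ = -J. -/
theorem solutionDeriv_eq (B : LoopOp ℂ n) (c : Vec ℂ n) (h : L2 ℂ n) :
    solutionDeriv B (c, h)
      = JL2 (mulL2 B (constL2 c + primitiveL (solutionDeriv B (c, h)))) - JL2 h := by
  have e := volterraEq_resolventL2 B (JL2 (mulL2 B (constL2 c)) - JL2 h)
  rw [← solutionDeriv_apply, volterraEq_apply, sub_eq_iff_eq_add] at e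
  rw [map_add, map_add, add_sub_right_comm]
  exact e

theorem firstOrderOp_eq (B : LoopOp ℂ n) (u : Sobolev ℂ n 2) :
    firstOrderOp B u = JL2 (derivL2 u) + mulL2 B (toL2 u) := by
  rw [firstOrderOp_apply, JL2_derivL2]

theorem solutionDeriv_firstOrderOp (B : LoopOp ℂ n) (u : Sobolev ℂ n 2) :
    solutionDeriv B (evalZero u, firstOrderOp B u) = derivL2 u := by
  rw [solutionDeriv_apply, ← resolventL2_volterraEq B (derivL2 u), volterraEq_apply, firstOrderOp_eq,
    toL2_eq_constL2_add_primitiveL u, map_add, map_add, map_add, JL2_JL2]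
  congr 1
  abel

/-- The vanishing integral of u' says that the solution of the initial value problem closes up, so
that it belongs to H¹ of the circle. -/
theorem firstOrderOp_reconstruct (B : LoopOp ℂ n) (c : Vec ℂ n) (h : L2 ℂ n)
    (hg : integralL2 (solutionDeriv B (c, h)) = 0) :
    firstOrderOp B (reconstruct (c, solutionDeriv B (c, h))) = h := by
  rw [firstOrderOp_eq, toL2_eq_constL2_add_primitiveL, derivL2_reconstruct _ hg,
    evalZero_reconstruct]
  conv_lhs => enter [1]; rw [solutionDeriv_eq]
  rw [map_sub, JL2_JL2, JL2_JL2]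
  abel

/-- The values of the fundamental solution of `J u' + B u = 0`. -/
def evolution (B : LoopOp ℂ n) (t : ℝ) (c : Vec ℂ n) : Vec ℂ n :=
  c + primitive (solutionDeriv B (c, 0)) t

theorem evolution_zero (B : LoopOp ℂ n) (c : Vec ℂ n) : evolution B 0 c = c := by
  rw [evolution, primitive_zero, add_zero]

theorem continuous_evolution (B : LoopOp ℂ n) (c : Vec ℂ n) :
    Continuous fun t => evolution B t c :=
  continuous_const.add (continuous_primitive _)

theorem hasDerivWithinAt_evolution (B : LoopOp ℂ n) (c : Vec ℂ n) {t : ℝ}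
    (ht : t ∈ Set.Icc 0 (2 * Real.pi)) : HasDerivWithinAt (fun t => evolution B t c)
      (Jop (B.extend t (evolution B t c))) (Set.Icc 0 (2 * Real.pi)) t := by
  refine (hasDerivWithinAt_primitive (φ := fun t => Jop (B.extend t (evolution B t c)))
    (continuous_Jop_extend B (continuous_evolution B c)) ?_ ht).const_add c
  have e := solutionDeriv_eq B c 0
  rw [map_zero, sub_zero] at e
  rw [e]
  refine coeFn_JL2_mulL2 B ?_
  filter_upwards [Lp.coeFn_add (constL2 c : L2 ℂ n) (primitiveL (solutionDeriv B (c, 0))),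
    coeFn_constL2 c, coeFn_primitiveL (solutionDeriv B (c, 0))] with t h1 h2 h3
  rw [h1, Pi.add_apply, h2, h3, evolution]

theorem evolution_add (B : LoopOp ℂ n) (t : ℝ) (c d : Vec ℂ n) :
    evolution B t (c + d) = evolution B t c + evolution B t d := by
  have h : ((c + d, 0) : Vec ℂ n × L2 ℂ n) = (c, 0) + (d, 0) := by simp
  rw [evolution, h, map_add, primitive_add, evolution, evolution]
  abel

theorem evolution_smul (B : LoopOp ℂ n) (t : ℝ) (a : ℂ) (c : Vec ℂ n) :
    evolution B t (a • c) = a • evolution B t c := by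
  have h : ((a • c, 0) : Vec ℂ n × L2 ℂ n) = a • (c, 0) := by simp
  rw [evolution, h, map_smul, primitive_smul, evolution, smul_add]

/-- The difference of the evolution over a period and the identity. -/
def periodMap (B : LoopOp ℂ n) : Vec ℂ n →L[ℂ] Vec ℂ n :=
  integralL2 ∘L solutionDeriv B ∘L ContinuousLinearMap.inl ℂ (Vec ℂ n) (L2 ℂ n)

theorem periodMap_apply (B : LoopOp ℂ n) (c : Vec ℂ n) :
    periodMap B c = integralL2 (solutionDeriv B (c, 0)) := rfl

theorem evolution_two_pi (B : LoopOp ℂ n) (c : Vec ℂ n) :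
    evolution B (2 * Real.pi) c = c + periodMap B c := by
  rw [evolution, primitive_two_pi, periodMap_apply]

theorem continuous_periodMap : Continuous (periodMap (n := n)) :=
  (continuous_solutionDeriv.clm_comp continuous_const).const_clm_comp _

/-- The defect `h ↦ -∫₀^{2π} u'` of the solution `u` of `J u' + B u = h` with initial value `0`. -/
def defectMap (B : LoopOp ℂ n) : L2 ℂ n →L[ℂ] Vec ℂ n :=
  integralL2 ∘L resolventL2 B ∘L JL2

/-- The increment u(2π) - u(0), split into the contributions of c and of h. So the solution is
periodic exactly if `periodMap B c = defectMap B h`, the relation that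
`HasIndexBundle.eq_mk_endTriple` requires. -/
theorem integralL2_solutionDeriv (B : LoopOp ℂ n) (c : Vec ℂ n) (h : L2 ℂ n) :
    integralL2 (solutionDeriv B (c, h)) = periodMap B c - defectMap B h := by
  rw [periodMap_apply, solutionDeriv_apply, solutionDeriv_apply, map_zero, sub_zero, map_sub,
    map_sub]
  rfl

theorem periodMap_evalZero (B : LoopOp ℂ n) (u : Sobolev ℂ n 2) :
    periodMap B (evalZero u) = defectMap B (firstOrderOp B u) := by
  rw [← sub_eq_zero, ← integralL2_solutionDeriv, solutionDeriv_firstOrderOp, integralL2_derivL2]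

/-- A vector in the kernel is the initial value of a periodic solution of J u' + B u = 0. -/
theorem bijective_periodMap {B : LoopOp ℂ n} (hB : Function.Injective (firstOrderOp B)) :
    Function.Bijective (periodMap B) := by
  have h : Function.Injective (periodMap B).toLinearMap := by
    refine (injective_iff_map_eq_zero _).mpr fun c hc => ?_
    have h0 : reconstruct (c, solutionDeriv B (c, 0)) = 0 := hB (by
      rw [firstOrderOp_reconstruct B c 0 hc, map_zero])
    rw [← evalZero_reconstruct c (solutionDeriv B (c, 0)), h0, map_zero]
  exact ⟨h, LinearMap.injective_iff_surjective.mp h⟩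

/-- A right inverse of the defect map. -/
def defectSection (B : LoopOp ℂ n) : Vec ℂ n →L[ℂ] L2 ℂ n :=
  (-((2 * Real.pi : ℝ) : ℂ)⁻¹) • JL2 ∘L volterraEq B ∘L constL2

theorem continuous_defectSection : Continuous (defectSection (n := n)) := by
  have h : Continuous fun B : LoopOp ℂ n => (JL2 ∘L volterraEq B ∘L constL2 : Vec ℂ n →L[ℂ] L2 ℂ n) :=
    (continuous_volterraEq.clm_comp continuous_const).const_clm_comp _
  exact h.const_smul (-((2 * Real.pi : ℝ) : ℂ)⁻¹)

theorem continuous_defectMap : Continuous (defectMap (n := n)) :=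
  (continuous_resolventL2.clm_comp continuous_const).const_clm_comp _

/-- The right-hand side is the one that belongs to u(t) = -tc/2π, which starts at 0 and whose
derivative has integral -c. -/
theorem defectMap_defectSection (B : LoopOp ℂ n) (c : Vec ℂ n) :
    defectMap B (defectSection B c) = c := by
  change integralL2 (resolventL2 B (JL2 ((-((2 * Real.pi : ℝ) : ℂ)⁻¹)
    • JL2 (volterraEq B (constL2 c))))) = c
  rw [map_smul, JL2_JL2, smul_neg, neg_smul, neg_neg, map_smul, map_smul, resolventL2_volterraEq,
    integralL2_constL2, inv_smul_smul₀ two_pi_complex_ne_zero]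

/-- The solution of `J u' + B u = h` with initial value `c`, if it exists. -/
def solution (B : LoopOp ℂ n) : Vec ℂ n × L2 ℂ n →L[ℂ] Sobolev ℂ n 2 :=
  reconstruct ∘L (ContinuousLinearMap.inl ℂ (Vec ℂ n) (L2 ℂ n)
    ∘L ContinuousLinearMap.fst ℂ (Vec ℂ n) (L2 ℂ n)
      + ContinuousLinearMap.inr ℂ (Vec ℂ n) (L2 ℂ n) ∘L solutionDeriv B)

theorem solution_apply (B : LoopOp ℂ n) (c : Vec ℂ n) (h : L2 ℂ n) :
    solution B (c, h) = reconstruct (c, solutionDeriv B (c, h)) := by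
  have e : (ContinuousLinearMap.inl ℂ (Vec ℂ n) (L2 ℂ n)
      ∘L ContinuousLinearMap.fst ℂ (Vec ℂ n) (L2 ℂ n)
      + ContinuousLinearMap.inr ℂ (Vec ℂ n) (L2 ℂ n) ∘L solutionDeriv B) (c, h)
      = (c, solutionDeriv B (c, h)) := by
    simp
  rw [← e, solution, ContinuousLinearMap.comp_apply]

theorem continuous_solution : Continuous (solution (n := n)) := by
  refine Continuous.const_clm_comp (Continuous.add continuous_const ?_) _
  exact continuous_solutionDeriv.const_clm_comp _

theorem isClosed_supp_endTriple {Z : Type u} [TopologicalSpace Z] {F : Type} [NormedAddCommGroup F]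
    [NormedSpace ℂ F] [FiniteDimensional ℂ F] (M : C(Z, F →L[ℂ] F)) :
    IsClosed (endTriple M).supp := by
  have := FiniteDimensional.complete ℂ F
  have h : (endTriple M).suppᶜ = {z | (M z).IsInvertible} := by
    ext z
    rw [Set.mem_compl_iff]
    refine not_not.trans ⟨fun hb => ?_, fun ⟨e, he⟩ => ?_⟩
    · exact ⟨(LinearEquiv.ofBijective (M z).toLinearMap hb).toContinuousLinearEquiv,
        ContinuousLinearMap.ext fun _ => rfl⟩
    · change Function.Bijective (M z)
      rw [← he]
      exact e.bijective
  rw [← isOpen_compl_iff, h]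
  exact (ContinuousLinearEquiv.isOpen (𝕜 := ℂ) (E := F) (F := F)).preimage M.continuous

/-- The index bundle of the operators `u ↦ J u' + B_z u` of order one on the circle is the class of
the differences of their evolutions over a period and the identity. -/
theorem HasIndexBundle.eq_mk_periodMap {Z : Type u} [TopologicalSpace Z]
    {T : C(Z, Sobolev ℂ n 2 →L[ℂ] L2 ℂ n)} {Y : Set Z} {κ : KTheory Z Y}
    (hT : HasIndexBundle T Y κ) (B : C(Z, LoopOp ℂ n)) (hB : ∀ z, T z = firstOrderOp (B z))
    (M : C(Z, Vec ℂ n →L[ℂ] Vec ℂ n)) (hM : ∀ z, M z = periodMap (B z)) :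
    ∃ h : (endTriple M).IsRelative Y, κ = KTheory.mk (endTriple M) h := by
  have hbij : ∀ z, (T z).IsInvertible → Function.Bijective (M z) := fun z ⟨e, he⟩ => by
    rw [hM]
    refine bijective_periodMap ?_
    rw [← hB, ← he]
    exact e.injective
  obtain ⟨K, hK, hTK⟩ := hT.exists_isCompact
  have hrel : (endTriple M).IsRelative Y := by
    refine ⟨hK.of_isClosed_subset ?_ fun z hz => ?_, Set.disjoint_left.mpr fun z hz hzY =>
      hz (hbij z (hT.isInvertible z hzY))⟩
    · exact isClosed_supp_endTriple M
    · by_contra hzK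
      exact hz (hbij z (hTK z hzK))
  refine ⟨hrel, hT.eq_mk_endTriple evalZero M
    ⟨fun z => defectMap (B z), continuous_defectMap.comp B.continuous⟩
    ⟨fun z => defectSection (B z), continuous_defectSection.comp B.continuous⟩
    (fun z c => defectMap_defectSection (B z) c)
    ⟨fun z => solution (B z), continuous_solution.comp B.continuous⟩
    (fun z u => ?_) (fun z c h hc => ?_) (fun z u => ?_) hrel⟩
  · rw [hM, hB]
    exact periodMap_evalZero (B z) u
  · have hg : integralL2 (solutionDeriv (B z) (c, h)) = 0 := by
      rw [integralL2_solutionDeriv, ← hM, hc]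
      exact sub_self _
    rw [hB, ContinuousMap.coe_mk, solution_apply]
    exact ⟨evalZero_reconstruct _ _, firstOrderOp_reconstruct (B z) c h hg⟩
  · rw [hB, ContinuousMap.coe_mk, solution_apply, solutionDeriv_firstOrderOp,
      reconstruct_evalZero_derivL2]

end Volterra

/-! ### The fundamental solution, its symplecticity and the monodromy index. -/

section Monodromy

open Sobolev

variable {n : ℕ}

theorem matVec_of_columns (f : Vec ℂ n →ₗ[ℂ] Vec ℂ n) (c : Vec ℂ n) :
    matVec (Matrix.of fun i j => (f (EuclideanSpace.single j 1)).ofLp i) c = f c := by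
  have hc : c = ∑ j, c j • EuclideanSpace.single j (1 : ℂ) := by
    simpa using ((EuclideanSpace.basisFun (Fin n ⊕ Fin n) ℂ).sum_repr c).symm
  conv_rhs => rw [hc, map_sum]
  ext i
  rw [WithLp.ofLp_sum, Finset.sum_apply]
  simp [matVec, Matrix.mulVec, dotProduct, mul_comm]

/-- The fundamental solution of `J u' + B u = 0`. -/
def fundamentalMatrix (B : LoopOp ℂ n) (t : ℝ) : Matrix (Fin n ⊕ Fin n) (Fin n ⊕ Fin n) ℂ :=
  Matrix.of fun i j => (evolution B t (EuclideanSpace.single j 1)).ofLp i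

theorem fundamentalMatrix_mulVec (B : LoopOp ℂ n) (t : ℝ) (c : Vec ℂ n) :
    fundamentalMatrix B t *ᵥ c.ofLp = (evolution B t c).ofLp :=
  congrArg WithLp.ofLp (matVec_of_columns
    ⟨⟨evolution B t, evolution_add B t⟩, evolution_smul B t⟩ c)

theorem fundamentalMatrix_zero (B : LoopOp ℂ n) : fundamentalMatrix B 0 = 1 := by
  ext i j
  rw [fundamentalMatrix, Matrix.of_apply, evolution_zero, Matrix.one_apply]
  simp

theorem hasDerivWithinAt_apply {f : ℝ → Vec ℂ n} {f' : Vec ℂ n} {s : Set ℝ} {t : ℝ}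
    (h : HasDerivWithinAt f f' s t) (i : Fin n ⊕ Fin n) :
    HasDerivWithinAt (fun τ => (f τ).ofLp i) (f'.ofLp i) s t :=
  (((EuclideanSpace.proj i : Vec ℂ n →L[ℂ] ℂ).restrictScalars ℝ).hasFDerivAt).comp_hasDerivWithinAt
    t h

theorem isFundamentalSolution_fundamentalMatrix (B : LoopOp ℂ n)
    (S : ℝ → Matrix (Fin n ⊕ Fin n) (Fin n ⊕ Fin n) ℝ) (s : ℝ)
    (hB : ∀ t ∈ Set.Icc 0 (2 * Real.pi),
      B.extend t = matVecL ((S t).map Complex.ofReal + (Complex.I * (s : ℂ)) • 1)) :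
    IsFundamentalSolution S s (fundamentalMatrix B) := by
  refine ⟨fundamentalMatrix_zero B, fun t => Matrix.J (Fin n) ℂ *
    (((S t).map Complex.ofReal + (Complex.I * (s : ℂ)) • 1) * fundamentalMatrix B t),
    fun t ht => ⟨fun i j => ?_, ?_⟩⟩
  · have h := hasDerivWithinAt_apply
      (hasDerivWithinAt_evolution B (EuclideanSpace.single j 1) ht) i
    rw [hB t ht] at h
    exact h
  · rw [← Matrix.mul_assoc, Matrix.J_squared, Matrix.add_mul, Matrix.smul_mul, Matrix.one_mul]
    simp only [neg_mul, one_mul]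
    abel

theorem mulVec_dotProduct (A : Matrix (Fin n ⊕ Fin n) (Fin n ⊕ Fin n) ℂ)
    (v w : Fin n ⊕ Fin n → ℂ) : (A *ᵥ v) ⬝ᵥ w = v ⬝ᵥ (Aᵀ *ᵥ w) := by
  rw [Matrix.dotProduct_mulVec, Matrix.vecMul_transpose]

theorem J_transpose_mul_J : (Matrix.J (Fin n) ℂ)ᵀ * Matrix.J (Fin n) ℂ = 1 := by
  rw [Matrix.J_transpose, neg_mul, Matrix.J_squared, neg_neg]

/-- The evolution preserves the complexified symplectic form. -/
theorem evolution_dotProduct (B : LoopOp ℂ n) (N : ℝ → Matrix (Fin n ⊕ Fin n) (Fin n ⊕ Fin n) ℂ)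
    (hN : ∀ t, (N t)ᵀ = N t) (hB : ∀ t ∈ Set.Icc 0 (2 * Real.pi), B.extend t = matVecL (N t))
    (c d : Vec ℂ n) {t : ℝ} (ht : t ∈ Set.Icc 0 (2 * Real.pi)) :
    (evolution B t c).ofLp ⬝ᵥ (Matrix.J (Fin n) ℂ *ᵥ (evolution B t d).ofLp)
      = c.ofLp ⬝ᵥ (Matrix.J (Fin n) ℂ *ᵥ d.ofLp) := by
  -- The derivative is N x · y - x · N y by JᵀJ = 1 and J² = -1. The dot product is bilinear,
  -- without conjugation, so the symmetry of N suffices; for s ≠ 0 the matrix S + is is symmetric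
  -- but not Hermitian.
  have hd : ∀ t ∈ Set.Icc 0 (2 * Real.pi), HasDerivWithinAt
      (fun t => (evolution B t c).ofLp ⬝ᵥ (Matrix.J (Fin n) ℂ *ᵥ (evolution B t d).ofLp)) 0
      (Set.Icc 0 (2 * Real.pi)) t := fun t ht => by
    have h1 := hasDerivWithinAt_evolution B c ht
    have h2 := ((Jop (𝕜 := ℂ) (n := n)).restrictScalars ℝ).hasFDerivAt.comp_hasDerivWithinAt t
      (hasDerivWithinAt_evolution B d ht)
    rw [hB t ht] at h1 h2
    have h3 := HasDerivWithinAt.fun_sum (u := Finset.univ) fun (i : Fin n ⊕ Fin n) _ =>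
      (hasDerivWithinAt_apply h1 i).fun_mul (hasDerivWithinAt_apply h2 i)
    refine h3.congr_deriv ?_
    rw [Finset.sum_add_distrib]
    set x := (evolution B t c).ofLp
    set y := (evolution B t d).ofLp
    change (Matrix.J (Fin n) ℂ *ᵥ (N t *ᵥ x)) ⬝ᵥ (Matrix.J (Fin n) ℂ *ᵥ y)
      + x ⬝ᵥ (Matrix.J (Fin n) ℂ *ᵥ (Matrix.J (Fin n) ℂ *ᵥ (N t *ᵥ y))) = 0
    rw [mulVec_dotProduct, Matrix.mulVec_mulVec, J_transpose_mul_J, Matrix.one_mulVec,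
      mulVec_dotProduct, hN, Matrix.mulVec_mulVec (N t *ᵥ y), Matrix.J_squared,
      Matrix.neg_mulVec, Matrix.one_mulVec, dotProduct_neg, add_neg_cancel]
  have h := constant_of_has_deriv_right_zero (fun t ht => (hd t ht).continuousWithinAt)
    (fun t ht => (hd t ⟨ht.1, ht.2.le⟩).mono_of_mem_nhdsWithin (Icc_mem_nhdsGE_of_mem ht)) t ht
  rwa [evolution_zero, evolution_zero] at h

/-- The fundamental solution is symplectic. -/
theorem fundamentalMatrix_symplectic (B : LoopOp ℂ n)
    (N : ℝ → Matrix (Fin n ⊕ Fin n) (Fin n ⊕ Fin n) ℂ) (hN : ∀ t, (N t)ᵀ = N t)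
    (hB : ∀ t ∈ Set.Icc 0 (2 * Real.pi), B.extend t = matVecL (N t)) {t : ℝ}
    (ht : t ∈ Set.Icc 0 (2 * Real.pi)) :
    (fundamentalMatrix B t)ᵀ * Matrix.J (Fin n) ℂ * fundamentalMatrix B t
      = Matrix.J (Fin n) ℂ := by
  ext i j
  rw [Matrix.mul_assoc]
  refine (evolution_dotProduct B N hN hB (EuclideanSpace.single i 1) (EuclideanSpace.single j 1)
    ht).trans ?_
  simp

variable {Z : Type u} [TopologicalSpace Z]

/-- The isomorphism of product bundles given by invertible matrices. -/
def matrixIso (P Q : C(Z, Matrix (Fin n ⊕ Fin n) (Fin n ⊕ Fin n) ℂ)) (hPQ : ∀ z, P z * Q z = 1)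
    (hQP : ∀ z, Q z * P z = 1) : VectorFamily.Iso (VectorFamily.productBundle Z (Vec ℂ n))
      (VectorFamily.productBundle Z (Fin n ⊕ Fin n → ℂ)) where
  equiv z :=
    { toFun := fun (c : Vec ℂ n) => P z *ᵥ c.ofLp
      invFun := fun v => (WithLp.toLp 2 (Q z *ᵥ v) : Vec ℂ n)
      map_add' := fun (c d : Vec ℂ n) => Matrix.mulVec_add (P z) c.ofLp d.ofLp
      map_smul' := fun a (c : Vec ℂ n) => Matrix.mulVec_smul (P z) a c.ofLp
      left_inv := fun (c : Vec ℂ n) => by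
        change (WithLp.toLp 2 (Q z *ᵥ (P z *ᵥ c.ofLp)) : Vec ℂ n) = c
        rw [Matrix.mulVec_mulVec, hQP, Matrix.one_mulVec]
      right_inv := fun (v : Fin n ⊕ Fin n → ℂ) => by
        change P z *ᵥ (Q z *ᵥ v) = v
        rw [Matrix.mulVec_mulVec, hPQ, Matrix.one_mulVec] }
  continuous_total := by
    have h := VectorFamily.continuous_productBundle_pair (Z := Z) (V := Vec ℂ n)
    exact VectorFamily.continuous_to_productBundle (continuous_fst.comp h)
      ((P.continuous.comp (continuous_fst.comp h)).matrix_mulVec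
        ((PiLp.continuous_ofLp 2 _).comp (continuous_snd.comp h)))
  continuous_symm_total := by
    have h := VectorFamily.continuous_productBundle_pair (Z := Z) (V := Fin n ⊕ Fin n → ℂ)
    exact VectorFamily.continuous_to_productBundle (continuous_fst.comp h)
      ((PiLp.continuous_toLp 2 _).comp ((Q.continuous.comp (continuous_fst.comp h)).matrix_mulVec
        (continuous_snd.comp h)))

/-- From Ψᵀ J Ψ = J one gets (1 - Ψ)ᵀ J Ψ = J Ψ - J = J (Ψ - 1). So JΨ on the source and J on the
target form an isomorphism of triples, which accounts for the transpose and the sign in Λ. -/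
theorem endTriple_isomorphic_matrixTriple (Ψ : C(Z, Matrix (Fin n ⊕ Fin n) (Fin n ⊕ Fin n) ℂ))
    (hΨ : ∀ z, (Ψ z)ᵀ * Matrix.J (Fin n) ℂ * Ψ z = Matrix.J (Fin n) ℂ)
    (M : C(Z, Vec ℂ n →L[ℂ] Vec ℂ n)) (hM : ∀ z c, (M z c).ofLp = Ψ z *ᵥ c.ofLp - c.ofLp)
    (Λ : C(Z, Matrix (Fin n ⊕ Fin n) (Fin n ⊕ Fin n) ℂ)) (hΛ : ∀ z, Λ z = (1 - Ψ z)ᵀ) :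
    Triple.Isomorphic (endTriple M) (matrixTriple Λ) := by
  have hJ : (-Matrix.J (Fin n) ℂ) * Matrix.J (Fin n) ℂ = 1 := by
    rw [neg_mul, Matrix.J_squared, neg_neg]
  have hJ' : Matrix.J (Fin n) ℂ * (-Matrix.J (Fin n) ℂ) = 1 := by
    rw [mul_neg, Matrix.J_squared, neg_neg]
  have hQP : ∀ z, (-Matrix.J (Fin n) ℂ * (Ψ z)ᵀ) * (Matrix.J (Fin n) ℂ * Ψ z) = 1 := fun z => by
    rw [Matrix.mul_assoc, ← Matrix.mul_assoc (Ψ z)ᵀ, hΨ, hJ]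
  refine ⟨matrixIso ⟨fun z => Matrix.J (Fin n) ℂ * Ψ z, by fun_prop⟩
    ⟨fun z => -Matrix.J (Fin n) ℂ * (Ψ z)ᵀ, by fun_prop⟩
    (fun z => mul_eq_one_comm.mp (hQP z)) hQP,
    matrixIso ⟨fun _ => Matrix.J (Fin n) ℂ, continuous_const⟩
      ⟨fun _ => -Matrix.J (Fin n) ℂ, continuous_const⟩ (fun _ => hJ') (fun _ => hJ),
    fun z (c : Vec ℂ n) => ?_⟩
  change Λ z *ᵥ ((Matrix.J (Fin n) ℂ * Ψ z) *ᵥ c.ofLp) = Matrix.J (Fin n) ℂ *ᵥ (M z c).ofLp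
  rw [hΛ, hM, Matrix.mulVec_mulVec, Matrix.transpose_sub, Matrix.transpose_one, Matrix.sub_mul,
    Matrix.one_mul, ← Matrix.mul_assoc, hΨ, Matrix.sub_mulVec, Matrix.mulVec_sub,
    Matrix.mulVec_mulVec]

variable {X : Type u} [TopologicalSpace X] {𝓗 : X → ℝ → Vec ℝ n → ℝ}

namespace IsHamiltonianFamily

/-- The loops of operators `S_x(t) + i s`. -/
def suspendedLoop (h𝓗 : IsHamiltonianFamily 𝓗) : C(X × ℝ, LoopOp ℂ n) where
  toFun z := h𝓗.complexHessianLoop z.1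
    + (Complex.I * (z.2 : ℂ)) • ContinuousMap.const _ (ContinuousLinearMap.id ℂ (Vec ℂ n))
  continuous_toFun := by
    have h : Continuous fun z : X × ℝ => Complex.I * (z.2 : ℂ) := by fun_prop
    exact (h𝓗.complexHessianLoop.continuous.comp continuous_fst).add (h.smul continuous_const)

theorem suspendedLoop_apply (h𝓗 : IsHamiltonianFamily 𝓗) (z : X × ℝ) :
    h𝓗.suspendedLoop z = h𝓗.complexHessianLoop z.1
      + (Complex.I * (z.2 : ℂ)) • ContinuousMap.const _ (ContinuousLinearMap.id ℂ (Vec ℂ n)) := rfl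

theorem suspendedLoop_extend (h𝓗 : IsHamiltonianFamily 𝓗) (z : X × ℝ) {t : ℝ}
    (ht : t ∈ Set.Icc 0 (2 * Real.pi)) : (h𝓗.suspendedLoop z).extend t
      = matVecL ((hessianMatrix 𝓗 z.1 t).map Complex.ofReal + (Complex.I * (z.2 : ℂ)) • 1) := by
  rw [LoopOp.extend_of_mem _ ht, suspendedLoop_apply, map_add, map_smul]
  have h : matVecL (1 : Matrix (Fin n ⊕ Fin n) (Fin n ⊕ Fin n) ℂ)
      = ContinuousLinearMap.id ℂ (Vec ℂ n) := by
    ext v i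
    simp [matVecL_apply, matVec]
  rw [h]
  rfl

/-- The parameter i s becomes part of the coefficient loop, so that the suspended family again
consists of operators J u' + B u. -/
theorem suspension_spectralFamily (h𝓗 : IsHamiltonianFamily 𝓗) (z : X × ℝ) :
    suspension toL2 h𝓗.spectralFamily z = firstOrderOp (h𝓗.suspendedLoop z) := by
  have hc : mulL2 (ContinuousMap.const _ (ContinuousLinearMap.id ℂ (Vec ℂ n)) : LoopOp ℂ n)
      = ContinuousLinearMap.id ℂ (L2 ℂ n) := by
    refine ContinuousLinearMap.ext fun f => Lp.ext ?_
    filter_upwards [coeFn_mulL2 (ContinuousMap.const _ (ContinuousLinearMap.id ℂ (Vec ℂ n))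
      : LoopOp ℂ n) f] with t ht
    rw [ht]
    rfl
  refine ContinuousLinearMap.ext fun u => ?_
  have hs : h𝓗.spectralFamily z.1 = firstOrderOp (h𝓗.complexHessianLoop z.1) := rfl
  rw [suspension_apply, hs, _root_.add_apply, _root_.smul_apply, firstOrderOp_apply,
    firstOrderOp_apply, suspendedLoop_apply, map_add, map_smul, hc, _root_.add_apply,
    _root_.smul_apply, ContinuousLinearMap.id_apply, add_assoc]

/-- The index bundle of the first order operators is the monodromy index. -/
theorem hasMonodromyIndex (h𝓗 : IsHamiltonianFamily 𝓗) {Y : Set X} {κ : KMinusOne X Y}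
    (hκ : HasIndexBundle (suspension toL2 h𝓗.spectralFamily) (Y ×ˢ Set.univ) κ) :
    HasMonodromyIndex 𝓗 Y κ := by
  let B := h𝓗.suspendedLoop
  let M : C(X × ℝ, Vec ℂ n →L[ℂ] Vec ℂ n) :=
    ⟨fun z => periodMap (B z), continuous_periodMap.comp B.continuous⟩
  have hT : (2 * Real.pi) ∈ Set.Icc 0 (2 * Real.pi) := Set.right_mem_Icc.mpr Real.two_pi_pos.le
  let Ψ : C(X × ℝ, Matrix (Fin n ⊕ Fin n) (Fin n ⊕ Fin n) ℂ) :=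
    ⟨fun z => fundamentalMatrix (B z) (2 * Real.pi), continuous_matrix fun i j => by
      have h : (fun z => fundamentalMatrix (B z) (2 * Real.pi) i j)
          = fun z => (EuclideanSpace.single j (1 : ℂ) + M z (EuclideanSpace.single j 1)).ofLp i := by
        funext z
        exact congrArg (fun v : Vec ℂ n => v.ofLp i) (evolution_two_pi (B z) _)
      rw [h]
      fun_prop⟩
  have hΨ : ∀ z, (Ψ z)ᵀ * Matrix.J (Fin n) ℂ * Ψ z = Matrix.J (Fin n) ℂ := fun z => by
    refine fundamentalMatrix_symplectic (B z) _ (fun t => ?_)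
      (fun t ht => h𝓗.suspendedLoop_extend z ht) hT
    rw [Matrix.transpose_add, Matrix.transpose_smul, Matrix.transpose_one, ← Matrix.transpose_map,
      h𝓗.hessianMatrix_isSymm]
  have hM : ∀ z c, (M z c).ofLp = Ψ z *ᵥ c.ofLp - c.ofLp := fun z c => by
    refine Eq.trans ?_ (congrArg (fun v => v - c.ofLp)
      (fundamentalMatrix_mulVec (B z) (2 * Real.pi) c)).symm
    rw [evolution_two_pi, WithLp.ofLp_add, add_sub_cancel_left]
    rfl
  let Λ : C(X × ℝ, Matrix (Fin n ⊕ Fin n) (Fin n ⊕ Fin n) ℂ) := ⟨fun z => (1 - Ψ z)ᵀ, by fun_prop⟩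
  obtain ⟨hrel, rfl⟩ := hκ.eq_mk_periodMap B h𝓗.suspension_spectralFamily M fun _ => rfl
  have hiso := endTriple_isomorphic_matrixTriple Ψ hΨ M hM Λ fun _ => rfl
  have hrel' : (matrixTriple Λ).IsRelative (Y ×ˢ Set.univ) := by
    rw [Triple.IsRelative, ← hiso.supp_eq]
    exact hrel
  exact ⟨fun z => fundamentalMatrix (B z), Λ, fun z =>
    isFundamentalSolution_fundamentalMatrix (B z) _ z.2 fun t ht => h𝓗.suspendedLoop_extend z ht,
    fun _ => rfl, hrel', KTheory.mk_eq_of_isomorphic _ _ hiso⟩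

end IsHamiltonianFamily

end Monodromy

end

end HamiltonianIndex

theorem theorem3p4 {X : Type u} [TopologicalSpace X] [CompactSpace X] (Y : Set X) (hY : IsClosed Y)
    (n : ℕ) (𝓗 : X → ℝ → HamiltonianIndex.Vec ℝ n → ℝ)
    (h𝓗 : HamiltonianIndex.IsHamiltonianFamily 𝓗)
    (hadm : HamiltonianIndex.IsAdmissible 𝓗 Y) :
    ∃ κ : HamiltonianIndex.KMinusOne X Y,
      HamiltonianIndex.HasMorseIndex 𝓗 Y κ ∧
      HamiltonianIndex.HasSpectralIndex 𝓗 Y κ ∧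
      HamiltonianIndex.HasMonodromyIndex 𝓗 Y κ := by
  obtain ⟨κ, hMorse, hspec⟩ := h𝓗.exists_hasMorseIndex Y hadm
  exact ⟨κ, hMorse, ⟨h𝓗.spectralFamily, h𝓗.coeFn_spectralFamily, hspec⟩,
    h𝓗.hasMonodromyIndex hspec.hasIndexBundle⟩
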